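/- **Part 1 (gradient systems).** Let $H$ be a separable real Hilbert space and let $X$ be a Banach space that is densely and compactly embedded in $H$ (the domain $X=D(V')$). Let $V:X\to\mathbb R$ be a $C^2$ functional whose derivative is represented in $H$, $DV(u)v=\langle V'(u),v\rangle_H$ for $u,v\in X$, with $V':X\to H$ of class $C^1$; write $V''(u):X\to H$ for the derivative of $V'$ at $u$ and $\Phi=\{\psi\in X: V'(\psi)=0\}$. Assume that for every $\psi\in\Phi$ the operator $V''(\psi)$ is Fredholm of index zero and has a self-adjoint extension in $H$ with discrete spectrum, compact resolvent and a complete set of eigenfunctions. Assume moreover hypothesis $(H_R)$: whenever $\psi\in\Phi$ is not isolated in $\Phi$ (branching occurs at $\psi$) and $k=\dim\ker V''(\psi)\ge 1$, there is a $k$-dimensional $C^1$ surface in $X$ through $\psi$ that consists of equilibria. Let $u\in C((0,\infty);X)$ be differentiable as an $H$-valued function and satisfy $u_t=V'(u)$ for all $t>0$. Suppose that $u$ is bounded in $X$ and has the smoothing property of smooth flows: if $s_n\to\infty$ and $u(s_n)$ converges in $H$, then $u(s_n)$ converges in $X$. Then there is a single equilibrium $\psi\in\Phi$ with $u(t)\to\psi$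 in $X$ as $t\to\infty$. If $\ker V''(\psi)=\{0\}$ or $\psi$ is not isolated in $\Phi$ (that is, unless $\psi$ is an isolated degenerate equilibrium), the convergence is exponential: $\|u(t)-\psi\|_H\le Ce^{-\delta t}$ for all $t>0$, with some constants $C$ and $\delta>0$. **Part 2 (parabolic equations of order $2m$).** Let $m,N\ge1$, let $\Omega\subset\mathbb R^N$ be a bounded open set and let $f\in C^1(\mathbb R)$. Let $D=\{u\in H^m_0(\Omega):\Delta^m u\in L^2(\Omega)\}$ with the graph norm $\max(\|u\|_{L^2},\|\Delta^m u\|_{L^2})$ (so $D=H^{2m}(\Omega)\cap H_0^m(\Omega)$ if $\partial\Omega$ is smooth), and let $\Phi_M$ be the set of $\psi\in D$ with $|\psi|\le M$ a.e. and $(-1)^{m+1}\Delta^m\psi+f(\psi)=0$. Call $\psi$ a branching point if, for some $M$, it is an accumulation point of $\Phi_M$ in $D$. Assume $(H_R)$: whenever $\psi\in\bigcup_M\Phi_M$ is a branching point and $k=\dim\ker\big((-1)^{m+1}\Delta^m+f'(\psi)\big)\ge1$ (kernel in $D$), there are $M$ and a $k$-dimensional $C^1$ surface in $D$ through $\psi$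 that is contained in $\Phi_M$. Let $u\in C((0,\infty);D)$ be differentiable as an $L^2(\Omega)$-valued function, satisfy $$u_t=(-1)^{m+1}\Delta^m u+f(u),\qquad t>0,$$ and let $|u(t)|\le M$ a.e. in $\Omega$ for all $t>0$. Then there is $\psi\in\Phi_M$ with $u(t)\to\psi$ in $D$ as $t\to\infty$. If the kernel of $(-1)^{m+1}\Delta^m+f'(\psi)$ is trivial or $\psi$ is a branching point, then $\|u(t)-\psi\|_{L^2(\Omega)}\le Ce^{-\delta t}$ for all $t>0$, with some constants $C$ and $\delta>0$. -/

import Mathlib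

open Filter Topology MeasureTheory
open scoped ContDiff Laplacian InnerProductSpace

noncomputable section

namespace GradientFlow

/-! ### Gradient systems in a Hilbert space -/

section Abstract

variable {H X : Type*} [NormedAddCommGroup H] [InnerProductSpace ℝ H]
  [NormedAddCommGroup X] [NormedSpace ℝ X]

/-- `ι : X → H` is the dense, compact embedding of the domain `X = D(V')` into `H`, the functional
`V` is of class `C²` on `X`, and `V' : X → H` is its gradient with respect to the inner product
of `H`; `V'` is of class `C¹`, so that the linearization `V''(u) = fderiv ℝ V' u` is a bounded
operator `X → H`. -/
structure IsGradientSystem (ι : X →L[ℝ] H) (V : X → ℝ) (V' : X → H) : Prop where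
  injective : Function.Injective ι
  denseRange : DenseRange ι
  compact : IsCompactOperator ι
  contDiff_functional : ContDiff ℝ 2 V
  gradient : ∀ u v : X, fderiv ℝ V u v = ⟪V' u, ι v⟫_ℝ
  contDiff_gradient : ContDiff ℝ 1 V'

/-- A Fredholm operator whose index `dim ker L - dim coker L` vanishes. -/
def IsFredholmIndexZero (L : X →L[ℝ] H) : Prop :=
  L.IsFredholm ∧ Module.finrank ℝ L.ker = Module.finrank ℝ (H ⧸ L.range)

/-- `R` is the resolvent `(A - c)⁻¹` of the unbounded operator `A`. -/
def IsResolvent (A : H →ₗ.[ℝ] H) (c : ℝ) (R : H →L[ℝ] H) : Prop :=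
  (∀ y : H, ∃ h : R y ∈ A.domain, A ⟨R y, h⟩ - c • R y = y) ∧
    ∀ x : A.domain, R (A x - c • (x : H)) = x

/-- The (real) spectrum of an unbounded operator. -/
def unboundedSpectrum (A : H →ₗ.[ℝ] H) : Set ℝ :=
  {c | ¬ ∃ R : H →L[ℝ] H, IsResolvent A c R}

/-- The eigenspace of an unbounded operator, as a subspace of `H`. -/
def unboundedEigenspace (A : H →ₗ.[ℝ] H) (c : ℝ) : Submodule ℝ H :=
  (LinearMap.ker (A.toFun - c • A.domain.subtype)).map A.domain.subtype

/-- The spectrum of `A` consists of isolated eigenvalues of finite multiplicity. -/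
def HasDiscreteSpectrum (A : H →ₗ.[ℝ] H) : Prop :=
  (∀ c : ℝ, ¬ AccPt c (𝓟 (unboundedSpectrum A))) ∧
    ∀ c ∈ unboundedSpectrum A,
      unboundedEigenspace A c ≠ ⊥ ∧ FiniteDimensional ℝ (unboundedEigenspace A c)

/-- `L : X → H`, regarded as an operator in `H` with domain `ι X`, has a self-adjoint extension
with discrete spectrum, compact resolvent and a complete set of eigenfunctions. -/
def HasDiscreteSelfAdjointExtension [CompleteSpace H] (ι L : X →L[ℝ] H) : Prop :=
  ∃ A : H →ₗ.[ℝ] H,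
    IsSelfAdjoint A ∧
    (∀ x : X, ∃ h : ι x ∈ A.domain, A ⟨ι x, h⟩ = L x) ∧
    HasDiscreteSpectrum A ∧
    (∃ c : ℝ, ∃ R : H →L[ℝ] H, IsResolvent A c R ∧ IsCompactOperator R) ∧
    (⨆ c : ℝ, unboundedEigenspace A c).topologicalClosure = ⊤

/-- The set of equilibria. -/
def equilibria (V' : X → H) : Set X := {ψ | V' ψ = 0}

/-- `S` contains a `k`-dimensional `C¹` surface through `ψ`, given by local coordinates
`μ ↦ ψ_μ`, `μ ∈ ℝᵏ` near `0`, `ψ_0 = ψ`. -/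
def HasSurfaceThrough (S : Set X) (ψ : X) (k : ℕ) : Prop :=
  ∃ p : EuclideanSpace ℝ (Fin k) → X,
    p 0 = ψ ∧ ContDiffAt ℝ 1 p 0 ∧ Function.Injective (fderiv ℝ p 0) ∧ ∀ᶠ μ in 𝓝 0, p μ ∈ S

/-- Resonance branching: at every equilibrium `ψ` at which branching occurs (that is, `ψ` is not
isolated among the equilibria) and `dim ker V''(ψ) = k ≥ 1`, the equilibria form a `k`-dimensional
surface through `ψ`. -/
def ResonanceBranching (V' : X → H) : Prop :=
  ∀ ψ ∈ equilibria V', AccPt ψ (𝓟 (equilibria V')) →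
    1 ≤ Module.finrank ℝ (fderiv ℝ V' ψ).ker →
    HasSurfaceThrough (equilibria V') ψ (Module.finrank ℝ (fderiv ℝ V' ψ).ker)

/-- A global orbit of `u_t = V'(u)`, `t > 0`, of a smooth flow. The last condition is the smoothing
property of such flows: along the orbit, as `t → ∞`, convergence in `H` implies convergence
in the domain `X`. -/
structure IsSmoothOrbit (ι : X →L[ℝ] H) (V' : X → H) (u : ℝ → X) : Prop where
  continuousOn : ContinuousOn u (Set.Ioi 0)
  equation : ∀ t > 0, HasDerivAt (fun s => ι (u s)) (V' (u t)) t
  smoothing : ∀ s : ℕ → ℝ, Tendsto s atTop atTop →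
    CauchySeq (fun n => ι (u (s n))) → CauchySeq (fun n => u (s n))

/-- `v(t)` converges to `a` exponentially fast. -/
def ConvergesExponentially (v : ℝ → H) (a : H) : Prop :=
  ∃ C δ : ℝ, 0 < δ ∧ ∀ t > 0, ‖v t - a‖ ≤ C * Real.exp (-(δ * t))

end Abstract

/-! ### The parabolic equation `u_t = (-1)^(m+1) Δ^m u + f(u)` with Dirichlet conditions -/

section Polyharmonic

variable {N : ℕ}

/-- The real space `L²(Ω)`. -/
abbrev L2 (Ω : Set (EuclideanSpace ℝ (Fin N))) : Type := Lp ℝ 2 (volume.restrict Ω)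

/-- Test functions: smooth, with compact support in `Ω`. -/
structure IsTest (Ω : Set (EuclideanSpace ℝ (Fin N))) (φ : EuclideanSpace ℝ (Fin N) → ℝ) :
    Prop where
  contDiff : ContDiff ℝ ∞ φ
  hasCompactSupport : HasCompactSupport φ
  tsupport_subset : tsupport φ ⊆ Ω

/-- `u ∈ H₀ᵐ(Ω)`: `u` is a limit of test functions in the norm of `Hᵐ(Ω)`. -/
def MemH0 (Ω : Set (EuclideanSpace ℝ (Fin N))) (m : ℕ) (u : L2 Ω) : Prop :=
  ∃ φ : ℕ → EuclideanSpace ℝ (Fin N) → ℝ,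
    (∀ n, IsTest Ω (φ n)) ∧
    Tendsto (fun n => eLpNorm (fun x => φ n x - u x) 2 (volume.restrict Ω)) atTop (𝓝 0) ∧
    ∀ k ≤ m, Tendsto (fun q : ℕ × ℕ =>
      eLpNorm (iteratedFDeriv ℝ k (φ q.1 - φ q.2)) 2 (volume.restrict Ω)) atTop (𝓝 0)

/-- The `m`-th power of the Laplacian of a smooth function. -/
def iterLaplacian (m : ℕ) (φ : EuclideanSpace ℝ (Fin N) → ℝ) : EuclideanSpace ℝ (Fin N) → ℝ :=
  (fun g : EuclideanSpace ℝ (Fin N) → ℝ => Δ g)^[m] φ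

/-- `g = (-1)^(m+1) Δ^m u` in the sense of distributions in `Ω`. -/
def IsWeakPolyharmonic (Ω : Set (EuclideanSpace ℝ (Fin N))) (m : ℕ) (u g : L2 Ω) : Prop :=
  ∀ φ, IsTest Ω φ →
    ∫ x in Ω, g x * φ x = (-1) ^ (m + 1) * ∫ x in Ω, u x * iterLaplacian m φ x

theorem MemH0.zero (Ω : Set (EuclideanSpace ℝ (Fin N))) (m : ℕ) : MemH0 Ω m 0 := by
  refine ⟨fun _ => 0, fun n => ⟨contDiff_const, HasCompactSupport.zero, by simp [tsupport]⟩, ?_, ?_⟩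
  · have : eLpNorm ((0 : EuclideanSpace ℝ (Fin N) → ℝ) - ((0 : L2 Ω) : _ → ℝ)) 2
        (volume.restrict Ω) = 0 := by
      rw [eLpNorm_congr_ae (g := 0)]
      · simp
      · filter_upwards [Lp.coeFn_zero ℝ 2 (volume.restrict Ω)] with x hx
        rw [Pi.sub_apply, hx]
        simp
    exact tendsto_const_nhds.congr fun n => this.symm
  · intro k _
    simp only [sub_self]
    have : iteratedFDeriv ℝ k (0 : EuclideanSpace ℝ (Fin N) → ℝ) = 0 := by
      ext1 x
      simp
    simp [this]

theorem IsTest.add {Ω : Set (EuclideanSpace ℝ (Fin N))} {φ χ : EuclideanSpace ℝ (Fin N) → ℝ}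
    (hφ : IsTest Ω φ) (hχ : IsTest Ω χ) : IsTest Ω (φ + χ) :=
  ⟨hφ.contDiff.add hχ.contDiff, hφ.hasCompactSupport.add hχ.hasCompactSupport,
    (tsupport_add φ χ).trans (Set.union_subset hφ.tsupport_subset hχ.tsupport_subset)⟩

theorem IsTest.const_smul {Ω : Set (EuclideanSpace ℝ (Fin N))}
    {φ : EuclideanSpace ℝ (Fin N) → ℝ} (c : ℝ) (hφ : IsTest Ω φ) : IsTest Ω (c • φ) :=
  ⟨hφ.contDiff.const_smul c,
    hφ.hasCompactSupport.mono (Function.support_const_smul_subset c φ),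
    (closure_mono (Function.support_const_smul_subset c φ)).trans hφ.tsupport_subset⟩

theorem IsTest.continuous_iteratedFDeriv {Ω : Set (EuclideanSpace ℝ (Fin N))}
    {φ χ : EuclideanSpace ℝ (Fin N) → ℝ} (hφ : IsTest Ω φ) (hχ : IsTest Ω χ) (k : ℕ) :
    Continuous (iteratedFDeriv ℝ k (φ - χ)) :=
  (hφ.contDiff.sub hχ.contDiff).continuous_iteratedFDeriv (by exact_mod_cast le_top)

theorem MemH0.add {Ω : Set (EuclideanSpace ℝ (Fin N))} {m : ℕ} {u v : L2 Ω}
    (hu : MemH0 Ω m u) (hv : MemH0 Ω m v) : MemH0 Ω m (u + v) := by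
  obtain ⟨φ, hφ, hφu, hφc⟩ := hu
  obtain ⟨χ, hχ, hχv, hχc⟩ := hv
  refine ⟨fun n => φ n + χ n, fun n => (hφ n).add (hχ n), ?_, ?_⟩
  · refine tendsto_of_tendsto_of_tendsto_of_le_of_le tendsto_const_nhds
      (by simpa using hφu.add hχv) (fun n => zero_le) (fun n => ?_)
    have h : (φ n + χ n - ((u + v : L2 Ω) : _ → ℝ)) =ᵐ[volume.restrict Ω]
        (φ n - (u : _ → ℝ)) + (χ n - (v : _ → ℝ)) := by
      filter_upwards [Lp.coeFn_add u v] with x hx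
      simp only [Pi.sub_apply, Pi.add_apply] at hx ⊢
      rw [hx]; ring
    change eLpNorm (φ n + χ n - ((u + v : L2 Ω) : _ → ℝ)) 2 (volume.restrict Ω) ≤ _
    rw [eLpNorm_congr_ae h]
    exact eLpNorm_add_le
      ((hφ n).contDiff.continuous.aestronglyMeasurable.sub (Lp.aestronglyMeasurable u))
      ((hχ n).contDiff.continuous.aestronglyMeasurable.sub (Lp.aestronglyMeasurable v))
      (by norm_num)
  · intro k hk
    refine tendsto_of_tendsto_of_tendsto_of_le_of_le tendsto_const_nhds
      (by simpa using (hφc k hk).add (hχc k hk)) (fun q => zero_le) (fun q => ?_)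
    have h : iteratedFDeriv ℝ k (φ q.1 + χ q.1 - (φ q.2 + χ q.2)) =
        iteratedFDeriv ℝ k (φ q.1 - φ q.2) + iteratedFDeriv ℝ k (χ q.1 - χ q.2) := by
      rw [← iteratedFDeriv_add]
      · congr 1; abel
      · exact ((hφ _).contDiff.sub (hφ _).contDiff).of_le (by exact_mod_cast le_top)
      · exact ((hχ _).contDiff.sub (hχ _).contDiff).of_le (by exact_mod_cast le_top)
    change eLpNorm (iteratedFDeriv ℝ k (φ q.1 + χ q.1 - (φ q.2 + χ q.2))) 2
      (volume.restrict Ω) ≤ _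
    rw [h]
    exact eLpNorm_add_le
      ((hφ _).continuous_iteratedFDeriv (hφ _) k).aestronglyMeasurable
      ((hχ _).continuous_iteratedFDeriv (hχ _) k).aestronglyMeasurable (by norm_num)

theorem MemH0.const_smul {Ω : Set (EuclideanSpace ℝ (Fin N))} {m : ℕ} {u : L2 Ω} (c : ℝ)
    (hu : MemH0 Ω m u) : MemH0 Ω m (c • u) := by
  obtain ⟨φ, hφ, hφu, hφc⟩ := hu
  refine ⟨fun n => c • φ n, fun n => (hφ n).const_smul c, ?_, ?_⟩
  · have h : ∀ n, eLpNorm (c • φ n - ((c • u : L2 Ω) : _ → ℝ)) 2 (volume.restrict Ω) =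
        ‖c‖ₑ * eLpNorm (φ n - (u : _ → ℝ)) 2 (volume.restrict Ω) := by
      intro n
      rw [← eLpNorm_const_smul]
      refine eLpNorm_congr_ae ?_
      filter_upwards [Lp.coeFn_smul c u] with x hx
      simp only [Pi.sub_apply, Pi.smul_apply] at hx ⊢
      rw [hx, smul_sub]
    have h' := ENNReal.Tendsto.const_mul (a := ‖c‖ₑ) hφu (Or.inr (by simp))
    rw [mul_zero] at h'
    exact h'.congr fun n => (h n).symm
  · intro k hk
    have h : ∀ q : ℕ × ℕ, eLpNorm (iteratedFDeriv ℝ k (c • φ q.1 - c • φ q.2)) 2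
        (volume.restrict Ω) =
        ‖c‖ₑ * eLpNorm (iteratedFDeriv ℝ k (φ q.1 - φ q.2)) 2 (volume.restrict Ω) := by
      intro q
      rw [← eLpNorm_const_smul, ← smul_sub]
      congr 1
      ext1 x
      exact iteratedFDeriv_const_smul_apply
        (((hφ _).contDiff.sub (hφ _).contDiff).of_le (by exact_mod_cast le_top)).contDiffAt
    simp only [h]
    simpa using ENNReal.Tendsto.const_mul (hφc k hk) (Or.inr (by simp))

theorem IsTest.laplacian {Ω : Set (EuclideanSpace ℝ (Fin N))}
    {φ : EuclideanSpace ℝ (Fin N) → ℝ} (hφ : IsTest Ω φ) : IsTest Ω (Δ φ) := by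
  have hs : tsupport (Δ φ) ⊆ tsupport φ := by
    refine closure_minimal (fun x hx => ?_) (isClosed_tsupport φ)
    by_contra hx'
    apply hx
    have h0 : iteratedFDeriv ℝ 2 φ x = 0 := by
      by_contra h
      exact hx' (support_iteratedFDeriv_subset (𝕜 := ℝ) 2 h)
    rw [InnerProductSpace.laplacian_eq_iteratedFDeriv_stdOrthonormalBasis]
    simp [h0]
  refine ⟨?_, hφ.hasCompactSupport.mono' ((subset_tsupport _).trans hs),
    hs.trans hφ.tsupport_subset⟩
  rw [InnerProductSpace.laplacian_eq_iteratedFDeriv_stdOrthonormalBasis]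
  refine ContDiff.sum fun i _ => ?_
  have h : ContDiff ℝ ∞ (iteratedFDeriv ℝ 2 φ) :=
    hφ.contDiff.iteratedFDeriv_right (m := ∞) (i := 2) (by norm_cast)
  exact (ContinuousMultilinearMap.apply ℝ (fun _ : Fin 2 => EuclideanSpace ℝ (Fin N)) ℝ
    ![stdOrthonormalBasis ℝ (EuclideanSpace ℝ (Fin N)) i,
      stdOrthonormalBasis ℝ (EuclideanSpace ℝ (Fin N)) i]).contDiff.comp h

theorem IsTest.iterLaplacian {Ω : Set (EuclideanSpace ℝ (Fin N))} (m : ℕ)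
    {φ : EuclideanSpace ℝ (Fin N) → ℝ} (hφ : IsTest Ω φ) : IsTest Ω (iterLaplacian m φ) := by
  induction m generalizing φ with
  | zero => exact hφ
  | succ m ih => exact ih hφ.laplacian

theorem IsTest.integrable_mul {Ω : Set (EuclideanSpace ℝ (Fin N))}
    {φ : EuclideanSpace ℝ (Fin N) → ℝ} (hφ : IsTest Ω φ) (u : L2 Ω) :
    Integrable (fun x => u x * φ x) (volume.restrict Ω) :=
  MemLp.integrable_mul (p := 2) (q := 2) (Lp.memLp u) (hφ.contDiff.continuous.memLp_of_hasCompactSupport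
    hφ.hasCompactSupport)

theorem IsWeakPolyharmonic.zero (Ω : Set (EuclideanSpace ℝ (Fin N))) (m : ℕ) :
    IsWeakPolyharmonic Ω m 0 0 := by
  intro φ _
  have h : ∀ χ : EuclideanSpace ℝ (Fin N) → ℝ, ∫ x in Ω, ((0 : L2 Ω) : _ → ℝ) x * χ x = 0 := by
    intro χ
    rw [integral_congr_ae (g := fun _ => (0 : ℝ))]
    · simp
    · filter_upwards [Lp.coeFn_zero ℝ 2 (volume.restrict Ω)] with x hx
      rw [hx]
      simp
  rw [h, h, mul_zero]

theorem IsWeakPolyharmonic.add {Ω : Set (EuclideanSpace ℝ (Fin N))} {m : ℕ} {u g v h : L2 Ω}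
    (hu : IsWeakPolyharmonic Ω m u g) (hv : IsWeakPolyharmonic Ω m v h) :
    IsWeakPolyharmonic Ω m (u + v) (g + h) := by
  intro φ hφ
  have key : ∀ (χ : EuclideanSpace ℝ (Fin N) → ℝ), IsTest Ω χ → ∀ a b : L2 Ω,
      ∫ x in Ω, ((a + b : L2 Ω) : _ → ℝ) x * χ x =
        (∫ x in Ω, a x * χ x) + ∫ x in Ω, b x * χ x := by
    intro χ hχ a b
    rw [← integral_add (hχ.integrable_mul a) (hχ.integrable_mul b)]
    refine integral_congr_ae ?_
    filter_upwards [Lp.coeFn_add a b] with x hx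
    rw [hx, Pi.add_apply, add_mul]
  rw [key φ hφ, key _ (hφ.iterLaplacian m), hu φ hφ, hv φ hφ, mul_add]

theorem IsWeakPolyharmonic.const_smul {Ω : Set (EuclideanSpace ℝ (Fin N))} {m : ℕ} {u g : L2 Ω}
    (c : ℝ) (hu : IsWeakPolyharmonic Ω m u g) : IsWeakPolyharmonic Ω m (c • u) (c • g) := by
  intro φ hφ
  have key : ∀ (χ : EuclideanSpace ℝ (Fin N) → ℝ) (a : L2 Ω),
      ∫ x in Ω, ((c • a : L2 Ω) : _ → ℝ) x * χ x = c * ∫ x in Ω, a x * χ x := by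
    intro χ a
    rw [← integral_const_mul]
    refine integral_congr_ae ?_
    filter_upwards [Lp.coeFn_smul c a] with x hx
    rw [hx, Pi.smul_apply, smul_eq_mul, mul_assoc]
  rw [key, key, hu φ hφ]
  ring

/-- The domain of the Dirichlet realization of `(-1)^(m+1) Δ^m` in `L²(Ω)`,
`{u ∈ H₀ᵐ(Ω) : Δ^m u ∈ L²(Ω)}` (this is `H²ᵐ(Ω) ∩ H₀ᵐ(Ω)` if `∂Ω` is smooth), with the graph norm:
`x = (u, (-1)^(m+1) Δ^m u)`. -/
def dirichletDomain (Ω : Set (EuclideanSpace ℝ (Fin N))) (m : ℕ) : Submodule ℝ (L2 Ω × L2 Ω) where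
  carrier := {x | MemH0 Ω m x.1 ∧ IsWeakPolyharmonic Ω m x.1 x.2}
  zero_mem' := ⟨MemH0.zero Ω m, IsWeakPolyharmonic.zero Ω m⟩
  add_mem' := fun hx hy => ⟨hx.1.add hy.1, hx.2.add hy.2⟩
  smul_mem' := fun c _ hx => ⟨hx.1.const_smul c, hx.2.const_smul c⟩

variable {Ω : Set (EuclideanSpace ℝ (Fin N))} {m : ℕ}

/-- The element of `L²(Ω)` underlying an element of the domain. -/
def toL2 (u : dirichletDomain Ω m) : L2 Ω := u.1.1

/-- The function `(-1)^(m+1) Δ^m u ∈ L²(Ω)`. -/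
def polyLaplacian (u : dirichletDomain Ω m) : L2 Ω := u.1.2

/-- `|u| ≤ M` almost everywhere in `Ω`. -/
def BoundedBy (M : ℝ) (u : dirichletDomain Ω m) : Prop :=
  ∀ᵐ x ∂(volume.restrict Ω), |toL2 u x| ≤ M

/-- The solutions of `(-1)^(m+1) Δ^m ψ + f(ψ) = 0` that are bounded by `M`. -/
def pdeEquilibria (Ω : Set (EuclideanSpace ℝ (Fin N))) (m : ℕ) (f : ℝ → ℝ) (M : ℝ) :
    Set (dirichletDomain Ω m) :=
  {ψ | BoundedBy M ψ ∧ ∀ᵐ x ∂(volume.restrict Ω), polyLaplacian ψ x + f (toL2 ψ x) = 0}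

/-- The kernel of the linearized operator `(-1)^(m+1) Δ^m + f'(ψ) I`. -/
def pdeKernel (f : ℝ → ℝ) (ψ : dirichletDomain Ω m) : Submodule ℝ (dirichletDomain Ω m) where
  carrier := {v | ∀ᵐ x ∂(volume.restrict Ω),
    polyLaplacian v x + deriv f (toL2 ψ x) * toL2 v x = 0}
  zero_mem' := by
    filter_upwards [Lp.coeFn_zero ℝ 2 (volume.restrict Ω)] with x hx
    change ((0 : L2 Ω) : _ → ℝ) x + _ * ((0 : L2 Ω) : _ → ℝ) x = 0
    rw [hx]
    simp
  add_mem' := by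
    intro v w hv hw
    filter_upwards [hv, hw, Lp.coeFn_add v.1.1 w.1.1, Lp.coeFn_add v.1.2 w.1.2] with x h1 h2 h3 h4
    change ((v.1.2 + w.1.2 : L2 Ω) : _ → ℝ) x + _ * ((v.1.1 + w.1.1 : L2 Ω) : _ → ℝ) x = 0
    simp only [polyLaplacian, toL2] at h1 h2 ⊢
    rw [h3, h4, Pi.add_apply, Pi.add_apply]
    linear_combination h1 + h2
  smul_mem' := by
    intro c v hv
    filter_upwards [hv, Lp.coeFn_smul c v.1.1, Lp.coeFn_smul c v.1.2] with x h1 h3 h4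
    change ((c • v.1.2 : L2 Ω) : _ → ℝ) x + _ * ((c • v.1.1 : L2 Ω) : _ → ℝ) x = 0
    simp only [polyLaplacian, toL2] at h1 ⊢
    rw [h3, h4, Pi.smul_apply, Pi.smul_apply, smul_eq_mul, smul_eq_mul]
    linear_combination c * h1

/-- `ψ` is a branching point: it is the limit of a uniformly bounded family of other equilibria. -/
def PdeBranchingAt (f : ℝ → ℝ) (ψ : dirichletDomain Ω m) : Prop :=
  ∃ M : ℝ, AccPt ψ (𝓟 (pdeEquilibria Ω m f M))

/-- Resonance branching for the equation `(-1)^(m+1) Δ^m ψ + f(ψ) = 0`. -/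
def PdeResonanceBranching (Ω : Set (EuclideanSpace ℝ (Fin N))) (m : ℕ) (f : ℝ → ℝ) : Prop :=
  ∀ M₀ : ℝ, ∀ ψ ∈ pdeEquilibria Ω m f M₀, PdeBranchingAt f ψ →
    1 ≤ Module.finrank ℝ (pdeKernel f ψ) →
    ∃ M : ℝ, HasSurfaceThrough (pdeEquilibria Ω m f M) ψ (Module.finrank ℝ (pdeKernel f ψ))

/-- A global solution of `u_t = (-1)^(m+1) Δ^m u + f(u)`, `t > 0`. -/
structure IsPdeOrbit (f : ℝ → ℝ) (u : ℝ → dirichletDomain Ω m) : Prop where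
  continuousOn : ContinuousOn u (Set.Ioi 0)
  equation : ∀ t > 0, ∃ g : L2 Ω, HasDerivAt (fun s => toL2 (u s)) g t ∧
    ∀ᵐ x ∂(volume.restrict Ω), g x = polyLaplacian (u t) x + f (toL2 (u t) x)

end Polyharmonic

end GradientFlow

end

/-!
Along an orbit of a gradient system `d/dt V(u) = ‖V'(u)‖²`, so `V(u)` increases and the velocity is
small at suitable large times; precompactness then produces an equilibrium `ψ` in the `ω`-limit
set. If near `ψ` the Łojasiewicz inequality `|V - V(ψ)| ≤ C ‖V'‖²` with exponent `1/2` holds, the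
length of the orbit after time `t` is controlled by `√(V(ψ) - V(u(t)))`, which traps the orbit near
`ψ`, and the gap `V(ψ) - V(u)` decays exponentially. If `ψ` is isolated, connectedness of the orbit
suffices.

Resonance branching yields the inequality: if `L = V''(ψ)` has a `k`-dimensional kernel and a
`k`-dimensional `C¹` surface of equilibria passes through `ψ`, then its tangent space is `ker L`,
and the projection of the surface onto `ker L` covers a neighbourhood. Hence every `x` near `ψ` has
an equilibrium `y` on the surface with `x - y` in a complement of `ker L`, where `L` is bounded
below, so `‖x - y‖ ≤ C ‖V'(x)‖`, while `V` is constant on the surface and quadratic in `x - y`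
around `y`.

For the parabolic equation, the nonlinearity may be replaced by a globally Lipschitz one, as
`|u| ≤ M`. The energy is bounded above, since `(-1)^(m+1) Δ^m ≤ 0`, and the flow is one-sided
Lipschitz in `L²`, which makes `u_t` tend to `0` and the orbit precompact in the graph norm. The
superposition operator is not differentiable on `L²`, but it is strictly differentiable on the
domain, which embeds compactly.
-/

namespace GradientFlow

/-! ### Curves of steepest ascent of an energy -/

section GradientCurve

theorem le_mul_exp_of_deriv_le_mul {f f' : ℝ → ℝ} {K s t : ℝ} (hst : s ≤ t)
    (hf : ∀ r ∈ Set.Icc s t, HasDerivAt f (f' r) r) (hle : ∀ r ∈ Set.Icc s t, f' r ≤ K * f r) :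
    f t ≤ f s * Real.exp (K * (t - s)) := by
  rw [← gronwallBound_ε0]
  refine le_gronwallBound_of_liminf_deriv_right_le (f' := f')
    (fun r hr => (hf r hr).continuousAt.continuousWithinAt) (fun r hr b hb => ?_) le_rfl
    (fun r hr => ?_) t (Set.right_mem_Icc.2 hst)
  · exact (hf r (Set.Ico_subset_Icc_self hr)).hasDerivWithinAt.liminf_right_slope_le hb
  · rw [add_zero]
    exact hle r (Set.Ico_subset_Icc_self hr)

variable {H : Type*} [NormedAddCommGroup H] [NormedSpace ℝ H]

/-- The curve `v` has velocity `g`, and the energy `E` increases along it at the rate `‖g‖²`, as is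
the case for a solution of `v_t = V'(v)` with `E = V ∘ v` and `g = V' ∘ v`. -/
structure IsGradientCurve (v g : ℝ → H) (E : ℝ → ℝ) : Prop where
  hasDerivAt : ∀ t > 0, HasDerivAt v (g t) t
  hasDerivAt_energy : ∀ t > 0, HasDerivAt E (‖g t‖ ^ 2) t

namespace IsGradientCurve

variable {v g : ℝ → H} {E : ℝ → ℝ} {a : H} {c C s t : ℝ}

theorem monotoneOn (h : IsGradientCurve v g E) : MonotoneOn E (Set.Ioi 0) :=
  monotoneOn_of_hasDerivWithinAt_nonneg (convex_Ioi 0)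
    (fun t ht => (h.hasDerivAt_energy t ht).continuousAt.continuousWithinAt)
    (fun t ht => (h.hasDerivAt_energy t (interior_subset ht)).hasDerivWithinAt)
    (fun _ _ => sq_nonneg _)

theorem energy_le_of_tendsto (h : IsGradientCurve v g E) (hc : Tendsto E atTop (𝓝 c))
    (ht : 0 < t) : E t ≤ c :=
  ge_of_tendsto hc <| (eventually_ge_atTop t).mono fun _ hs =>
    h.monotoneOn ht (ht.trans_le hs) hs

theorem exists_norm_sq_eq_slope (h : IsGradientCurve v g E) (hs : 0 < s) (hst : s < t) :
    ∃ r ∈ Set.Ioo s t, ‖g r‖ ^ 2 = (E t - E s) / (t - s) :=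
  exists_hasDerivAt_eq_slope E _ hst
    (fun r hr => (h.hasDerivAt_energy r (hs.trans_le hr.1)).continuousAt.continuousWithinAt)
    fun r hr => h.hasDerivAt_energy r (hs.trans hr.1)

theorem norm_sub_sq_le (h : IsGradientCurve v g E) (hs : 0 < s) (hst : s ≤ t) :
    ‖v t - v s‖ ^ 2 ≤ (t - s) * (E t - E s) := by
  -- Integrating `2 l ‖g‖ ≤ l² ‖g‖² + 1` and optimizing in `l` replaces the Cauchy-Schwarz
  -- inequality for `∫ ‖g‖`, which need not make sense.
  have hquad (l : ℝ) : ‖l • (v t - v s)‖ ≤ (l ^ 2 * (E t - E s) + (t - s)) / 2 := by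
    have hv (r : ℝ) (hr : 0 < r) : HasDerivAt (fun r => l • (v r - v s)) (l • g r) r :=
      ((h.hasDerivAt r hr).sub_const _).const_smul l
    have hB (r : ℝ) (hr : 0 < r) : HasDerivAt (fun r => (l ^ 2 * (E r - E s) + (r - s)) / 2)
        ((l ^ 2 * ‖g r‖ ^ 2 + 1) / 2) r :=
      ((((h.hasDerivAt_energy r hr).sub_const _).const_mul _).add
        ((hasDerivAt_id r).sub_const s)).div_const 2
    refine image_norm_le_of_norm_deriv_right_le_deriv_boundary'
      (fun r hr => (hv r (hs.trans_le hr.1)).continuousAt.continuousWithinAt)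
      (fun r hr => (hv r (hs.trans_le hr.1)).hasDerivWithinAt) (by simp)
      (fun r hr => (hB r (hs.trans_le hr.1)).continuousAt.continuousWithinAt)
      (fun r hr => (hB r (hs.trans_le hr.1)).hasDerivWithinAt) (fun r _ => ?_)
      (Set.right_mem_Icc.2 hst)
    rw [norm_smul, Real.norm_eq_abs, ← sq_abs l]
    linarith [sq_nonneg (|l| * ‖g r‖ - 1)]
  have hdiscrim := discrim_le_zero (a := E t - E s) (b := -2 * ‖v t - v s‖) (c := t - s)
    fun l => by
      have := hquad l
      rw [norm_smul, Real.norm_eq_abs] at this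
      linarith [mul_le_mul_of_nonneg_right (le_abs_self l) (norm_nonneg (v t - v s))]
  rw [discrim] at hdiscrim
  linarith

theorem energy_eq_of_le (h : IsGradientCurve v g E) (hc : Tendsto E atTop (𝓝 c)) (hs : 0 < s)
    (hEs : E s = c) (hst : s ≤ t) : E t = c :=
  (h.energy_le_of_tendsto hc (hs.trans_le hst)).antisymm <|
    hEs.symm.trans_le (h.monotoneOn hs (hs.trans_le hst) hst)

theorem velocity_eq_zero (h : IsGradientCurve v g E) (hc : Tendsto E atTop (𝓝 c)) (ht : 0 < t)
    (hEt : E t = c) : g t = 0 := by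
  have hconst : HasDerivWithinAt E 0 (Set.Ici t) t :=
    (hasDerivWithinAt_const t _ c).congr (fun _ hr => h.energy_eq_of_le hc ht hEt hr) hEt
  simpa using (uniqueDiffWithinAt_Ici t).eq_deriv _ (h.hasDerivAt_energy t ht).hasDerivWithinAt
    hconst

theorem hasDerivWithinAt_sqrt_gap (h : IsGradientCurve v g E) (hc : Tendsto E atTop (𝓝 c))
    (ht : 0 < t) :
    HasDerivWithinAt (fun r => √(c - E r)) (-‖g t‖ ^ 2 / (2 * √(c - E t))) (Set.Ici t) t := by
  rcases (h.energy_le_of_tendsto hc ht).eq_or_lt with hEt | hEt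
  · rw [h.velocity_eq_zero hc ht hEt, norm_zero, zero_pow two_ne_zero, neg_zero, zero_div]
    exact (hasDerivWithinAt_const t _ 0).congr
      (fun r hr => by simp [h.energy_eq_of_le hc ht hEt hr]) (by simp [hEt])
  · exact (((h.hasDerivAt_energy t ht).const_sub c).sqrt (sub_pos.2 hEt).ne').hasDerivWithinAt

theorem norm_sub_le_sqrt_gap_sub (h : IsGradientCurve v g E) (hc : Tendsto E atTop (𝓝 c))
    (hs : 0 < s) (hst : s ≤ t) (hloj : ∀ r ∈ Set.Ico s t, c - E r ≤ C * ‖g r‖ ^ 2) :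
    ‖v t - v s‖ ≤ 2 * √C * (√(c - E s) - √(c - E t)) := by
  have hpos {r : ℝ} (hr : s ≤ r) : 0 < r := hs.trans_le hr
  refine image_norm_le_of_norm_deriv_right_le_deriv_boundary'
    (f := fun r => v r - v s) (B := fun r => 2 * √C * (√(c - E s) - √(c - E r)))
    (fun r hr => ((h.hasDerivAt r (hpos hr.1)).sub_const _).continuousAt.continuousWithinAt)
    (fun r hr => ((h.hasDerivAt r (hpos hr.1)).sub_const _).hasDerivWithinAt) (by simp)
    (fun r hr => ?_)
    (fun r hr => ((h.hasDerivWithinAt_sqrt_gap hc (hpos hr.1)).const_sub _).const_mul _)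
    (fun r hr => ?_) (Set.right_mem_Icc.2 hst)
  · have := (h.hasDerivAt_energy r (hpos hr.1)).continuousAt
    exact (by fun_prop : ContinuousAt _ r).continuousWithinAt
  · rcases (h.energy_le_of_tendsto hc (hpos hr.1)).eq_or_lt with hEr | hEr
    · simp [h.velocity_eq_zero hc (hpos hr.1) hEr]
    have hgap : 0 < √(c - E r) := Real.sqrt_pos.2 (sub_pos.2 hEr)
    have hsqrt : √(c - E r) ≤ √C * ‖g r‖ := by
      rw [← Real.sqrt_sq (norm_nonneg (g r)), ← Real.sqrt_mul' _ (sq_nonneg _)]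
      exact Real.sqrt_le_sqrt (hloj r hr)
    calc ‖g r‖ ≤ ‖g r‖ * (√C * ‖g r‖ / √(c - E r)) :=
          le_mul_of_one_le_right (norm_nonneg _) ((one_le_div hgap).2 hsqrt)
      _ = 2 * √C * -(-‖g r‖ ^ 2 / (2 * √(c - E r))) := by field

theorem energy_gap_le_mul_exp (h : IsGradientCurve v g E) (hC : 0 < C) (hs : 0 < s) (hst : s ≤ t)
    (hloj : ∀ r ∈ Set.Icc s t, c - E r ≤ C * ‖g r‖ ^ 2) :
    c - E t ≤ (c - E s) * Real.exp (-C⁻¹ * (t - s)) := by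
  refine le_mul_exp_of_deriv_le_mul (f := fun r => c - E r) hst
    (fun r hr => (h.hasDerivAt_energy r (hs.trans_le hr.1)).const_sub c) fun r hr => ?_
  rw [neg_mul, neg_le_neg_iff, inv_mul_le_iff₀ hC]
  exact hloj r hr

/-- The remaining length of the curve is controlled by the energy gap, which is small at the times
when the curve is close to `a`: this traps the curve near `a`. -/
theorem eventually_lojasiewicz (h : IsGradientCurve v g E) (hc : Tendsto E atTop (𝓝 c))
    (ha : MapClusterPt a atTop v)
    (hloj : ∀ᶠ t in atTop ⊓ comap v (𝓝 a), c - E t ≤ C * ‖g t‖ ^ 2) :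
    ∀ᶠ t in atTop, c - E t ≤ C * ‖g t‖ ^ 2 := by
  rw [(atTop_basis.inf (Metric.nhds_basis_ball.comap v)).eventually_iff] at hloj
  obtain ⟨⟨T, δ⟩, ⟨-, hδ⟩, hball⟩ := hloj
  have hball (t : ℝ) (hTt : T ≤ t) (ht : dist (v t) a < δ) : c - E t ≤ C * ‖g t‖ ^ 2 :=
    hball ⟨hTt, ht⟩
  have hshort : ∀ᶠ t in atTop, 2 * √C * √(c - E t) < δ / 2 := by
    have : Tendsto (fun t => 2 * √C * √(c - E t)) atTop (𝓝 0) := by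
      simpa using ((hc.const_sub c).sqrt).const_mul (2 * √C)
    exact this.eventually_lt_const (half_pos hδ)
  obtain ⟨s, hsa, hTs, hs, hlen⟩ := ((mapClusterPt_iff_frequently.1 ha _
    (Metric.ball_mem_nhds a (half_pos hδ))).and_eventually
    ((eventually_ge_atTop T).and ((eventually_gt_atTop 0).and hshort))).exists
  filter_upwards [eventually_ge_atTop s] with t hst
  refine hball t (hTs.trans hst) (not_le.1 fun hout => ?_)
  set exits : Set ℝ := Set.Ici s ∩ (fun r => dist (v r) a) ⁻¹' Set.Ici δ
  have hclosed : IsClosed exits := by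
    refine ContinuousOn.preimage_isClosed_of_isClosed (fun r hr => ?_) isClosed_Ici isClosed_Ici
    have := (h.hasDerivAt r (hs.trans_le hr)).continuousAt
    exact (by fun_prop : ContinuousAt (fun r => dist (v r) a) r).continuousWithinAt
  have hbdd : BddBelow exits := ⟨s, fun r hr => hr.1⟩
  obtain ⟨hsr, hr⟩ : sInf exits ∈ exits := hclosed.csInf_mem ⟨t, hst, hout⟩ hbdd
  set r := sInf exits
  have hlength := h.norm_sub_le_sqrt_gap_sub hc hs hsr fun q hq =>
    hball q (hTs.trans hq.1) (not_le.1 fun hq' => (csInf_le hbdd ⟨hq.1, hq'⟩).not_gt hq.2)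
  rw [mul_sub, ← dist_eq_norm] at hlength
  have : 0 ≤ 2 * √C * √(c - E r) := by positivity
  linarith [dist_triangle (v r) (v s) a, Metric.mem_ball.1 hsa, show δ ≤ dist (v r) a from hr]

theorem dist_le_sqrt_gap (h : IsGradientCurve v g E) (hc : Tendsto E atTop (𝓝 c))
    (ha : MapClusterPt a atTop v) (ht : 0 < t) (hloj : ∀ r ≥ t, c - E r ≤ C * ‖g r‖ ^ 2) :
    dist a (v t) ≤ 2 * √C * √(c - E t) := by
  refine Metric.isClosed_closedBall.mem_of_mapClusterPt ha ?_
  filter_upwards [eventually_ge_atTop t] with r htr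
  rw [Metric.mem_closedBall, dist_eq_norm]
  refine (h.norm_sub_le_sqrt_gap_sub hc ht htr fun q hq => hloj q hq.1).trans ?_
  gcongr
  exact sub_le_self _ (Real.sqrt_nonneg _)

theorem exists_isBigO_exp (h : IsGradientCurve v g E) (hc : Tendsto E atTop (𝓝 c))
    (ha : MapClusterPt a atTop v)
    (hloj : ∀ᶠ t in atTop ⊓ comap v (𝓝 a), c - E t ≤ C * ‖g t‖ ^ 2) :
    ∃ δ > 0, (fun t => v t - a) =O[atTop] fun t => Real.exp (-(δ * t)) := by
  obtain ⟨s, hs⟩ := eventually_atTop.1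
    ((eventually_gt_atTop 0).and (h.eventually_lojasiewicz hc ha hloj))
  set D := max C 1
  have hD : 0 < D := zero_lt_one.trans_le (le_max_right C 1)
  have hlojD (t : ℝ) (ht : s ≤ t) : c - E t ≤ D * ‖g t‖ ^ 2 :=
    (hs t ht).2.trans (by gcongr; exact le_max_left C 1)
  have hs0 : 0 < s := (hs s le_rfl).1
  refine ⟨(2 * D)⁻¹, by positivity, .of_bound
    (2 * √D * √((c - E s) * Real.exp (D⁻¹ * s))) ?_⟩
  filter_upwards [eventually_ge_atTop s] with t ht
  calc ‖v t - a‖ = dist a (v t) := by rw [dist_comm, dist_eq_norm]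
    _ ≤ 2 * √D * √(c - E t) :=
      h.dist_le_sqrt_gap hc ha (hs0.trans_le ht) fun r hr => hlojD r (ht.trans hr)
    _ ≤ 2 * √D * √((c - E s) * Real.exp (-D⁻¹ * (t - s))) := by
      gcongr
      exact h.energy_gap_le_mul_exp hD hs0 ht fun r hr => hlojD r hr.1
    _ = 2 * √D * √((c - E s) * Real.exp (D⁻¹ * s)) * ‖Real.exp (-((2 * D)⁻¹ * t))‖ := by
      rw [show -D⁻¹ * (t - s) = D⁻¹ * s + (-((2 * D)⁻¹ * t) + -((2 * D)⁻¹ * t)) by field,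
        Real.exp_add, Real.exp_add, ← mul_assoc, Real.sqrt_mul' _ (by positivity),
        Real.sqrt_mul_self (Real.exp_nonneg _), Real.norm_of_nonneg (Real.exp_nonneg _),
        ← mul_assoc]

end IsGradientCurve

end GradientCurve

theorem ConvergesExponentially.of_isBigO {H : Type*} [NormedAddCommGroup H]
    [InnerProductSpace ℝ H] {v : ℝ → H} {a : H} {B δ : ℝ} (hδ : 0 < δ)
    (hv : (fun t => v t - a) =O[atTop] fun t => Real.exp (-(δ * t)))
    (hB : ∀ t > 0, ‖v t‖ ≤ B) : ConvergesExponentially v a := by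
  obtain ⟨K, hK⟩ := hv.bound
  obtain ⟨T, hT⟩ := eventually_atTop.1 hK
  have hB0 : 0 ≤ B := (norm_nonneg _).trans (hB 1 one_pos)
  refine ⟨max K ((B + ‖a‖) * Real.exp (δ * T)), δ, hδ, fun t ht => ?_⟩
  rcases le_total T t with hTt | htT
  · refine (hT t hTt).trans ?_
    rw [Real.norm_of_nonneg (Real.exp_nonneg _)]
    gcongr
    exact le_max_left _ _
  · calc ‖v t - a‖ ≤ (B + ‖a‖) * 1 := by
          rw [mul_one]
          exact (norm_sub_le _ _).trans (by gcongr; exact hB t ht)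
      _ ≤ (B + ‖a‖) * (Real.exp (δ * T) * Real.exp (-(δ * t))) := by
          gcongr
          rw [← Real.exp_add, Real.one_le_exp_iff]
          nlinarith
      _ ≤ max K ((B + ‖a‖) * Real.exp (δ * T)) * Real.exp (-(δ * t)) := by
          rw [← mul_assoc]
          gcongr
          exact le_max_right _ _

namespace IsGradientCurve

theorem exists_tendsto_velocity_zero {H : Type*} [NormedAddCommGroup H] [NormedSpace ℝ H]
    {v g : ℝ → H} {E : ℝ → ℝ} {c : ℝ} (h : IsGradientCurve v g E) (hc : Tendsto E atTop (𝓝 c)) :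
    ∃ θ : ℝ → ℝ, Tendsto θ atTop atTop ∧ Tendsto (fun t => v (θ t) - v t) atTop (𝓝 0) ∧
      Tendsto (fun t => g (θ t)) atTop (𝓝 0) := by
  have hmean (t : ℝ) (ht : 0 < t) : ∃ r ∈ Set.Ioo t (t + 1), ‖g r‖ ^ 2 = E (t + 1) - E t := by
    simpa using h.exists_norm_sq_eq_slope ht (lt_add_one t)
  choose! θ hθ hgθ using hmean
  have hgain : Tendsto (fun t => √(E (t + 1) - E t)) atTop (𝓝 0) := by
    simpa using ((hc.comp (tendsto_atTop_add_const_right _ 1 tendsto_id)).sub hc).sqrt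
  refine ⟨θ, tendsto_atTop_mono' _ ?_ tendsto_id, squeeze_zero_norm' ?_ hgain,
    squeeze_zero_norm' ?_ hgain⟩
  all_goals filter_upwards [eventually_gt_atTop 0] with t ht
  · exact (hθ t ht).1.le
  · obtain ⟨hlt, hlt'⟩ := hθ t ht
    have hθ0 : 0 < θ t := ht.trans hlt
    refine Real.le_sqrt_of_sq_le ((h.norm_sub_sq_le ht hlt.le).trans ?_)
    calc (θ t - t) * (E (θ t) - E t) ≤ 1 * (E (θ t) - E t) :=
          mul_le_mul_of_nonneg_right (by linarith) (sub_nonneg.2 (h.monotoneOn ht hθ0 hlt.le))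
      _ ≤ E (t + 1) - E t := by
          rw [one_mul]
          exact sub_le_sub_right (h.monotoneOn hθ0 (hθ0.trans hlt') hlt'.le) _
  · exact Real.le_sqrt_of_sq_le (hgθ t ht).le

end IsGradientCurve

theorem tendsto_of_monotoneOn_of_mapClusterPt {α β : Type*} [LinearOrder α] [NoMaxOrder α]
    [LinearOrder β] [TopologicalSpace β] [OrderTopology β] {f : α → β} {a : α} {c : β}
    (hf : MonotoneOn f (Set.Ioi a)) (hc : MapClusterPt c atTop f) : Tendsto f atTop (𝓝 c) := by
  have : Nonempty α := ⟨a⟩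
  refine tendsto_order.2 ⟨fun b hb => ?_, fun b hb => ?_⟩
  · obtain ⟨t, hbt, ht⟩ :=
      ((hc.frequently (lt_mem_nhds hb)).and_eventually (eventually_gt_atTop a)).exists
    filter_upwards [eventually_ge_atTop t] with r hr
    exact hbt.trans_le (hf ht (ht.trans_le hr) hr)
  · filter_upwards [eventually_gt_atTop a] with t ht
    refine lt_of_le_of_lt ?_ hb
    refine isClosed_Ici.mem_of_mapClusterPt hc ?_
    filter_upwards [eventually_ge_atTop t] with r hr
    exact hf ht (lt_of_lt_of_le ht hr) hr

theorem frequently_dist_eq_of_mapClusterPt {X : Type*} [PseudoMetricSpace X] {u : ℝ → X} {x : X}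
    {T r : ℝ} (hc : ContinuousOn u (Set.Ioi T))
    (hx : MapClusterPt x atTop u) (hr : 0 < r) (hfar : ∃ᶠ t in atTop, r ≤ dist (u t) x) :
    ∃ᶠ t in atTop, dist (u t) x = r := by
  refine frequently_atTop.2 fun a => ?_
  obtain ⟨s, hsx, has, hTs⟩ := ((mapClusterPt_iff_frequently.1 hx _
    (Metric.ball_mem_nhds x hr)).and_eventually
      ((eventually_ge_atTop a).and (eventually_gt_atTop T))).exists
  obtain ⟨t, htx, hst⟩ := (hfar.and_eventually (eventually_ge_atTop s)).exists
  have hcont : ContinuousOn (fun q => dist (u q) x) (Set.Icc s t) :=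
    (continuous_id.dist continuous_const).comp_continuousOn
      (hc.mono fun q (hq : q ∈ Set.Icc s t) => hTs.trans_le hq.1)
  obtain ⟨q, hq, hqx⟩ := intermediate_value_Icc hst hcont ⟨(Metric.mem_ball.1 hsx).le, htx⟩
  exact ⟨q, has.trans hq.1, hqx⟩

/-! ### Orbits that are precompact at infinity -/

section Precompact

/-- Every sequence of times tending to infinity has a subsequence along which `u` converges. -/
def PrecompactAtTop {X : Type*} [TopologicalSpace X] (u : ℝ → X) : Prop :=
  ∀ s : ℕ → ℝ, Tendsto s atTop atTop →
    ∃ x, ∃ φ : ℕ → ℕ, StrictMono φ ∧ Tendsto (fun n => u (s (φ n))) atTop (𝓝 x)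

namespace PrecompactAtTop

section TopologicalSpace

variable {X Y : Type*} [TopologicalSpace X] [TopologicalSpace Y] {u : ℝ → X}

theorem exists_mapClusterPt_mem (hu : PrecompactAtTop u) {K : Set X} (hK : IsClosed K)
    (h : ∃ᶠ t in atTop, u t ∈ K) : ∃ x ∈ K, MapClusterPt x atTop u := by
  obtain ⟨s, hs, hsK⟩ := exists_seq_forall_of_frequently h
  obtain ⟨x, φ, hφ, hx⟩ := hu s hs
  exact ⟨x, hK.mem_of_tendsto hx (.of_forall fun n => hsK (φ n)),
    hx.mapClusterPt.of_comp (hs.comp hφ.tendsto_atTop)⟩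

theorem exists_mapClusterPt (hu : PrecompactAtTop u) : ∃ x, MapClusterPt x atTop u := by
  obtain ⟨x, -, hx⟩ :=
    hu.exists_mapClusterPt_mem isClosed_univ (Eventually.of_forall fun _ => trivial).frequently
  exact ⟨x, hx⟩

theorem tendsto_comap [T2Space Y] [FirstCountableTopology Y] (hu : PrecompactAtTop u) {f : X → Y}
    (hf : Continuous f) (hinj : Function.Injective f) (x : X) :
    Tendsto u (atTop ⊓ comap (fun t => f (u t)) (𝓝 (f x))) (𝓝 x) := by
  refine tendsto_of_subseq_tendsto fun s hs => ?_
  rw [tendsto_inf, tendsto_comap_iff] at hs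
  obtain ⟨y, φ, hφ, hy⟩ := hu s hs.1
  have hyx : f y = f x :=
    tendsto_nhds_unique ((hf.tendsto y).comp hy) (hs.2.comp hφ.tendsto_atTop)
  rw [← hinj hyx]
  exact ⟨φ, hy⟩

end TopologicalSpace

variable {X : Type*} [PseudoMetricSpace X] {u : ℝ → X} {x : X}

theorem tendsto_of_not_accPt (hu : PrecompactAtTop u) {T : ℝ} (hc : ContinuousOn u (Set.Ioi T))
    (hx : MapClusterPt x atTop u) {Φ : Set X} (hΦ : ∀ y, MapClusterPt y atTop u → y ∈ Φ)
    (hiso : ¬ AccPt x (𝓟 Φ)) : Tendsto u atTop (𝓝 x) := by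
  rw [accPt_iff_frequently, not_frequently, Metric.eventually_nhds_iff] at hiso
  obtain ⟨ρ, hρ, hball⟩ := hiso
  rw [Metric.tendsto_nhds]
  by_contra! hnot
  obtain ⟨ε, hε, hfar⟩ := hnot
  have hr : 0 < min ε (ρ / 2) := lt_min hε (half_pos hρ)
  obtain ⟨y, hyr, hy⟩ := hu.exists_mapClusterPt_mem (Metric.isClosed_sphere (x := x))
    (frequently_dist_eq_of_mapClusterPt hc hx hr (hfar.mono fun t ht => (min_le_left _ _).trans ht))
  refine hball ?_ ⟨?_, hΦ y hy⟩
  · rw [Metric.mem_sphere.1 hyr]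
    exact (min_le_right _ _).trans_lt (half_lt_self hρ)
  · rintro rfl
    exact Metric.ne_of_mem_sphere hyr hr.ne' rfl

end PrecompactAtTop

end Precompact

/-! ### Orbits of a gradient field with respect to an embedding -/

section Orbit

variable {X H : Type*} [NormedAddCommGroup X] [NormedSpace ℝ X] [NormedAddCommGroup H]

/-- The functional `V` on `X` has the gradient `g` at `y` with respect to the inner product of `H`,
where `X` is embedded in `H` by `ι`. The error is small compared with the norm of `H`, not just with
that of `X`, so that `V` can be differentiated along curves that are differentiable in `H` only. -/
def HasEmbeddedGradientAt [InnerProductSpace ℝ H] (ι : X →L[ℝ] H) (V : X → ℝ) (g : H) (y : X) :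
    Prop :=
  (fun x => V x - V y - ⟪g, ι (x - y)⟫_ℝ) =o[𝓝 y] fun x => ι (x - y)

/-- `u` solves `u_t = G(u)` for `t > 0`, the derivative being taken in `H`. -/
structure IsOrbit [NormedSpace ℝ H] (ι : X →L[ℝ] H) (G : X → H) (u : ℝ → X) : Prop where
  continuousOn : ContinuousOn u (Set.Ioi 0)
  equation : ∀ t > 0, HasDerivAt (fun s => ι (u s)) (G (u t)) t

variable [InnerProductSpace ℝ H] {ι : X →L[ℝ] H} {V : X → ℝ} {G : X → H} {u : ℝ → X}

theorem HasEmbeddedGradientAt.hasFDerivAt {g : H} {y : X} (h : HasEmbeddedGradientAt ι V g y) :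
    HasFDerivAt V (innerSL ℝ g ∘L ι) y :=
  .of_isLittleO (h.trans_isBigO (ι.isBigO_sub _ _))

theorem HasEmbeddedGradientAt.hasDerivAt_comp {g w : H} {t : ℝ}
    (h : HasEmbeddedGradientAt ι V g (u t)) (hu : ContinuousAt u t)
    (hv : HasDerivAt (fun s => ι (u s)) w t) : HasDerivAt (fun s => V (u s)) ⟪g, w⟫_ℝ t := by
  have herror : (fun s => V (u s) - V (u t) - ⟪g, ι (u s - u t)⟫_ℝ) =o[𝓝 t] fun s => s - t := by
    refine (h.comp_tendsto hu).trans_isBigO ?_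
    simpa [Function.comp_def] using hv.hasFDerivAt.isBigO_sub
  have hinner : HasDerivAt (fun s => ⟪g, ι (u s)⟫_ℝ) ⟪g, w⟫_ℝ t := by
    simpa using (hasDerivAt_const t g).inner ℝ hv
  rw [hasDerivAt_iff_isLittleO] at hinner ⊢
  refine (herror.add hinner).congr_left fun s => ?_
  simp only [map_sub, inner_sub_right]
  ring

namespace IsOrbit

theorem isGradientCurve (hu : IsOrbit ι G u) (hV : ∀ x, HasEmbeddedGradientAt ι V (G x) x) :
    IsGradientCurve (fun t => ι (u t)) (fun t => G (u t)) fun t => V (u t) where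
  hasDerivAt := hu.equation
  hasDerivAt_energy t ht := by
    rw [← real_inner_self_eq_norm_sq]
    exact (hV (u t)).hasDerivAt_comp (hu.continuousOn.continuousAt (Ioi_mem_nhds ht))
      (hu.equation t ht)

theorem tendsto_functional (hu : IsOrbit ι G u) (hV : ∀ x, HasEmbeddedGradientAt ι V (G x) x)
    {ψ : X} (hψ : MapClusterPt ψ atTop u) : Tendsto (fun t => V (u t)) atTop (𝓝 (V ψ)) :=
  tendsto_of_monotoneOn_of_mapClusterPt (hu.isGradientCurve hV).monotoneOn
    (hψ.continuousAt_comp (hV ψ).hasFDerivAt.continuousAt)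

theorem eq_zero_of_mapClusterPt (hu : IsOrbit ι G u)
    (hV : ∀ x, HasEmbeddedGradientAt ι V (G x) x) (hι : Function.Injective ι) (hG : Continuous G)
    (hpre : PrecompactAtTop u) {ψ : X} (hψ : MapClusterPt ψ atTop u) : G ψ = 0 := by
  obtain ⟨θ, hθ, hdist, hvel⟩ :=
    (hu.isGradientCurve hV).exists_tendsto_velocity_zero (hu.tendsto_functional hV hψ)
  have : (atTop ⊓ comap u (𝓝 ψ)).NeBot := by
    rwa [← map_neBot_iff u, Filter.push_pull, inf_comm]
  have huψ : Tendsto (fun t => ι (u t)) (atTop ⊓ comap u (𝓝 ψ)) (𝓝 (ι ψ)) :=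
    (ι.continuous.tendsto ψ).comp (tendsto_comap.mono_left inf_le_right)
  have hshift : Tendsto (fun t => ι (u (θ t))) (atTop ⊓ comap u (𝓝 ψ)) (𝓝 (ι ψ)) := by
    simpa using (hdist.mono_left inf_le_left).add huψ
  have huθ : Tendsto (fun t => u (θ t)) (atTop ⊓ comap u (𝓝 ψ)) (𝓝 ψ) :=
    (hpre.tendsto_comap ι.continuous hι ψ).comp
      (tendsto_inf.2 ⟨hθ.mono_left inf_le_left, tendsto_comap_iff.2 hshift⟩)
  exact tendsto_nhds_unique ((hG.tendsto ψ).comp huθ) (hvel.mono_left inf_le_left)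

theorem tendsto_of_lojasiewicz (hu : IsOrbit ι G u) (hV : ∀ x, HasEmbeddedGradientAt ι V (G x) x)
    (hι : Function.Injective ι) (hpre : PrecompactAtTop u) {ψ : X} (hψ : MapClusterPt ψ atTop u)
    {S : Set X} (hS : ∀ t > 0, u t ∈ S)
    (hloj : (fun x => V x - V ψ) =O[𝓝[S] ψ] fun x => ‖G x‖ ^ 2)
    {B : ℝ} (hB : ∀ t > 0, ‖ι (u t)‖ ≤ B) :
    Tendsto u atTop (𝓝 ψ) ∧ ConvergesExponentially (fun t => ι (u t)) (ι ψ) := by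
  obtain ⟨C, hC⟩ := hloj.bound
  have hu_near : Tendsto u (atTop ⊓ comap (fun t => ι (u t)) (𝓝 (ι ψ))) (𝓝[S] ψ) := by
    refine tendsto_nhdsWithin_iff.2 ⟨hpre.tendsto_comap ι.continuous hι ψ, ?_⟩
    exact (eventually_gt_atTop 0).filter_mono inf_le_left |>.mono hS
  have hgap : ∀ᶠ t in atTop ⊓ comap (fun t => ι (u t)) (𝓝 (ι ψ)),
      V ψ - V (u t) ≤ C * ‖G (u t)‖ ^ 2 := by
    filter_upwards [hu_near.eventually hC] with t ht
    rw [norm_sub_rev, norm_pow, norm_norm] at ht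
    exact (le_abs_self _).trans ht
  obtain ⟨δ, hδ, hexp⟩ := (hu.isGradientCurve hV).exists_isBigO_exp (hu.tendsto_functional hV hψ)
    (hψ.continuousAt_comp ι.continuous.continuousAt) hgap
  refine ⟨?_, .of_isBigO hδ hexp hB⟩
  have hv : Tendsto (fun t => ι (u t)) atTop (𝓝 (ι ψ)) := by
    refine tendsto_sub_nhds_zero_iff.1 (hexp.trans_tendsto ?_)
    exact Real.tendsto_exp_neg_atTop_nhds_zero.comp (tendsto_id.const_mul_atTop hδ)
  exact (hpre.tendsto_comap ι.continuous hι ψ).comp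
    (tendsto_inf.2 ⟨tendsto_id, tendsto_comap_iff.2 hv⟩)

theorem exists_tendsto (hu : IsOrbit ι G u) (hV : ∀ x, HasEmbeddedGradientAt ι V (G x) x)
    (hι : Function.Injective ι) (hG : Continuous G) (hpre : PrecompactAtTop u)
    {S : Set X} (hS : ∀ t > 0, u t ∈ S) {B : ℝ} (hB : ∀ t > 0, ‖ι (u t)‖ ≤ B)
    {Φ : Set X} (hΦ : ∀ ψ, MapClusterPt ψ atTop u → G ψ = 0 → ψ ∈ Φ) {P : X → Prop}
    (hloj : ∀ ψ ∈ Φ, P ψ → (fun x => V x - V ψ) =O[𝓝[S] ψ] fun x => ‖G x‖ ^ 2)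
    (hiso : ∀ ψ ∈ Φ, ¬ P ψ → ¬ AccPt ψ (𝓟 Φ)) :
    ∃ ψ ∈ Φ, Tendsto u atTop (𝓝 ψ) ∧
      (P ψ → ConvergesExponentially (fun t => ι (u t)) (ι ψ)) := by
  have hlimit (ψ : X) (hψ : MapClusterPt ψ atTop u) : ψ ∈ Φ :=
    hΦ ψ hψ (hu.eq_zero_of_mapClusterPt hV hι hG hpre hψ)
  obtain ⟨ψ, hψ⟩ := hpre.exists_mapClusterPt
  refine ⟨ψ, hlimit ψ hψ, ?_⟩
  by_cases hP : P ψ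
  · obtain ⟨htend, hexp⟩ :=
      hu.tendsto_of_lojasiewicz hV hι hpre hψ hS (hloj ψ (hlimit ψ hψ) hP) hB
    exact ⟨htend, fun _ => hexp⟩
  · exact ⟨hpre.tendsto_of_not_accPt hu.continuousOn hψ hlimit (hiso ψ (hlimit ψ hψ) hP),
      fun hP' => (hP hP').elim⟩

end IsOrbit

end Orbit

/-! ### The Łojasiewicz inequality at a point of resonance branching -/

section Lojasiewicz

variable {E F X : Type*} [NormedAddCommGroup E] [NormedSpace ℝ E] [NormedAddCommGroup F]
  [NormedSpace ℝ F] [NormedAddCommGroup X] [NormedSpace ℝ X]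

/-- The kernel of `L` is finite dimensional and `L` is bounded below on a closed complement
of its kernel. For bounded operators between Banach spaces this means that the kernel is finite
dimensional and the range closed. -/
def IsSemiFredholm (L : X →L[ℝ] F) : Prop :=
  FiniteDimensional ℝ L.ker ∧ ∃ P : X →L[ℝ] L.ker, (∀ x : L.ker, P x = x) ∧
    ∃ C : ℝ, ∀ w, P w = 0 → ‖w‖ ≤ C * ‖L w‖

theorem isSemiFredholm_of_isFredholm {L : X →L[ℝ] F} (hL : L.IsFredholm) : IsSemiFredholm L := by
  obtain ⟨dom₁, h_dom⟩ := hL.closedComplemented_ker.exists_isTopCompl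
  obtain ⟨codom₀, h_codom⟩ := hL.closedComplemented_range.exists_isTopCompl
  set pkg := hL.fredholmPackage h_dom h_codom
  obtain ⟨K, hK⟩ : ∃ K : NNReal, AntilipschitzWith K pkg.equiv := ⟨_, pkg.equiv.antilipschitz⟩
  refine ⟨hL.finite_ker, L.ker.projectionOntoL dom₁ h_dom, fun x => by simp, K, fun w hw => ?_⟩
  have hw₁ : w ∈ dom₁ := (Submodule.projectionOntoL_apply_eq_zero_iff h_dom).1 hw
  have hproj : pkg.decDom.proj w = ⟨w, hw₁⟩ :=
    Submodule.projectionOntoL_apply_left h_dom.symm ⟨w, hw₁⟩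
  have hLw : L w = (pkg.equiv (pkg.decDom.proj w) : F) := by
    conv_lhs => rw [pkg.eq_equiv]
    rfl
  have hbound := ZeroHomClass.bound_of_antilipschitz pkg.equiv hK (pkg.decDom.proj w)
  rw [hLw]
  rwa [hproj] at hbound ⊢

theorem hasSurfaceThrough_finrank {S : Set X} {ψ : X} (hψ : ψ ∈ S) {K : Submodule ℝ X}
    (h : K = ⊥ ∨ (1 ≤ Module.finrank ℝ K → HasSurfaceThrough S ψ (Module.finrank ℝ K))) :
    HasSurfaceThrough S ψ (Module.finrank ℝ K) := by
  rcases Nat.eq_zero_or_pos (Module.finrank ℝ K) with h₀ | h₁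
  · rw [h₀]
    exact ⟨fun _ => ψ, rfl, contDiffAt_const, Function.injective_of_subsingleton _,
      .of_forall fun _ => hψ⟩
  · refine h.resolve_left ?_ h₁
    rintro rfl
    simp at h₁

theorem hasSurfaceThrough_mono {S T : Set X} (hST : S ⊆ T) {ψ : X} {k : ℕ}
    (h : HasSurfaceThrough S ψ k) : HasSurfaceThrough T ψ k := by
  obtain ⟨p, hp₀, hp, hinj, hpS⟩ := h
  exact ⟨p, hp₀, hp, hinj, hpS.mono fun _ hμ => hST hμ⟩

theorem eventually_eq_of_eventually_hasFDerivAt_zero {f : E → F} {a : E}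
    (h : ∀ᶠ x in 𝓝 a, HasFDerivAt f (0 : E →L[ℝ] F) x) : ∀ᶠ x in 𝓝 a, f x = f a := by
  obtain ⟨r, hr, hball⟩ := Metric.eventually_nhds_iff_ball.1 h
  filter_upwards [Metric.ball_mem_nhds a hr] with x hx
  exact Metric.isOpen_ball.is_const_of_fderiv_eq_zero (𝕜 := ℝ)
    (convex_ball a r).isPreconnected
    (fun y hy => (hball y hy).differentiableAt.differentiableWithinAt)
    (fun y hy => (hball y hy).fderiv) hx (Metric.mem_ball_self hr)

theorem exists_tendsto_map_eq [CompleteSpace E] {p : E → X} {A : E →L[ℝ] X} {a : E}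
    (hp : HasStrictFDerivAt p A a) {P : X →L[ℝ] F} {B : E ≃L[ℝ] F} (hB : P ∘L A = B) :
    ∃ σ : X → E, Tendsto σ (𝓝 (p a)) (𝓝 a) ∧ ∀ᶠ x in 𝓝 (p a), P (p (σ x)) = P x := by
  have hPp : HasStrictFDerivAt (fun μ => P (p μ)) (B : E →L[ℝ] F) a := by
    rw [← hB]
    exact P.hasStrictFDerivAt.comp a hp
  have hP : Tendsto P (𝓝 (p a)) (𝓝 (P (p a))) := P.continuous.tendsto _
  exact ⟨fun x => hPp.localInverse _ B a (P x), hPp.localInverse_tendsto.comp hP,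
    hP.eventually hPp.eventually_right_inverse⟩

section EmbeddedGradient

variable {H : Type*} [NormedAddCommGroup H] [InnerProductSpace ℝ H] {ι : X →L[ℝ] H} {V : X → ℝ}

theorem isBigO_sub_sub_inner_norm_sq {G : X → H} (hV : ∀ x, HasEmbeddedGradientAt ι V (G x) x)
    {L : X →L[ℝ] H} {ψ : X} (hG : HasStrictFDerivAt G L ψ) :
    (fun q : X × X => V q.1 - V q.2 - ⟪G q.2, ι (q.1 - q.2)⟫_ℝ) =O[𝓝 (ψ, ψ)]
      fun q => ‖q.1 - q.2‖ ^ 2 := by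
  obtain ⟨k, s, hs, hk⟩ := hG.exists_lipschitzOnWith
  obtain ⟨r, hr, hball⟩ := Metric.mem_nhds_iff.1 hs
  refine .of_bound (k * ‖ι‖) ?_
  rw [nhds_prod_eq]
  filter_upwards [prod_mem_prod (Metric.ball_mem_nhds ψ hr) (Metric.ball_mem_nhds ψ hr)]
  rintro ⟨x, y⟩ ⟨hx, hy⟩
  have hderiv (z : X) (hz : z ∈ segment ℝ y x) :
      ‖innerSL ℝ (G z) ∘L ι - innerSL ℝ (G y) ∘L ι‖ ≤ k * ‖x - y‖ * ‖ι‖ := by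
    have hz' := (convex_ball ψ r).segment_subset hy hx hz
    rw [← ContinuousLinearMap.sub_comp, ← map_sub]
    refine (ContinuousLinearMap.opNorm_comp_le _ _).trans ?_
    rw [innerSL_apply_norm]
    gcongr
    refine (hk.norm_sub_le (hball hz') (hball hy)).trans ?_
    gcongr
    exact norm_sub_le_of_mem_segment hz
  have hmean := (convex_segment y x).norm_image_sub_le_of_norm_hasFDerivWithin_le'
    (fun z _ => (hV z).hasFDerivAt.hasFDerivWithinAt) hderiv (left_mem_segment ℝ y x)
    (right_mem_segment ℝ y x)
  rw [norm_pow, norm_norm]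
  calc ‖V x - V y - ⟪G y, ι (x - y)⟫_ℝ‖ ≤ k * ‖x - y‖ * ‖ι‖ * ‖x - y‖ := hmean
    _ = k * ‖ι‖ * ‖x - y‖ ^ 2 := by ring

theorem eventually_eq_of_surface {G : X → H} (hV : ∀ x, HasEmbeddedGradientAt ι V (G x) x)
    {p : E → X} {a : E} (hp : ContDiffAt ℝ 1 p a) (hpG : ∀ᶠ μ in 𝓝 a, G (p μ) = 0) :
    ∀ᶠ μ in 𝓝 a, V (p μ) = V (p a) := by
  refine eventually_eq_of_eventually_hasFDerivAt_zero (f := fun μ => V (p μ)) ?_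
  filter_upwards [hpG, hp.eventually (by simp)] with μ hμ hpμ
  simpa [hμ, Function.comp_def] using
    (hV (p μ)).hasFDerivAt.comp μ (hpμ.differentiableAt one_ne_zero).hasFDerivAt

theorem isBigO_norm_sq_of_hasSurfaceThrough {G : X → H}
    (hV : ∀ x, HasEmbeddedGradientAt ι V (G x) x) {L : X →L[ℝ] H} {ψ : X}
    (hG : HasStrictFDerivAt G L ψ) (hL : IsSemiFredholm L)
    (hsurf : HasSurfaceThrough {x | G x = 0} ψ (Module.finrank ℝ L.ker)) :
    (fun x => V x - V ψ) =O[𝓝 ψ] fun x => ‖G x‖ ^ 2 := by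
  obtain ⟨_, P, hP, C, hC⟩ := hL
  obtain ⟨p, rfl, hp, hinj, hpG⟩ := hsurf
  have hstrict := hp.hasStrictFDerivAt one_ne_zero
  have hLA : L ∘L fderiv ℝ p 0 = 0 :=
    (hG.hasFDerivAt.comp 0 hstrict.hasFDerivAt).unique
      ((hasFDerivAt_const 0 _).congr_of_eventuallyEq hpG)
  have hPinj : Function.Injective (P ∘L fderiv ℝ p 0) := fun μ ν h => by
    have hker (κ) : P (fderiv ℝ p 0 κ) = fderiv ℝ p 0 κ :=
      congrArg Subtype.val (hP ⟨_, DFunLike.congr_fun hLA κ⟩)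
    exact hinj (by simpa [Subtype.ext_iff, hker] using h)
  obtain ⟨σ, hσ, hPσ⟩ := exists_tendsto_map_eq hstrict
    (B := (LinearEquiv.ofInjectiveOfFinrankEq (P ∘L fderiv ℝ p 0 : _ →ₗ[ℝ] L.ker) hPinj
      (by simp)).toContinuousLinearEquiv) rfl
  have hproj : Tendsto (fun x => (x, p (σ x))) (𝓝 (p 0)) (𝓝 (p 0, p 0)) :=
    tendsto_id.prodMk_nhds (hstrict.continuousAt.tendsto.comp hσ)
  have hbelow : (fun x => x - p (σ x)) =O[𝓝 (p 0)] fun x => L (x - p (σ x)) := by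
    refine .of_bound C (hPσ.mono fun x hx => hC _ ?_)
    rw [map_sub, hx, sub_self]
  have hGx : (fun x => G x - L (x - p (σ x))) =o[𝓝 (p 0)] fun x => L (x - p (σ x)) := by
    refine ((hG.isLittleO.comp_tendsto hproj).trans_isBigO hbelow).congr' ?_ .rfl
    filter_upwards [hσ.eventually hpG] with x (hx : G (p (σ x)) = 0)
    simp [hx]
  have hLG : (fun x => L (x - p (σ x))) =O[𝓝 (p 0)] G := by
    simpa using hGx.right_isBigO_add
  refine (((isBigO_sub_sub_inner_norm_sq hV hG).comp_tendsto hproj).trans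
    ((hbelow.trans hLG).norm_norm.pow 2)).congr' ?_ .rfl
  filter_upwards [hσ.eventually hpG, hσ.eventually (eventually_eq_of_surface hV hp hpG)]
    with x (hx : G (p (σ x)) = 0) hVx
  simp [hx, hVx]

end EmbeddedGradient

end Lojasiewicz

/-! ### Smooth gradient systems -/

section GradientSystem

variable {H X : Type*} [NormedAddCommGroup H] [InnerProductSpace ℝ H]
  [NormedAddCommGroup X] [NormedSpace ℝ X] {ι : X →L[ℝ] H} {V : X → ℝ} {V' : X → H} {u : ℝ → X}

namespace IsSmoothOrbit

theorem isOrbit (hu : IsSmoothOrbit ι V' u) : IsOrbit ι V' u := ⟨hu.continuousOn, hu.equation⟩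

theorem precompactAtTop [CompleteSpace X] (hι : IsCompactOperator ι) (hu : IsSmoothOrbit ι V' u)
    (hb : Bornology.IsBounded (u '' Set.Ioi 0)) : PrecompactAtTop u := by
  intro s hs
  obtain ⟨K, hK, hKu⟩ := hι.image_subset_compact_of_bounded hb
  have hmem : ∀ᶠ n in atTop, ι (u (s n)) ∈ K := by
    filter_upwards [hs.eventually_gt_atTop 0] with n hn
    exact hKu ⟨_, ⟨_, hn, rfl⟩, rfl⟩
  obtain ⟨a, -, φ, hφ, ha⟩ := hK.tendsto_subseq' hmem.frequently
  obtain ⟨x, hx⟩ := cauchySeq_tendsto_of_complete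
    (hu.smoothing (s ∘ φ) (hs.comp hφ.tendsto_atTop) ha.cauchySeq)
  exact ⟨x, φ, hφ, hx⟩

end IsSmoothOrbit

namespace IsGradientSystem

theorem abs_sub_sub_inner_le (hS : IsGradientSystem ι V V') {x y : X} {ε : ℝ}
    (h : ∀ z ∈ segment ℝ y x, ‖V' z - V' y‖ ≤ ε) :
    |V x - V y - ⟪V' y, ι (x - y)⟫_ℝ| ≤ ε * ‖ι (x - y)‖ := by
  have hV : Differentiable ℝ V := hS.contDiff_functional.differentiable two_ne_zero
  have hderiv (θ : ℝ) :
      HasDerivAt (fun θ : ℝ => V (y + θ • (x - y)) - θ * ⟪V' y, ι (x - y)⟫_ℝ)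
        ⟪V' (y + θ • (x - y)) - V' y, ι (x - y)⟫_ℝ θ := by
    have hline : HasDerivAt (fun θ : ℝ => y + θ • (x - y)) (x - y) θ := by
      simpa using ((hasDerivAt_id θ).smul_const (x - y)).const_add y
    have hcomp := (hV (y + θ • (x - y))).hasFDerivAt.comp_hasDerivAt θ hline
    rw [hS.gradient] at hcomp
    rw [inner_sub_left]
    exact hcomp.sub (by simpa using (hasDerivAt_id θ).mul_const ⟪V' y, ι (x - y)⟫_ℝ)
  have hmean := norm_image_sub_le_of_norm_deriv_le_segment_01' (C := ε * ‖ι (x - y)‖)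
    (fun θ _ => (hderiv θ).hasDerivWithinAt) fun θ hθ => by
      refine (norm_inner_le_norm _ _).trans ?_
      gcongr
      refine h _ ?_
      rw [segment_eq_image']
      exact ⟨θ, ⟨hθ.1, hθ.2.le⟩, rfl⟩
  simpa [sub_right_comm] using hmean

theorem hasEmbeddedGradientAt (hS : IsGradientSystem ι V V') (y : X) :
    HasEmbeddedGradientAt ι V (V' y) y := by
  refine Asymptotics.isLittleO_iff.2 fun ε hε => ?_
  obtain ⟨r, hr, hball⟩ := Metric.continuous_iff.1 hS.contDiff_gradient.continuous y ε hε
  filter_upwards [Metric.ball_mem_nhds y hr] with x hx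
  refine hS.abs_sub_sub_inner_le fun z hz => ?_
  rw [← dist_eq_norm]
  exact (hball z ((convex_ball y r).segment_subset (Metric.mem_ball_self hr) hx hz)).le

theorem exists_tendsto [CompleteSpace X] (hS : IsGradientSystem ι V V')
    (hF : ∀ ψ ∈ equilibria V', IsSemiFredholm (fderiv ℝ V' ψ)) (hR : ResonanceBranching V')
    (hu : IsSmoothOrbit ι V' u) (hb : Bornology.IsBounded (u '' Set.Ioi 0)) :
    ∃ ψ ∈ equilibria V', Tendsto u atTop (𝓝 ψ) ∧
      ((fderiv ℝ V' ψ).ker = ⊥ ∨ AccPt ψ (𝓟 (equilibria V')) →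
        ConvergesExponentially (fun t => ι (u t)) (ι ψ)) := by
  obtain ⟨B, hB⟩ := hb.exists_norm_le
  refine hu.isOrbit.exists_tendsto hS.hasEmbeddedGradientAt hS.injective
    hS.contDiff_gradient.continuous (hu.precompactAtTop hS.compact hb) (fun _ _ => Set.mem_univ _)
    (fun t ht => ι.le_opNorm_of_le (hB _ ⟨t, ht, rfl⟩)) (fun _ _ h => h) (fun ψ hψ hP => ?_)
    fun ψ _ hP hacc => hP (.inr hacc)
  rw [nhdsWithin_univ]
  exact isBigO_norm_sq_of_hasSurfaceThrough hS.hasEmbeddedGradientAt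
    (hS.contDiff_gradient.contDiffAt.hasStrictFDerivAt one_ne_zero) (hF ψ hψ)
    (hasSurfaceThrough_finrank hψ (hP.imp_right (hR ψ hψ)))

end IsGradientSystem

end GradientSystem

/-! ### Energy forms of Schwartz functions -/

section Schwartz

open scoped SchwartzMap FourierTransform LineDeriv

variable {ι E F : Type*} [Fintype ι] [NormedAddCommGroup E] [InnerProductSpace ℝ E]
  [NormedAddCommGroup F] [NormedSpace ℝ F] {k : ℕ}

/-- The iterated directional derivative of `f` along the basis vectors `b (α 0), …, b (α (k - 1))`,
that is, the partial derivative `∂^α f` in the coordinates given by `b`. -/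
noncomputable def partialDeriv (b : OrthonormalBasis ι ℝ E) (α : Fin k → ι) (f : 𝓢(E, F)) :
    𝓢(E, F) :=
  ∂^{fun j => b (α j)} f

theorem partialDeriv_apply (b : OrthonormalBasis ι ℝ E) (α : Fin k → ι) (f : 𝓢(E, F)) (x : E) :
    partialDeriv b α f x = iteratedFDeriv ℝ k f x fun j => b (α j) :=
  SchwartzMap.iteratedLineDerivOp_eq_iteratedFDeriv

theorem norm_partialDeriv_le (b : OrthonormalBasis ι ℝ E) (α : Fin k → ι) (f : 𝓢(E, F)) (x : E) :
    ‖partialDeriv b α f x‖ ≤ ‖iteratedFDeriv ℝ k f x‖ := by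
  rw [partialDeriv_apply]
  simpa using (iteratedFDeriv ℝ k f x).le_opNorm fun j => b (α j)

theorem norm_le_sum_norm_apply_basis (b : OrthonormalBasis ι ℝ E)
    (A : ContinuousMultilinearMap ℝ (fun _ : Fin k => E) F) :
    ‖A‖ ≤ ∑ α : Fin k → ι, ‖A fun j => b (α j)‖ := by
  refine A.opNorm_le_bound (Finset.sum_nonneg fun _ _ => norm_nonneg _) fun v => ?_
  have hexpand : A v = ∑ α : Fin k → ι, (∏ j, b.repr (v j) (α j)) • A fun j => b (α j) := by
    conv_lhs => rw [show v = fun j => ∑ i, b.repr (v j) i • b i from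
      funext fun j => (b.sum_repr (v j)).symm]
    rw [A.map_sum]
    simp only [A.map_smul_univ]
  rw [hexpand, Finset.sum_mul]
  refine (norm_sum_le _ _).trans (Finset.sum_le_sum fun α _ => ?_)
  rw [norm_smul, mul_comm, norm_prod]
  gcongr with j
  exact (PiLp.norm_apply_le (b.repr (v j)) (α j)).trans_eq (b.repr.norm_map (v j))

theorem norm_iteratedFDeriv_le_sum_norm_partialDeriv (b : OrthonormalBasis ι ℝ E) (f : 𝓢(E, F))
    (x : E) : ‖iteratedFDeriv ℝ k f x‖ ≤ ∑ α : Fin k → ι, ‖partialDeriv b α f x‖ := by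
  simpa only [partialDeriv_apply] using norm_le_sum_norm_apply_basis b (iteratedFDeriv ℝ k f x)

/-- The complexification of a real Schwartz function. The Fourier transform is only available for
complex-valued functions. -/
noncomputable def complexify (f : 𝓢(E, ℝ)) : 𝓢(E, ℂ) :=
  f.postcompCLM Complex.ofRealCLM

theorem complexify_apply (f : 𝓢(E, ℝ)) (x : E) : complexify f x = (f x : ℂ) := rfl

theorem coe_complexify (f : 𝓢(E, ℝ)) : (complexify f : E → ℂ) = Complex.ofRealCLM ∘ f := rfl

theorem partialDeriv_complexify (b : OrthonormalBasis ι ℝ E) (α : Fin k → ι) (f : 𝓢(E, ℝ)) :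
    partialDeriv b α (complexify f) = complexify (partialDeriv b α f) := by
  ext x
  rw [partialDeriv_apply, complexify_apply, partialDeriv_apply, coe_complexify,
    Complex.ofRealCLM.iteratedFDeriv_comp_left (f.smooth k).contDiffAt le_rfl]
  rfl

variable [FiniteDimensional ℝ E]

/-- The iterated Laplacian `Δ^m` on Schwartz functions. -/
noncomputable def schwartzLaplacian (m : ℕ) : 𝓢(E, F) → 𝓢(E, F) := (fun f => Δ f)^[m]

theorem schwartzLaplacian_complexify (m : ℕ) (f : 𝓢(E, ℝ)) :
    schwartzLaplacian m (complexify f) = complexify (schwartzLaplacian m f) := by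
  refine (Function.Semiconj.iterate_right (fun g => ?_) m f).symm
  ext x
  rw [SchwartzMap.laplacian_apply, complexify_apply, SchwartzMap.laplacian_apply, coe_complexify,
    (g.smooth 2).contDiffAt.laplacian_CLM_comp_left]
  rfl

theorem coe_schwartzLaplacian {N : ℕ} (m : ℕ) (f : 𝓢(EuclideanSpace ℝ (Fin N), ℝ)) :
    (schwartzLaplacian m f : EuclideanSpace ℝ (Fin N) → ℝ) = iterLaplacian m f :=
  Function.Semiconj.iterate_right
    (fun g => funext fun x => SchwartzMap.laplacian_apply g x) m f

variable [MeasurableSpace E] [BorelSpace E]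

theorem fourier_lineDeriv_apply (f : 𝓢(E, ℂ)) (v ξ : E) :
    𝓕 (∂_{v} f) ξ = 2 * Real.pi * Complex.I * (⟪ξ, v⟫_ℝ : ℂ) * 𝓕 f ξ := by
  have hv : (inner ℝ · v : E → ℝ).HasTemperateGrowth := by fun_prop
  rw [SchwartzMap.fourier_lineDerivOp_eq, smul_apply, SchwartzMap.smulLeftCLM_apply_apply hv]
  simp only [smul_eq_mul, Complex.real_smul]
  ring

theorem fourier_partialDeriv_apply (b : OrthonormalBasis ι ℝ E) (α : Fin k → ι) (f : 𝓢(E, ℂ))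
    (ξ : E) : 𝓕 (partialDeriv b α f) ξ =
      (∏ j, 2 * Real.pi * Complex.I * (⟪ξ, b (α j)⟫_ℝ : ℂ)) * 𝓕 f ξ := by
  induction k with
  | zero => simp [partialDeriv]
  | succ k ih =>
    rw [partialDeriv, LineDeriv.iteratedLineDerivOp_succ_left, fourier_lineDeriv_apply,
      Fin.prod_univ_succ, mul_assoc (2 * Real.pi * Complex.I * _)]
    congr 1
    exact ih (Fin.tail α)

theorem fourier_laplacian_apply (f : 𝓢(E, ℂ)) (ξ : E) :
    𝓕 (Δ f) ξ = -(((2 * Real.pi * ‖ξ‖) ^ 2 : ℝ) : ℂ) * 𝓕 f ξ := by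
  rw [SchwartzMap.laplacian_eq_sum (stdOrthonormalBasis ℝ E), FourierTransform.fourier_sum,
    sum_apply, mul_pow, ← (stdOrthonormalBasis ℝ E).sum_sq_inner_left ξ]
  simp only [fourier_lineDeriv_apply]
  push_cast
  rw [Finset.mul_sum, ← Finset.sum_neg_distrib, Finset.sum_mul]
  refine Finset.sum_congr rfl fun i _ => ?_
  linear_combination (2 * Real.pi * (⟪ξ, stdOrthonormalBasis ℝ E i⟫_ℝ : ℂ)) ^ 2 * 𝓕 f ξ *
    Complex.I_sq

theorem fourier_schwartzLaplacian_apply (m : ℕ) (f : 𝓢(E, ℂ)) (ξ : E) :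
    𝓕 (schwartzLaplacian m f) ξ =
      (-1) ^ m * (((2 * Real.pi * ‖ξ‖) ^ (2 * m) : ℝ) : ℂ) * 𝓕 f ξ := by
  induction m with
  | zero => simp [schwartzLaplacian]
  | succ m ih =>
    rw [schwartzLaplacian, Function.iterate_succ_apply', fourier_laplacian_apply,
      ← schwartzLaplacian, ih]
    push_cast
    ring

theorem sum_inner_fourier_partialDeriv (b : OrthonormalBasis ι ℝ E) (f g : 𝓢(E, ℂ)) (ξ : E) :
    ∑ α : Fin k → ι, ⟪𝓕 (partialDeriv b α f) ξ, 𝓕 (partialDeriv b α g) ξ⟫_ℂ =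
      (((2 * Real.pi * ‖ξ‖) ^ (2 * k) : ℝ) : ℂ) * ⟪𝓕 f ξ, 𝓕 g ξ⟫_ℂ := by
  have hterm (α : Fin k → ι) : ⟪𝓕 (partialDeriv b α f) ξ, 𝓕 (partialDeriv b α g) ξ⟫_ℂ =
      (∏ j, (((2 * Real.pi) ^ 2 * ⟪ξ, b (α j)⟫_ℝ ^ 2 : ℝ) : ℂ)) * ⟪𝓕 f ξ, 𝓕 g ξ⟫_ℂ := by
    simp only [fourier_partialDeriv_apply, RCLike.inner_apply, map_mul, map_prod,
      Complex.conj_ofReal, Complex.conj_I, map_ofNat]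
    rw [mul_mul_mul_comm, ← Finset.prod_mul_distrib]
    congr 1
    refine Finset.prod_congr rfl fun j _ => ?_
    push_cast
    linear_combination -(2 * Real.pi * (⟪ξ, b (α j)⟫_ℝ : ℂ)) ^ 2 * Complex.I_sq
  rw [Finset.sum_congr rfl fun α _ => hterm α, ← Finset.sum_mul, pow_mul, mul_pow _ ‖ξ‖,
    ← b.sum_sq_inner_left ξ, Finset.mul_sum, Complex.ofReal_pow, Complex.ofReal_sum]
  congr 1
  exact (Fintype.sum_pow (fun i => (((2 * Real.pi) ^ 2 * ⟪ξ, b i⟫_ℝ ^ 2 : ℝ) : ℂ)) k).symm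

theorem integrable_inner_schwartz (f g : 𝓢(E, ℂ)) : Integrable (fun ξ => ⟪f ξ, g ξ⟫_ℂ) := by
  have h := MemLp.integrable_mul (p := 2) (q := 2) (f.memLp 2 volume).star (g.memLp 2 volume)
  refine h.congr (.of_forall fun ξ => ?_)
  simp [RCLike.inner_apply, mul_comm]

theorem integral_mul_eq_integral_fourier (f g : 𝓢(E, ℝ)) :
    ((∫ x, f x * g x : ℝ) : ℂ) = ∫ ξ, ⟪𝓕 (complexify f) ξ, 𝓕 (complexify g) ξ⟫_ℂ := by
  rw [SchwartzMap.integral_inner_fourier_fourier, ← integral_complex_ofReal]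
  refine integral_congr_ae (.of_forall fun x => ?_)
  simp only [complexify_apply, RCLike.inner_apply, Complex.conj_ofReal, Complex.ofReal_mul]
  ring

/-- The form `∑_α ∫ ∂^α f ∂^α g`, the sum being over all `α` of length `k`. It is the symmetric
bilinear form of the operator `(-1)^k Δ^k`. -/
noncomputable def energyForm (b : OrthonormalBasis ι ℝ E) (k : ℕ) (f g : 𝓢(E, ℝ)) : ℝ :=
  ∑ α : Fin k → ι, ∫ x, partialDeriv b α f x * partialDeriv b α g x

variable (b : OrthonormalBasis ι ℝ E)

theorem energyForm_zero (f : 𝓢(E, ℝ)) : energyForm b 0 f f = ∫ x, f x ^ 2 := by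
  simp only [energyForm, Finset.univ_unique, Finset.sum_singleton, partialDeriv,
    LineDeriv.iteratedLineDerivOp_fin_zero, pow_two]

theorem energyForm_eq_integral_fourier (k : ℕ) (f g : 𝓢(E, ℝ)) :
    (energyForm b k f g : ℂ) = ∫ ξ, (((2 * Real.pi * ‖ξ‖) ^ (2 * k) : ℝ) : ℂ) *
      ⟪𝓕 (complexify f) ξ, 𝓕 (complexify g) ξ⟫_ℂ := by
  rw [energyForm, Complex.ofReal_sum]
  simp only [integral_mul_eq_integral_fourier, ← partialDeriv_complexify]
  rw [← integral_finsetSum _ fun α _ => integrable_inner_schwartz _ _]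
  simp only [sum_inner_fourier_partialDeriv]

theorem energyForm_eq_integral_mul_schwartzLaplacian (m : ℕ) (f g : 𝓢(E, ℝ)) :
    energyForm b m f g = (-1) ^ m * ∫ x, f x * schwartzLaplacian m g x := by
  rw [← Complex.ofReal_inj, energyForm_eq_integral_fourier, Complex.ofReal_mul,
    integral_mul_eq_integral_fourier, ← schwartzLaplacian_complexify, ← integral_const_mul]
  refine integral_congr_ae (.of_forall fun ξ => ?_)
  have hsign : (-1 : ℂ) ^ m * (-1) ^ m = 1 := by rw [← mul_pow]; simp
  simp only [fourier_schwartzLaplacian_apply, RCLike.inner_apply]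
  push_cast
  linear_combination -((2 * Real.pi * ‖ξ‖) ^ (2 * m) * 𝓕 (complexify g) ξ *
    (starRingEnd ℂ) (𝓕 (complexify f) ξ)) * hsign

theorem ofReal_mul_inner_self (a : ℝ) (z : ℂ) : (a : ℂ) * ⟪z, z⟫_ℂ = ((a * ‖z‖ ^ 2 : ℝ) : ℂ) := by
  rw [inner_self_eq_norm_sq_to_K]
  push_cast
  rfl

theorem energyForm_self_eq (k : ℕ) (f : 𝓢(E, ℝ)) :
    energyForm b k f f = ∫ ξ, (2 * Real.pi * ‖ξ‖) ^ (2 * k) * ‖𝓕 (complexify f) ξ‖ ^ 2 := by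
  rw [← Complex.ofReal_inj, energyForm_eq_integral_fourier, ← integral_complex_ofReal]
  simp only [ofReal_mul_inner_self]

theorem integrable_weighted_fourier (k : ℕ) (f : 𝓢(E, ℝ)) :
    Integrable (fun ξ => (2 * Real.pi * ‖ξ‖) ^ (2 * k) * ‖𝓕 (complexify f) ξ‖ ^ 2) := by
  have h : Integrable (fun ξ => ∑ α : Fin k → Fin (Module.finrank ℝ E),
      ⟪𝓕 (partialDeriv (stdOrthonormalBasis ℝ E) α (complexify f)) ξ,
        𝓕 (partialDeriv (stdOrthonormalBasis ℝ E) α (complexify f)) ξ⟫_ℂ) :=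
    integrable_finsetSum _ fun α _ => integrable_inner_schwartz _ _
  simp only [sum_inner_fourier_partialDeriv, ofReal_mul_inner_self] at h
  exact h.re

theorem energyForm_self_le {k m : ℕ} (hkm : k ≤ m) (f : 𝓢(E, ℝ)) :
    energyForm b k f f ≤ energyForm b 0 f f + energyForm b m f f := by
  simp only [energyForm_self_eq]
  rw [← integral_add (integrable_weighted_fourier 0 f) (integrable_weighted_fourier m f)]
  refine integral_mono (integrable_weighted_fourier k f)
    ((integrable_weighted_fourier 0 f).add (integrable_weighted_fourier m f)) fun ξ => ?_
  simp only [mul_zero, pow_zero, one_mul]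
  rw [← one_add_mul]
  gcongr
  rcases le_total (2 * Real.pi * ‖ξ‖) 1 with hle | hge
  · exact (pow_le_one₀ (by positivity) hle).trans (le_add_of_nonneg_right (by positivity))
  · exact (pow_le_pow_right₀ hge (by lia)).trans (le_add_of_nonneg_left zero_le_one)

end Schwartz

/-! ### The form domain `H₀ᵐ(Ω)` -/

section FormDomain

open scoped SchwartzMap LineDeriv

variable {N m : ℕ}

/-- The Hilbert space in which the family `(∂^α f)`, `|α| = m`, of a Schwartz function `f` on `ℝᴺ`
takes its values. -/
abbrev DerivSpace (N m : ℕ) : Type :=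
  PiLp 2 fun _ : Fin m → Fin N => Lp ℝ 2 (volume : Measure (EuclideanSpace ℝ (Fin N)))

/-- The family of all partial derivatives of order `m`. Only derivatives of top order are recorded:
together with the function itself they control those of lower order. -/
noncomputable def derivMap (m : ℕ) : 𝓢(EuclideanSpace ℝ (Fin N), ℝ) →ₗ[ℝ] DerivSpace N m :=
  (WithLp.linearEquiv 2 ℝ _).symm.toLinearMap ∘ₗ LinearMap.pi fun α =>
    (SchwartzMap.toLpCLM ℝ ℝ 2 volume ∘L
      LineDeriv.iteratedLineDerivOpCLM ℝ 𝓢(EuclideanSpace ℝ (Fin N), ℝ)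
        (fun j => EuclideanSpace.basisFun (Fin N) ℝ (α j)) : _ →ₗ[ℝ] _)

theorem derivMap_apply (f : 𝓢(EuclideanSpace ℝ (Fin N), ℝ)) (α : Fin m → Fin N) :
    derivMap m f α = (partialDeriv (EuclideanSpace.basisFun (Fin N) ℝ) α f).toLp 2 := rfl

theorem eLpNorm_partialDeriv_eq_enorm_derivMap (f : 𝓢(EuclideanSpace ℝ (Fin N), ℝ))
    (α : Fin m → Fin N) :
    eLpNorm (partialDeriv (EuclideanSpace.basisFun (Fin N) ℝ) α f) 2 volume =
      ‖derivMap m f α‖ₑ := by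
  rw [derivMap_apply, Lp.enorm_def]
  exact (eLpNorm_congr_ae (SchwartzMap.coeFn_toLp _ 2 volume)).symm

theorem inner_derivMap (f g : 𝓢(EuclideanSpace ℝ (Fin N), ℝ)) :
    ⟪derivMap m f, derivMap m g⟫_ℝ =
      energyForm (EuclideanSpace.basisFun (Fin N) ℝ) m f g := by
  rw [PiLp.inner_apply, energyForm]
  refine Finset.sum_congr rfl fun α _ => ?_
  rw [derivMap_apply, derivMap_apply, L2.inner_def]
  refine integral_congr_ae ?_
  filter_upwards [SchwartzMap.coeFn_toLp (partialDeriv _ α f) 2 volume,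
    SchwartzMap.coeFn_toLp (partialDeriv _ α g) 2 volume] with x hf hg
  rw [hf, hg, real_inner_eq_re_inner, RCLike.inner_apply]
  simp [mul_comm]

theorem norm_derivMap_sq (f : 𝓢(EuclideanSpace ℝ (Fin N), ℝ)) :
    ‖derivMap m f‖ ^ 2 = energyForm (EuclideanSpace.basisFun (Fin N) ℝ) m f f := by
  rw [← inner_derivMap, real_inner_self_eq_norm_sq]

variable (Ω : Set (EuclideanSpace ℝ (Fin N)))

/-- The restriction of a Schwartz function to `Ω`, as an element of `L²(Ω)`. -/
noncomputable def restrictL2 : 𝓢(EuclideanSpace ℝ (Fin N), ℝ) →ₗ[ℝ] L2 Ω :=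
  (LpToLpRestrictCLM (EuclideanSpace ℝ (Fin N)) ℝ ℝ volume 2 Ω ∘L
    SchwartzMap.toLpCLM ℝ ℝ 2 volume : _ →ₗ[ℝ] _)

theorem coeFn_restrictL2 (f : 𝓢(EuclideanSpace ℝ (Fin N), ℝ)) :
    restrictL2 Ω f =ᵐ[volume.restrict Ω] f :=
  (LpToLpRestrictCLM_coeFn ℝ Ω _).trans (ae_restrict_of_ae (f.coeFn_toLp 2 volume))

/-- The space `C_c^∞(Ω)` of test functions, as a subspace of the Schwartz space. -/
def testSpace : Submodule ℝ 𝓢(EuclideanSpace ℝ (Fin N), ℝ) where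
  carrier := {f | IsTest Ω f}
  zero_mem' := ⟨contDiff_const, HasCompactSupport.zero, by
    rw [show ((0 : 𝓢(EuclideanSpace ℝ (Fin N), ℝ)) : EuclideanSpace ℝ (Fin N) → ℝ) = 0 from rfl,
      tsupport, Function.support_zero, closure_empty]
    exact Set.empty_subset _⟩
  add_mem' := IsTest.add
  smul_mem' := fun c _ hf => IsTest.const_smul c hf

variable {Ω} {f g : 𝓢(EuclideanSpace ℝ (Fin N), ℝ)}

namespace IsTest

variable {φ : EuclideanSpace ℝ (Fin N) → ℝ}

/-- A test function as a Schwartz function. -/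
noncomputable def toSchwartz (hφ : IsTest Ω φ) : 𝓢(EuclideanSpace ℝ (Fin N), ℝ) :=
  hφ.hasCompactSupport.toSchwartzMap hφ.contDiff

theorem toSchwartz_mem_testSpace (hφ : IsTest Ω φ) : hφ.toSchwartz ∈ testSpace Ω := hφ

theorem eq_zero_of_notMem (hφ : IsTest Ω φ) {x : EuclideanSpace ℝ (Fin N)} (hx : x ∉ Ω) :
    φ x = 0 :=
  image_eq_zero_of_notMem_tsupport fun h => hx (hφ.tsupport_subset h)

theorem iteratedFDeriv_eq_zero_of_notMem (hφ : IsTest Ω φ) {x : EuclideanSpace ℝ (Fin N)}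
    (hx : x ∉ Ω) (k : ℕ) : iteratedFDeriv ℝ k φ x = 0 := by
  contrapose! hx
  exact hφ.tsupport_subset (support_iteratedFDeriv_subset (𝕜 := ℝ) k hx)

end IsTest

theorem inner_restrictL2 (u : L2 Ω) (f : 𝓢(EuclideanSpace ℝ (Fin N), ℝ)) :
    ⟪u, restrictL2 Ω f⟫_ℝ = ∫ x in Ω, u x * f x := by
  rw [L2.inner_def]
  refine integral_congr_ae ?_
  filter_upwards [coeFn_restrictL2 Ω f] with x hx
  rw [hx, real_inner_eq_re_inner, RCLike.inner_apply]
  simp [mul_comm]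

theorem inner_restrictL2_of_ae_eq {u : L2 Ω} {w : EuclideanSpace ℝ (Fin N) → ℝ}
    (hu : u =ᵐ[volume.restrict Ω] w) (hg : g ∈ testSpace Ω) :
    ⟪u, restrictL2 Ω g⟫_ℝ = ∫ x, w x * g x := by
  rw [inner_restrictL2, ← setIntegral_eq_integral_of_forall_compl_eq_zero (s := Ω)
    (f := fun x => w x * g x) fun x hx => by rw [IsTest.eq_zero_of_notMem hg hx, mul_zero]]
  refine integral_congr_ae ?_
  filter_upwards [hu] with x hx
  rw [hx]

theorem norm_restrictL2_sq (hf : f ∈ testSpace Ω) :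
    ‖restrictL2 Ω f‖ ^ 2 = energyForm (EuclideanSpace.basisFun (Fin N) ℝ) 0 f f := by
  rw [← real_inner_self_eq_norm_sq, inner_restrictL2_of_ae_eq (coeFn_restrictL2 Ω f) hf,
    energyForm_zero]
  simp only [pow_two]

theorem norm_derivMap_le {k : ℕ} (hkm : k ≤ m) (hf : f ∈ testSpace Ω) :
    ‖derivMap k f‖ ≤ ‖restrictL2 Ω f‖ + ‖derivMap m f‖ := by
  refine le_of_sq_le_sq ?_ (by positivity)
  calc ‖derivMap k f‖ ^ 2 ≤ ‖restrictL2 Ω f‖ ^ 2 + ‖derivMap m f‖ ^ 2 := by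
        simpa only [norm_restrictL2_sq hf, norm_derivMap_sq] using energyForm_self_le _ hkm f
    _ ≤ (‖restrictL2 Ω f‖ + ‖derivMap m f‖) ^ 2 := by
        nlinarith [norm_nonneg (restrictL2 Ω f), norm_nonneg (derivMap m f)]

theorem schwartzLaplacian_mem_testSpace (m : ℕ) (hf : f ∈ testSpace Ω) :
    schwartzLaplacian m f ∈ testSpace Ω := by
  change IsTest Ω _
  rw [coe_schwartzLaplacian]
  exact IsTest.iterLaplacian m hf

theorem isWeakPolyharmonic_iff {u g : L2 Ω} :
    IsWeakPolyharmonic Ω m u g ↔ ∀ f ∈ testSpace Ω, ⟪g, restrictL2 Ω f⟫_ℝ =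
      (-1) ^ (m + 1) * ⟪u, restrictL2 Ω (schwartzLaplacian m f)⟫_ℝ := by
  simp only [inner_restrictL2, coe_schwartzLaplacian]
  exact ⟨fun h f hf => h f hf, fun h φ hφ => h hφ.toSchwartz hφ.toSchwartz_mem_testSpace⟩

variable (Ω) in
/-- The closure of the graph of `derivMap` on the test functions. A pair `(u, w)` in it consists of
a function `u ∈ H₀ᵐ(Ω)` and the family `w` of its weak derivatives of order `m`. -/
noncomputable def formGraph (m : ℕ) : Submodule ℝ (L2 Ω × DerivSpace N m) :=
  ((testSpace Ω).map ((restrictL2 Ω).prod (derivMap m))).topologicalClosure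

theorem mem_formGraph_iff {x : L2 Ω × DerivSpace N m} :
    x ∈ formGraph Ω m ↔ ∃ f : ℕ → 𝓢(EuclideanSpace ℝ (Fin N), ℝ), (∀ n, f n ∈ testSpace Ω) ∧
      Tendsto (fun n => restrictL2 Ω (f n)) atTop (𝓝 x.1) ∧
      Tendsto (fun n => derivMap m (f n)) atTop (𝓝 x.2) := by
  rw [formGraph, ← SetLike.mem_coe, Submodule.topologicalClosure_coe, mem_closure_iff_seq_limit]
  constructor
  · rintro ⟨y, hy, hyx⟩
    choose f hf hfy using hy
    obtain rfl : (fun n => (restrictL2 Ω (f n), derivMap m (f n))) = y := funext hfy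
    exact ⟨f, hf, hyx.fst_nhds, hyx.snd_nhds⟩
  · rintro ⟨f, hf, hres, hder⟩
    exact ⟨fun n => (restrictL2 Ω (f n), derivMap m (f n)), fun n => ⟨f n, hf n, rfl⟩,
      hres.prodMk_nhds hder⟩

theorem inner_restrictL2_schwartzLaplacian {u : L2 Ω} {w : DerivSpace N m}
    (huw : (u, w) ∈ formGraph Ω m) (hf : f ∈ testSpace Ω) :
    ⟪w, derivMap m f⟫_ℝ = (-1) ^ m * ⟪u, restrictL2 Ω (schwartzLaplacian m f)⟫_ℝ := by
  obtain ⟨φ, -, hφu, hφw⟩ := mem_formGraph_iff.1 huw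
  refine tendsto_nhds_unique (hφw.inner tendsto_const_nhds)
    (((hφu.inner tendsto_const_nhds).const_mul _).congr fun n => ?_)
  rw [inner_restrictL2_of_ae_eq (coeFn_restrictL2 Ω (φ n)) (schwartzLaplacian_mem_testSpace m hf),
    ← energyForm_eq_integral_mul_schwartzLaplacian (EuclideanSpace.basisFun (Fin N) ℝ),
    inner_derivMap]

theorem inner_eq_neg_inner_of_isWeakPolyharmonic {u v g : L2 Ω} {w z : DerivSpace N m}
    (huw : (u, w) ∈ formGraph Ω m) (hg : IsWeakPolyharmonic Ω m u g)
    (hvz : (v, z) ∈ formGraph Ω m) : ⟪g, v⟫_ℝ = -⟪w, z⟫_ℝ := by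
  obtain ⟨φ, hφ, hφv, hφz⟩ := mem_formGraph_iff.1 hvz
  refine tendsto_nhds_unique (tendsto_const_nhds.inner hφv)
    ((tendsto_const_nhds.inner hφz).neg.congr fun n => ?_)
  rw [inner_restrictL2_schwartzLaplacian huw (hφ n), isWeakPolyharmonic_iff.1 hg _ (hφ n)]
  ring

theorem eLpNorm_partialDeriv_le (b : OrthonormalBasis (Fin N) ℝ (EuclideanSpace ℝ (Fin N)))
    (α : Fin m → Fin N) (hf : f ∈ testSpace Ω) :
    eLpNorm (partialDeriv b α f) 2 volume ≤
      eLpNorm (iteratedFDeriv ℝ m f) 2 (volume.restrict Ω) := by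
  rw [← eLpNorm_restrict_eq_of_support_subset (s := Ω)]
  · exact eLpNorm_mono (norm_partialDeriv_le b α f)
  · intro x hx
    by_contra hxΩ
    apply hx
    rw [partialDeriv_apply, IsTest.iteratedFDeriv_eq_zero_of_notMem hf hxΩ]
    rfl

theorem enorm_derivMap_le (hf : f ∈ testSpace Ω) :
    ‖derivMap m f‖ₑ ≤
      Fintype.card (Fin m → Fin N) * eLpNorm (iteratedFDeriv ℝ m f) 2 (volume.restrict Ω) := by
  have hsum : ‖derivMap m f‖ ≤ ∑ α : Fin m → Fin N, ‖derivMap m f α‖ := by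
    refine le_of_sq_le_sq ?_ (Finset.sum_nonneg fun _ _ => norm_nonneg _)
    rw [PiLp.norm_sq_eq_of_L2]
    exact Finset.sum_sq_le_sq_sum_of_nonneg fun _ _ => norm_nonneg _
  calc ‖derivMap m f‖ₑ = ENNReal.ofReal ‖derivMap m f‖ := (ofReal_norm _).symm
    _ ≤ ENNReal.ofReal (∑ α : Fin m → Fin N, ‖derivMap m f α‖) := ENNReal.ofReal_le_ofReal hsum
    _ = ∑ α : Fin m → Fin N, ‖derivMap m f α‖ₑ := by
      rw [ENNReal.ofReal_sum_of_nonneg fun _ _ => norm_nonneg _]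
      simp only [ofReal_norm]
    _ ≤ ∑ _ : Fin m → Fin N, eLpNorm (iteratedFDeriv ℝ m f) 2 (volume.restrict Ω) := by
      simp only [← eLpNorm_partialDeriv_eq_enorm_derivMap]
      exact Finset.sum_le_sum fun α _ => eLpNorm_partialDeriv_le _ α hf
    _ = _ := by rw [Finset.sum_const, nsmul_eq_mul, Finset.card_univ]

theorem eLpNorm_iteratedFDeriv_le {k : ℕ} (hkm : k ≤ m) (hf : f ∈ testSpace Ω) :
    eLpNorm (iteratedFDeriv ℝ k f) 2 (volume.restrict Ω) ≤
      Fintype.card (Fin k → Fin N) * (‖restrictL2 Ω f‖ₑ + ‖derivMap m f‖ₑ) := by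
  set b := EuclideanSpace.basisFun (Fin N) ℝ
  have hα (α : Fin k → Fin N) : ‖derivMap k f α‖ₑ ≤ ‖restrictL2 Ω f‖ₑ + ‖derivMap m f‖ₑ := by
    simp only [← ofReal_norm]
    rw [← ENNReal.ofReal_add (norm_nonneg _) (norm_nonneg _)]
    exact ENNReal.ofReal_le_ofReal ((PiLp.norm_apply_le _ α).trans (norm_derivMap_le hkm hf))
  calc eLpNorm (iteratedFDeriv ℝ k f) 2 (volume.restrict Ω)
      ≤ eLpNorm (iteratedFDeriv ℝ k f) 2 volume := eLpNorm_mono_measure _ Measure.restrict_le_self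
    _ ≤ eLpNorm (∑ α : Fin k → Fin N, fun x => ‖partialDeriv b α f x‖) 2 volume :=
        eLpNorm_mono_real fun x => by
          simpa only [Finset.sum_apply] using norm_iteratedFDeriv_le_sum_norm_partialDeriv b f x
    _ ≤ ∑ α : Fin k → Fin N, eLpNorm (fun x => ‖partialDeriv b α f x‖) 2 volume :=
        eLpNorm_sum_le (fun α _ => (partialDeriv b α f).continuous.norm.aestronglyMeasurable)
          (by norm_num)
    _ ≤ ∑ _ : Fin k → Fin N, (‖restrictL2 Ω f‖ₑ + ‖derivMap m f‖ₑ) := by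
        simp only [eLpNorm_norm, b, eLpNorm_partialDeriv_eq_enorm_derivMap]
        exact Finset.sum_le_sum fun α _ => hα α
    _ = _ := by rw [Finset.sum_const, nsmul_eq_mul, Finset.card_univ]

theorem tendsto_restrictL2_iff {f : ℕ → 𝓢(EuclideanSpace ℝ (Fin N), ℝ)} {u : L2 Ω} :
    Tendsto (fun n => restrictL2 Ω (f n)) atTop (𝓝 u) ↔
      Tendsto (fun n => eLpNorm (fun x => f n x - u x) 2 (volume.restrict Ω)) atTop (𝓝 0) := by
  rw [Lp.tendsto_Lp_iff_tendsto_eLpNorm']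
  refine tendsto_congr fun n => eLpNorm_congr_ae ?_
  filter_upwards [coeFn_restrictL2 Ω (f n)] with x hx
  rw [Pi.sub_apply, hx]

theorem cauchySeq_iff_tendsto_enorm_sub {F : Type*} [NormedAddCommGroup F] {u : ℕ → F} :
    CauchySeq u ↔ Tendsto (fun q : ℕ × ℕ => ‖u q.1 - u q.2‖ₑ) atTop (𝓝 0) := by
  rw [cauchySeq_iff_tendsto_dist_atTop_0, ← ENNReal.ofReal_zero,
    ← ENNReal.tendsto_toReal_iff (fun _ => enorm_ne_top) ENNReal.ofReal_ne_top]
  simp only [toReal_enorm, dist_eq_norm, ENNReal.ofReal_zero, ENNReal.toReal_zero]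

theorem MemH0.exists_mem_formGraph {u : L2 Ω} (hu : MemH0 Ω m u) :
    ∃ w : DerivSpace N m, (u, w) ∈ formGraph Ω m := by
  obtain ⟨φ, hφ, hφu, hφc⟩ := hu
  have htest (n : ℕ) : (hφ n).toSchwartz ∈ testSpace Ω := (hφ n).toSchwartz_mem_testSpace
  have hcauchy : CauchySeq fun n => derivMap m (hφ n).toSchwartz := by
    rw [cauchySeq_iff_tendsto_enorm_sub]
    have hbound := ENNReal.Tendsto.const_mul (hφc m le_rfl)
      (.inr (ENNReal.natCast_ne_top (Fintype.card (Fin m → Fin N))))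
    rw [mul_zero] at hbound
    refine tendsto_of_tendsto_of_tendsto_of_le_of_le tendsto_const_nhds hbound
      (fun q => zero_le) fun q => ?_
    rw [← map_sub]
    exact enorm_derivMap_le ((testSpace Ω).sub_mem (htest q.1) (htest q.2))
  obtain ⟨w, hw⟩ := cauchySeq_tendsto_of_complete hcauchy
  exact ⟨w, mem_formGraph_iff.2 ⟨_, htest, tendsto_restrictL2_iff.2 hφu, hw⟩⟩

theorem memH0_of_mem_formGraph {u : L2 Ω} {w : DerivSpace N m} (huw : (u, w) ∈ formGraph Ω m) :
    MemH0 Ω m u := by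
  obtain ⟨f, hf, hfu, hfw⟩ := mem_formGraph_iff.1 huw
  refine ⟨fun n => f n, hf, tendsto_restrictL2_iff.1 hfu, fun k hk => ?_⟩
  have hbound := ENNReal.Tendsto.const_mul
    ((cauchySeq_iff_tendsto_enorm_sub.1 hfu.cauchySeq).add
      (cauchySeq_iff_tendsto_enorm_sub.1 hfw.cauchySeq))
    (.inr (ENNReal.natCast_ne_top (Fintype.card (Fin k → Fin N))))
  rw [add_zero, mul_zero] at hbound
  refine tendsto_of_tendsto_of_tendsto_of_le_of_le tendsto_const_nhds hbound
    (fun q => zero_le) fun q => ?_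
  have hcoe : (f q.1 : EuclideanSpace ℝ (Fin N) → ℝ) - f q.2 = (f q.1 - f q.2 : 𝓢(_, ℝ)) := rfl
  rw [← map_sub, ← map_sub, hcoe]
  exact eLpNorm_iteratedFDeriv_le hk ((testSpace Ω).sub_mem (hf q.1) (hf q.2))

theorem memH0_iff {u : L2 Ω} : MemH0 Ω m u ↔ ∃ w : DerivSpace N m, (u, w) ∈ formGraph Ω m :=
  ⟨MemH0.exists_mem_formGraph, fun ⟨_, huw⟩ => memH0_of_mem_formGraph huw⟩

end FormDomain

/-! ### Compactness of the embedding of the form domain -/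

section Rellich

open scoped SchwartzMap FourierTransform

theorem exists_weakly_convergent_subseq {H : Type*} [NormedAddCommGroup H] [InnerProductSpace ℝ H]
    [CompleteSpace H] [TopologicalSpace.SeparableSpace H] {a : ℕ → H} {C : ℝ}
    (ha : ∀ n, ‖a n‖ ≤ C) :
    ∃ φ : ℕ → ℕ, StrictMono φ ∧
      ∃ l, ∀ v, Tendsto (fun n => ⟪v, a (φ n)⟫_ℝ) atTop (𝓝 ⟪v, l⟫_ℝ) := by
  obtain ⟨y, -, φ, hφ, hy⟩ := WeakDual.isSeqCompact_closedBall ℝ H 0 C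
    (x := fun n => StrongDual.toWeakDual (InnerProductSpace.toDual ℝ H (a n)))
    (fun n => by simpa using ha n)
  refine ⟨φ, hφ, (InnerProductSpace.toDual ℝ H).symm (WeakDual.toStrongDual y), fun v => ?_⟩
  rw [real_inner_comm, InnerProductSpace.toDual_symm_apply]
  refine (((WeakDual.eval_continuous v).tendsto y).comp hy).congr fun n => ?_
  simp [real_inner_comm]

variable {N m : ℕ} {Ω : Set (EuclideanSpace ℝ (Fin N))}

theorem exists_inner_restrictL2_eq_integral [IsFiniteMeasure (volume.restrict Ω)]
    {w : EuclideanSpace ℝ (Fin N) → ℝ} (hw : Continuous w) (hw1 : ∀ x, |w x| ≤ 1) :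
    ∃ W : L2 Ω, ‖W‖ ≤ (volume.restrict Ω).real Set.univ ^ ((2 : ENNReal).toReal)⁻¹ ∧
      ∀ f ∈ testSpace Ω, ⟪W, restrictL2 Ω f⟫_ℝ = ∫ x, w x * f x := by
  have hwL2 : MemLp w 2 (volume.restrict Ω) :=
    MemLp.of_bound hw.aestronglyMeasurable 1 (.of_forall hw1)
  refine ⟨hwL2.toLp w, ?_, fun f hf => inner_restrictL2_of_ae_eq hwL2.coeFn_toLp hf⟩
  rw [← mul_one (_ ^ _)]
  refine Lp.norm_le_of_ae_bound zero_le_one ?_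
  filter_upwards [hwL2.coeFn_toLp] with x hx
  rw [hx]
  exact hw1 x

theorem fourier_complexify_sub_apply (f g : 𝓢(EuclideanSpace ℝ (Fin N), ℝ))
    (ξ : EuclideanSpace ℝ (Fin N)) :
    𝓕 (complexify (f - g)) ξ = 𝓕 (complexify f) ξ - 𝓕 (complexify g) ξ := by
  have hsub : complexify (f - g) = complexify f - complexify g :=
    map_sub (SchwartzMap.postcompCLM (𝕜 := ℝ) Complex.ofRealCLM) f g
  rw [hsub]
  exact DFunLike.congr_fun (map_sub
    (FourierTransform.fourierCLM ℂ 𝓢(EuclideanSpace ℝ (Fin N), ℂ)) _ _) ξ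

theorem fourier_complexify_eq_cos_sub_sin (f : 𝓢(EuclideanSpace ℝ (Fin N), ℝ))
    (ξ : EuclideanSpace ℝ (Fin N)) :
    𝓕 (complexify f) ξ = ((∫ x, Real.cos (2 * Real.pi * ⟪x, ξ⟫_ℝ) * f x : ℝ) : ℂ) -
      Complex.I * ((∫ x, Real.sin (2 * Real.pi * ⟪x, ξ⟫_ℝ) * f x : ℝ) : ℂ) := by
  have hint {w : ℝ → ℝ} (hw : Continuous w) (hw1 : ∀ t, |w t| ≤ 1) :
      Integrable fun x => ((w (2 * Real.pi * ⟪x, ξ⟫_ℝ) * f x : ℝ) : ℂ) :=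
    .ofReal (f.integrable.bdd_mul (c := 1) (Continuous.aestronglyMeasurable (by fun_prop))
      (.of_forall fun _ => hw1 _))
  rw [← integral_complex_ofReal, ← integral_complex_ofReal, ← integral_const_mul,
    ← integral_sub (hint Real.continuous_cos Real.abs_cos_le_one)
      ((hint Real.continuous_sin Real.abs_sin_le_one).const_mul _),
    SchwartzMap.fourier_coe, Real.fourier_eq']
  refine integral_congr_ae (.of_forall fun x => ?_)
  simp only [complexify_apply, smul_eq_mul]
  rw [Complex.exp_mul_I, ← Complex.ofReal_cos, ← Complex.ofReal_sin, neg_mul, neg_mul,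
    Real.cos_neg, Real.sin_neg]
  push_cast
  ring

theorem exists_fourier_complexify_eq_inner [IsFiniteMeasure (volume.restrict Ω)] :
    ∃ B : ℝ, ∀ ξ, ∃ c s : L2 Ω, ‖c‖ ≤ B ∧ ‖s‖ ≤ B ∧ ∀ f ∈ testSpace Ω,
      𝓕 (complexify f) ξ =
        (⟪c, restrictL2 Ω f⟫_ℝ : ℂ) - Complex.I * (⟪s, restrictL2 Ω f⟫_ℝ : ℂ) := by
  refine ⟨(volume.restrict Ω).real Set.univ ^ ((2 : ENNReal).toReal)⁻¹, fun ξ => ?_⟩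
  obtain ⟨c, hcB, hc⟩ := exists_inner_restrictL2_eq_integral (Ω := Ω)
    (w := fun x => Real.cos (2 * Real.pi * ⟪x, ξ⟫_ℝ)) (by fun_prop) fun _ => Real.abs_cos_le_one _
  obtain ⟨s, hsB, hs⟩ := exists_inner_restrictL2_eq_integral (Ω := Ω)
    (w := fun x => Real.sin (2 * Real.pi * ⟪x, ξ⟫_ℝ)) (by fun_prop) fun _ => Real.abs_sin_le_one _
  refine ⟨c, s, hcB, hsB, fun f hf => ?_⟩
  rw [hc f hf, hs f hf, fourier_complexify_eq_cos_sub_sin]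

theorem exists_norm_fourier_complexify_le [IsFiniteMeasure (volume.restrict Ω)] :
    ∃ B : ℝ, ∀ f ∈ testSpace Ω, ∀ ξ, ‖𝓕 (complexify f) ξ‖ ≤ B * ‖restrictL2 Ω f‖ := by
  obtain ⟨B, hB⟩ := exists_fourier_complexify_eq_inner (Ω := Ω)
  refine ⟨B + B, fun f hf ξ => ?_⟩
  obtain ⟨c, s, hc, hs, hcs⟩ := hB ξ
  have hinner {v : L2 Ω} (hv : ‖v‖ ≤ B) :
      ‖(⟪v, restrictL2 Ω f⟫_ℝ : ℂ)‖ ≤ B * ‖restrictL2 Ω f‖ := by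
    rw [Complex.norm_real]
    exact (norm_inner_le_norm _ _).trans (by gcongr)
  rw [hcs f hf, add_mul]
  refine (norm_sub_le _ _).trans (add_le_add (hinner hc) ?_)
  rw [norm_mul, Complex.norm_I, one_mul]
  exact hinner hs

theorem exists_tendsto_fourier_complexify [IsFiniteMeasure (volume.restrict Ω)]
    {f : ℕ → 𝓢(EuclideanSpace ℝ (Fin N), ℝ)} (hf : ∀ n, f n ∈ testSpace Ω) {l : L2 Ω}
    (hl : ∀ v, Tendsto (fun n => ⟪v, restrictL2 Ω (f n)⟫_ℝ) atTop (𝓝 ⟪v, l⟫_ℝ))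
    (ξ : EuclideanSpace ℝ (Fin N)) :
    ∃ z, Tendsto (fun n => 𝓕 (complexify (f n)) ξ) atTop (𝓝 z) := by
  obtain ⟨B, hB⟩ := exists_fourier_complexify_eq_inner (Ω := Ω)
  obtain ⟨c, s, -, -, hcs⟩ := hB ξ
  exact ⟨_, ((hl c).ofReal.sub ((hl s).ofReal.const_mul Complex.I)).congr fun n =>
    (hcs _ (hf n)).symm⟩

theorem norm_restrictL2_sq_le_low_add_high (hm : 0 < m) {f : 𝓢(EuclideanSpace ℝ (Fin N), ℝ)}
    (hf : f ∈ testSpace Ω) {R : ℝ} (hR : 1 ≤ R) :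
    ‖restrictL2 Ω f‖ ^ 2 ≤
      (∫ ξ in Metric.closedBall 0 R, ‖𝓕 (complexify f) ξ‖ ^ 2) + ‖derivMap m f‖ ^ 2 / R := by
  have hint : Integrable fun ξ => ‖𝓕 (complexify f) ξ‖ ^ 2 := by
    simpa using integrable_weighted_fourier 0 f
  have hlow := hint.indicator (measurableSet_closedBall (x := 0) (ε := R))
  have hhigh := (integrable_weighted_fourier m f).const_mul R⁻¹
  rw [norm_restrictL2_sq hf, norm_derivMap_sq, energyForm_self_eq, energyForm_self_eq,
    div_eq_inv_mul, ← integral_indicator measurableSet_closedBall, ← integral_const_mul,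
    ← integral_add hlow hhigh]
  refine integral_mono (integrable_weighted_fourier 0 f) (hlow.add hhigh) fun ξ => ?_
  simp only [mul_zero, pow_zero, one_mul]
  by_cases hξ : ξ ∈ Metric.closedBall (0 : EuclideanSpace ℝ (Fin N)) R
  · rw [Set.indicator_of_mem hξ]
    exact le_add_of_nonneg_right (by positivity)
  · have hRξ : R ≤ 2 * Real.pi * ‖ξ‖ := by
      rw [mem_closedBall_zero_iff, not_le] at hξ
      nlinarith [Real.pi_gt_three]
    rw [Set.indicator_of_notMem hξ, zero_add, ← mul_assoc]
    refine le_mul_of_one_le_left (by positivity) ?_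
    rw [← div_eq_inv_mul, one_le_div (by linarith)]
    exact hRξ.trans (le_self_pow₀ (hR.trans hRξ) (by lia))

theorem tendsto_zero_of_forall_le_add_div {β : Type*} {l : Filter β} {a : β → ℝ} {c : ℝ → β → ℝ}
    {K : ℝ} (ha : ∀ q, 0 ≤ a q) (hle : ∀ R ≥ 1, ∀ q, a q ≤ c R q + K / R)
    (hc : ∀ R, Tendsto (c R) l (𝓝 0)) : Tendsto a l (𝓝 0) := by
  rw [tendsto_order]
  refine ⟨fun ε hε => .of_forall fun q => hε.trans_le (ha q), fun ε hε => ?_⟩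
  have hK : Tendsto (fun R : ℝ => K / R) atTop (𝓝 0) := tendsto_const_nhds.div_atTop tendsto_id
  obtain ⟨R, hKR, hR⟩ :=
    ((hK.eventually_lt_const (half_pos hε)).and (eventually_ge_atTop 1)).exists
  filter_upwards [(hc R).eventually_lt_const (half_pos hε)] with q hq
  linarith [hle R hR q]

theorem tendsto_setIntegral_closedBall_norm_sq {β : Type*} {l : Filter β}
    [l.IsCountablyGenerated] {g : β → EuclideanSpace ℝ (Fin N) → ℂ} (hg : ∀ q, Continuous (g q))
    {K : ℝ} (hK : ∀ q ξ, ‖g q ξ‖ ≤ K) (hlim : ∀ ξ, Tendsto (fun q => g q ξ) l (𝓝 0)) (R : ℝ) :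
    Tendsto (fun q => ∫ ξ in Metric.closedBall 0 R, ‖g q ξ‖ ^ 2) l (𝓝 0) := by
  simpa using tendsto_integral_filter_of_dominated_convergence
    (μ := volume.restrict (Metric.closedBall (0 : EuclideanSpace ℝ (Fin N)) R)) (f := fun _ => 0)
    (fun _ => K ^ 2) (.of_forall fun q => ((hg q).norm.pow 2).aestronglyMeasurable)
    (.of_forall fun q => .of_forall fun ξ => by
      rw [Pi.pow_apply, norm_pow, norm_norm]
      exact pow_le_pow_left₀ (norm_nonneg _) (hK q ξ) 2)
    (integrableOn_const measure_closedBall_lt_top.ne)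
    (.of_forall fun ξ => by simpa using (hlim ξ).norm.pow 2)

/-- On test functions the weak convergence of a subsequence becomes pointwise convergence of the
Fourier transforms, which are uniformly bounded: the low frequencies converge by dominated
convergence, and the high frequencies are small because the `m`-th derivatives are bounded. -/
theorem exists_subseq_cauchySeq_restrictL2 [IsFiniteMeasure (volume.restrict Ω)] (hm : 0 < m)
    {f : ℕ → 𝓢(EuclideanSpace ℝ (Fin N), ℝ)} (hf : ∀ n, f n ∈ testSpace Ω) {C : ℝ}
    (hres : ∀ n, ‖restrictL2 Ω (f n)‖ ≤ C) (hder : ∀ n, ‖derivMap m (f n)‖ ≤ C) :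
    ∃ φ : ℕ → ℕ, StrictMono φ ∧ CauchySeq fun n => restrictL2 Ω (f (φ n)) := by
  have : Fact ((2 : ENNReal) ≠ ⊤) := ⟨ENNReal.ofNat_ne_top⟩
  obtain ⟨φ, hφ, l, hl⟩ := exists_weakly_convergent_subseq hres
  obtain ⟨B, hB⟩ := exists_norm_fourier_complexify_le (Ω := Ω)
  refine ⟨φ, hφ, ?_⟩
  set d : ℕ × ℕ → 𝓢(EuclideanSpace ℝ (Fin N), ℝ) := fun q => f (φ q.1) - f (φ q.2) with hd
  have hdt (q) : d q ∈ testSpace Ω := (testSpace Ω).sub_mem (hf _) (hf _)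
  have hdres (q) : ‖restrictL2 Ω (d q)‖ ≤ C + C := by
    rw [hd, map_sub]
    exact (norm_sub_le _ _).trans (add_le_add (hres _) (hres _))
  have hdder (q) : ‖derivMap m (d q)‖ ≤ C + C := by
    rw [hd, map_sub]
    exact (norm_sub_le _ _).trans (add_le_add (hder _) (hder _))
  have hbound (q ξ) : ‖𝓕 (complexify (d q)) ξ‖ ≤ |B| * (C + C) :=
    (hB _ (hdt q) ξ).trans (mul_le_mul (le_abs_self B) (hdres q) (norm_nonneg _) (abs_nonneg B))
  have hpointwise (ξ) : Tendsto (fun q => 𝓕 (complexify (d q)) ξ) atTop (𝓝 0) := by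
    obtain ⟨z, hz⟩ := exists_tendsto_fourier_complexify (fun n => hf (φ n)) hl ξ
    have hsub := (hz.comp tendsto_fst).sub (hz.comp tendsto_snd)
    rw [sub_self, prod_atTop_atTop_eq] at hsub
    refine hsub.congr fun q => ?_
    exact (fourier_complexify_sub_apply _ _ ξ).symm
  have hnorm_sq : Tendsto (fun q => ‖restrictL2 Ω (d q)‖ ^ 2) atTop (𝓝 0) :=
    tendsto_zero_of_forall_le_add_div (fun q => sq_nonneg _)
      (fun R hR q => (norm_restrictL2_sq_le_low_add_high hm (hdt q) hR).trans
        (add_le_add_right (div_le_div_of_nonneg_right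
          (pow_le_pow_left₀ (norm_nonneg _) (hdder q) 2) (zero_le_one.trans hR)) _))
      (tendsto_setIntegral_closedBall_norm_sq (fun q => (𝓕 (complexify (d q))).continuous)
        hbound hpointwise)
  rw [cauchySeq_iff_tendsto_dist_atTop_0, ← Real.sqrt_zero]
  refine hnorm_sq.sqrt.congr fun q => ?_
  rw [Real.sqrt_sq (norm_nonneg _), hd, map_sub, dist_eq_norm]

end Rellich

/-! ### The Dirichlet realization of the polyharmonic operator -/

section DirichletDomain

variable {N : ℕ} {Ω : Set (EuclideanSpace ℝ (Fin N))} {m : ℕ}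

variable (Ω m) in
/-- The embedding of the Dirichlet domain into `L²(Ω)`. -/
noncomputable def toL2CLM : dirichletDomain Ω m →L[ℝ] L2 Ω :=
  ContinuousLinearMap.fst ℝ (L2 Ω) (L2 Ω) ∘L (dirichletDomain Ω m).subtypeL

variable (Ω m) in
/-- The operator `(-1)^(m+1) Δ^m`, bounded on its domain with the graph norm. -/
noncomputable def polyLaplacianCLM : dirichletDomain Ω m →L[ℝ] L2 Ω :=
  ContinuousLinearMap.snd ℝ (L2 Ω) (L2 Ω) ∘L (dirichletDomain Ω m).subtypeL

theorem toL2CLM_apply (x : dirichletDomain Ω m) : toL2CLM Ω m x = toL2 x := rfl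

theorem polyLaplacianCLM_apply (x : dirichletDomain Ω m) :
    polyLaplacianCLM Ω m x = polyLaplacian x := rfl

theorem norm_eq_max (x : dirichletDomain Ω m) :
    ‖x‖ = max ‖toL2CLM Ω m x‖ ‖polyLaplacianCLM Ω m x‖ := rfl

theorem norm_toL2CLM_le (x : dirichletDomain Ω m) : ‖toL2CLM Ω m x‖ ≤ ‖x‖ := le_max_left _ _

theorem norm_polyLaplacianCLM_le (x : dirichletDomain Ω m) : ‖polyLaplacianCLM Ω m x‖ ≤ ‖x‖ :=
  le_max_right _ _

theorem tendsto_dirichletDomain_iff {β : Type*} {l : Filter β} {x : β → dirichletDomain Ω m}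
    {y : dirichletDomain Ω m} : Tendsto x l (𝓝 y) ↔
      Tendsto (fun b => toL2CLM Ω m (x b)) l (𝓝 (toL2CLM Ω m y)) ∧
      Tendsto (fun b => polyLaplacianCLM Ω m (x b)) l (𝓝 (polyLaplacianCLM Ω m y)) := by
  rw [tendsto_subtype_rng, Prod.tendsto_iff]
  rfl

theorem norm_sq_eq_of_mem_dirichletDomain {x : L2 Ω × L2 Ω} (hx : x ∈ dirichletDomain Ω m)
    {w : DerivSpace N m} (hw : (x.1, w) ∈ formGraph Ω m) : ‖w‖ ^ 2 = -⟪x.2, x.1⟫_ℝ := by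
  rw [inner_eq_neg_inner_of_isWeakPolyharmonic hw hx.2 hw, real_inner_self_eq_norm_sq, neg_neg]

theorem norm_le_of_mem_dirichletDomain {x : L2 Ω × L2 Ω} (hx : x ∈ dirichletDomain Ω m)
    {w : DerivSpace N m} (hw : (x.1, w) ∈ formGraph Ω m) : ‖w‖ ≤ ‖x‖ := by
  refine le_of_sq_le_sq ?_ (norm_nonneg _)
  calc ‖w‖ ^ 2 = -⟪x.2, x.1⟫_ℝ := norm_sq_eq_of_mem_dirichletDomain hx hw
    _ ≤ ‖⟪x.2, x.1⟫_ℝ‖ := neg_le_abs _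
    _ ≤ ‖x.2‖ * ‖x.1‖ := norm_inner_le_norm _ _
    _ ≤ ‖x‖ * ‖x‖ :=
      mul_le_mul (norm_snd_le x) (norm_fst_le x) (norm_nonneg _) (norm_nonneg _)
    _ = ‖x‖ ^ 2 := (pow_two _).symm

theorem inner_polyLaplacianCLM_symm (x y : dirichletDomain Ω m) :
    ⟪polyLaplacianCLM Ω m x, toL2CLM Ω m y⟫_ℝ = ⟪polyLaplacianCLM Ω m y, toL2CLM Ω m x⟫_ℝ := by
  obtain ⟨w, hw⟩ := memH0_iff.1 x.2.1
  obtain ⟨z, hz⟩ := memH0_iff.1 y.2.1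
  calc ⟪polyLaplacianCLM Ω m x, toL2CLM Ω m y⟫_ℝ = -⟪w, z⟫_ℝ :=
        inner_eq_neg_inner_of_isWeakPolyharmonic hw x.2.2 hz
    _ = -⟪z, w⟫_ℝ := by rw [real_inner_comm]
    _ = ⟪polyLaplacianCLM Ω m y, toL2CLM Ω m x⟫_ℝ :=
        (inner_eq_neg_inner_of_isWeakPolyharmonic hz y.2.2 hw).symm

theorem inner_polyLaplacianCLM_nonpos (x : dirichletDomain Ω m) :
    ⟪polyLaplacianCLM Ω m x, toL2CLM Ω m x⟫_ℝ ≤ 0 := by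
  obtain ⟨w, hw⟩ := memH0_iff.1 x.2.1
  exact neg_nonneg.1 ((sq_nonneg ‖w‖).trans_eq (norm_sq_eq_of_mem_dirichletDomain x.2 hw))

theorem isClosed_setOf_isWeakPolyharmonic :
    IsClosed {x : L2 Ω × L2 Ω | IsWeakPolyharmonic Ω m x.1 x.2} := by
  simp only [isWeakPolyharmonic_iff, Set.ofPred_forall]
  refine isClosed_iInter fun f => isClosed_iInter fun _ => isClosed_eq ?_ ?_
  · exact continuous_snd.inner continuous_const
  · exact continuous_const.mul (continuous_fst.inner continuous_const)

theorem isClosed_dirichletDomain : IsClosed (dirichletDomain Ω m : Set (L2 Ω × L2 Ω)) := by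
  refine isSeqClosed_iff_isClosed.1 fun x y hx hxy => ?_
  choose w hw using fun n => memH0_iff.1 (hx n).1
  have hcauchy : CauchySeq w := by
    rw [Metric.cauchySeq_iff]
    intro ε hε
    obtain ⟨n₀, hn₀⟩ := Metric.cauchySeq_iff.1 hxy.cauchySeq ε hε
    refine ⟨n₀, fun i hi j hj => lt_of_le_of_lt ?_ (hn₀ i hi j hj)⟩
    rw [dist_eq_norm, dist_eq_norm]
    exact norm_le_of_mem_dirichletDomain ((dirichletDomain Ω m).sub_mem (hx i) (hx j))
      ((formGraph Ω m).sub_mem (hw i) (hw j))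
  obtain ⟨z, hz⟩ := cauchySeq_tendsto_of_complete hcauchy
  have hclosed : IsClosed (formGraph Ω m : Set (L2 Ω × DerivSpace N m)) :=
    Submodule.isClosed_topologicalClosure _
  exact ⟨memH0_iff.2 ⟨z, hclosed.mem_of_tendsto
      (((continuous_fst.tendsto y).comp hxy).prodMk_nhds hz) (.of_forall hw)⟩,
    isClosed_setOf_isWeakPolyharmonic.mem_of_tendsto hxy (.of_forall fun n => (hx n).2)⟩

theorem exists_tendsto_of_tendsto {β : Type*} {l : Filter β} [l.NeBot]
    {x : β → dirichletDomain Ω m} {a b : L2 Ω}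
    (ha : Tendsto (fun n => toL2CLM Ω m (x n)) l (𝓝 a))
    (hb : Tendsto (fun n => polyLaplacianCLM Ω m (x n)) l (𝓝 b)) :
    ∃ y : dirichletDomain Ω m, Tendsto x l (𝓝 y) ∧ toL2CLM Ω m y = a ∧
      polyLaplacianCLM Ω m y = b :=
  ⟨⟨(a, b), isClosed_dirichletDomain.mem_of_tendsto (ha.prodMk_nhds hb)
    (.of_forall fun n => (x n).2)⟩, tendsto_dirichletDomain_iff.2 ⟨ha, hb⟩, rfl, rfl⟩

theorem injective_toL2CLM (hΩ : IsOpen Ω) : Function.Injective (toL2CLM Ω m) := by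
  rw [injective_iff_map_eq_zero]
  rintro ⟨⟨_, w⟩, -, hw⟩ (rfl : _ = 0)
  have hzero (φ) (hφ : IsTest Ω φ) : ∫ y in Ω, w y * φ y = 0 := by
    rw [hw φ hφ, integral_congr_ae (g := fun _ => (0 : ℝ)), integral_zero, mul_zero]
    filter_upwards [Lp.coeFn_zero ℝ 2 (volume.restrict Ω)] with y hy
    rw [hy, Pi.zero_apply, zero_mul]
  have hloc : LocallyIntegrableOn w Ω (volume.restrict Ω) :=
    ((Lp.memLp w).locallyIntegrable one_le_two).locallyIntegrableOn _
  have hae := hΩ.ae_eq_zero_of_integral_contDiff_smul_eq_zero hloc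
    fun φ hsmooth hcompact hsupport => by
      rw [← hzero φ ⟨hsmooth, hcompact, hsupport⟩]
      simp only [smul_eq_mul, mul_comm]
  refine Subtype.ext (Prod.ext rfl ((Lp.eq_zero_iff_ae_eq_zero).2 ?_))
  filter_upwards [hae, ae_restrict_mem hΩ.measurableSet] with y hy hyΩ
  exact hy hyΩ

theorem exists_mem_testSpace_norm_sub_lt {u : L2 Ω} {w : DerivSpace N m}
    (huw : (u, w) ∈ formGraph Ω m) {ε : ℝ} (hε : 0 < ε) :
    ∃ f ∈ testSpace Ω, ‖restrictL2 Ω f - u‖ < ε ∧ ‖derivMap m f - w‖ < ε := by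
  obtain ⟨f, hf, hres, hder⟩ := mem_formGraph_iff.1 huw
  obtain ⟨k, hk⟩ := (((tendsto_iff_norm_sub_tendsto_zero.1 hres).eventually_lt_const hε).and
    ((tendsto_iff_norm_sub_tendsto_zero.1 hder).eventually_lt_const hε)).exists
  exact ⟨f k, hf k, hk⟩

theorem exists_subseq_tendsto_toL2CLM [IsFiniteMeasure (volume.restrict Ω)] (hm : 0 < m)
    {x : ℕ → dirichletDomain Ω m} {C : ℝ} (hx : ∀ n, ‖x n‖ ≤ C) :
    ∃ a, ∃ φ : ℕ → ℕ, StrictMono φ ∧ Tendsto (fun n => toL2CLM Ω m (x (φ n))) atTop (𝓝 a) := by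
  choose w hw using fun n => memH0_iff.1 (x n).2.1
  choose f hf hres hder using fun n =>
    exists_mem_testSpace_norm_sub_lt (hw n) (Nat.one_div_pos_of_nat (α := ℝ) (n := n))
  have hle {E : Type} [NormedAddCommGroup E] {p q : E} {n : ℕ} (hq : ‖q‖ ≤ C)
      (hpq : ‖p - q‖ < 1 / ((n : ℝ) + 1)) : ‖p‖ ≤ C + 1 :=
    (norm_le_norm_add_norm_sub' p q).trans (add_le_add hq (hpq.le.trans
      (div_le_self zero_le_one (le_add_of_nonneg_left n.cast_nonneg))))
  obtain ⟨φ, hφ, hcauchy⟩ := exists_subseq_cauchySeq_restrictL2 hm hf (C := C + 1)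
    (fun n => hle ((norm_toL2CLM_le _).trans (hx n)) (hres n))
    (fun n => hle ((norm_le_of_mem_dirichletDomain (x n).2 (hw n)).trans (hx n)) (hder n))
  obtain ⟨a, ha⟩ := cauchySeq_tendsto_of_complete hcauchy
  have hsub : Tendsto (fun n => restrictL2 Ω (f (φ n)) - toL2CLM Ω m (x (φ n))) atTop (𝓝 0) :=
    squeeze_zero_norm (fun n => (hres (φ n)).le)
      (tendsto_one_div_add_atTop_nhds_zero_nat.comp hφ.tendsto_atTop)
  exact ⟨a, φ, hφ, by simpa using ha.sub hsub⟩

end DirichletDomain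

/-! ### Superposition operators and their potentials -/

theorem abs_primitive_sub_sub_le {g : ℝ → ℝ} {L : NNReal} (hg : LipschitzWith L g) (s r : ℝ) :
    |(∫ q in (0 : ℝ)..s, g q) - (∫ q in (0 : ℝ)..r, g q) - g r * (s - r)| ≤ L * (s - r) ^ 2 := by
  have hi (a b) : IntervalIntegrable g volume a b := hg.continuous.intervalIntegrable a b
  have hdiff : (∫ q in (0 : ℝ)..s, g q) - (∫ q in (0 : ℝ)..r, g q) - g r * (s - r) =
      ∫ q in r..s, (g q - g r) := by
    rw [intervalIntegral.integral_interval_sub_left (hi _ _) (hi _ _),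
      intervalIntegral.integral_sub (hi _ _) intervalIntegrable_const,
      intervalIntegral.integral_const, smul_eq_mul, mul_comm]
  rw [hdiff, ← Real.norm_eq_abs]
  calc ‖∫ q in r..s, (g q - g r)‖ ≤ L * |s - r| * |s - r| := by
        refine intervalIntegral.norm_integral_le_of_norm_le_const fun q hq => ?_
        refine (hg.norm_sub_le q r).trans ?_
        gcongr
        exact Set.abs_sub_left_of_mem_uIcc (Set.uIoc_subset_uIcc hq)
    _ = L * (s - r) ^ 2 := by rw [mul_assoc, abs_mul_abs_self, pow_two]

section Superposition

variable {α : Type*} [MeasurableSpace α] {μ : Measure α}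

theorem inner_eq_integral_mul (u v : Lp ℝ 2 μ) : ⟪u, v⟫_ℝ = ∫ x, u x * v x ∂μ := by
  simp only [L2.inner_def, RCLike.inner_apply, conj_trivial, mul_comm]

variable [IsFiniteMeasure μ] {g : ℝ → ℝ} {L : NNReal}

theorem memLp_comp_of_lipschitzWith (hg : LipschitzWith L g) (u : Lp ℝ 2 μ) :
    MemLp (fun x => g (u x)) 2 μ := by
  have hconst : MemLp (fun _ => ‖g 0‖) 2 μ := memLp_const _
  have hmul : MemLp (fun x => (L : ℝ) * ‖u x‖) 2 μ := (Lp.memLp u).norm.const_mul _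
  refine (hconst.add hmul).mono'
    (hg.continuous.comp_aestronglyMeasurable (Lp.aestronglyMeasurable u))
    (.of_forall fun x => ?_)
  have hlip := hg.norm_sub_le (u x) 0
  rw [sub_zero] at hlip
  rw [Pi.add_apply]
  linarith [norm_sub_norm_le (g (u x)) (g 0)]

/-- The superposition operator `u ↦ g ∘ u` on `L²` of a finite measure. -/
noncomputable def superposition (hg : LipschitzWith L g) (u : Lp ℝ 2 μ) : Lp ℝ 2 μ :=
  (memLp_comp_of_lipschitzWith hg u).toLp _

theorem coeFn_superposition (hg : LipschitzWith L g) (u : Lp ℝ 2 μ) :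
    superposition hg u =ᵐ[μ] fun x => g (u x) :=
  (memLp_comp_of_lipschitzWith hg u).coeFn_toLp

theorem lipschitzWith_superposition (hg : LipschitzWith L g) :
    LipschitzWith L (superposition hg : Lp ℝ 2 μ → Lp ℝ 2 μ) := by
  refine LipschitzWith.of_dist_le_mul fun u v => ?_
  rw [dist_eq_norm, dist_eq_norm]
  refine Lp.norm_le_mul_norm_of_ae_le_mul ?_
  filter_upwards [coeFn_superposition hg u, coeFn_superposition hg v,
    Lp.coeFn_sub (superposition hg u) (superposition hg v), Lp.coeFn_sub u v]
    with x hgu hgv hgsub hsub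
  rw [hgsub, hsub, Pi.sub_apply, Pi.sub_apply, hgu, hgv]
  exact hg.norm_sub_le _ _

theorem integrable_primitive_comp (hg : LipschitzWith L g) (u : Lp ℝ 2 μ) :
    Integrable (fun x => ∫ q in (0 : ℝ)..(u x), g q) μ := by
  have hcont : Continuous fun s : ℝ => ∫ q in (0 : ℝ)..s, g q :=
    intervalIntegral.continuous_primitive (fun a b => hg.continuous.intervalIntegrable a b) 0
  have hbound : Integrable (fun x => L * u x ^ 2 + |g 0| * |u x|) μ :=
    ((Lp.memLp u).integrable_sq.const_mul _).add
      (((Lp.memLp u).integrable one_le_two).abs.const_mul _)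
  refine hbound.mono' (hcont.comp_aestronglyMeasurable (Lp.aestronglyMeasurable u))
    (.of_forall fun x => ?_)
  have hquad := abs_primitive_sub_sub_le hg (u x) 0
  rw [intervalIntegral.integral_same, sub_zero, sub_zero] at hquad
  rw [Real.norm_eq_abs, ← abs_mul]
  linarith [abs_sub_abs_le_abs_sub (∫ q in (0 : ℝ)..(u x), g q) (g 0 * u x)]

/-- The potential of the superposition operator of `g`: the integral of the primitive of `g`
vanishing at `0`. -/
noncomputable def potential (g : ℝ → ℝ) (u : Lp ℝ 2 μ) : ℝ :=
  ∫ x, (∫ q in (0 : ℝ)..(u x), g q) ∂μ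

theorem abs_potential_sub_sub_inner_le (hg : LipschitzWith L g) (u v : Lp ℝ 2 μ) :
    |potential g u - potential g v - ⟪superposition hg v, u - v⟫_ℝ| ≤ L * ‖u - v‖ ^ 2 := by
  have hsq : ‖u - v‖ ^ 2 = ∫ x, (u - v) x ^ 2 ∂μ := by
    rw [← real_inner_self_eq_norm_sq, inner_eq_integral_mul]
    simp only [pow_two]
  have hmul : Integrable (fun x => superposition hg v x * (u - v) x) μ :=
    (Lp.memLp _).integrable_mul (Lp.memLp _)
  have hprim : Integrable (fun x => (∫ q in (0 : ℝ)..(u x), g q) -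
      ∫ q in (0 : ℝ)..(v x), g q) μ :=
    (integrable_primitive_comp hg u).sub (integrable_primitive_comp hg v)
  rw [potential, potential, inner_eq_integral_mul,
    ← integral_sub (integrable_primitive_comp hg u) (integrable_primitive_comp hg v),
    ← integral_sub hprim hmul, hsq, ← integral_const_mul, ← Real.norm_eq_abs]
  refine norm_integral_le_of_norm_le ((Lp.memLp (u - v)).integrable_sq.const_mul _) ?_
  filter_upwards [coeFn_superposition hg v, Lp.coeFn_sub u v] with x hgv hsub
  rw [hgv, hsub, Pi.sub_apply]
  exact abs_primitive_sub_sub_le hg _ _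

end Superposition

/-! ### One-sided Lipschitz gradient curves -/

section OneSidedLipschitz

variable {H : Type*} [NormedAddCommGroup H] [InnerProductSpace ℝ H] {v g : ℝ → H} {L : ℝ}

theorem norm_sub_le_exp_mul_norm_sub {v₁ v₂ g₁ g₂ : ℝ → H} {s t : ℝ} (hst : s ≤ t)
    (hv₁ : ∀ r ∈ Set.Icc s t, HasDerivAt v₁ (g₁ r) r)
    (hv₂ : ∀ r ∈ Set.Icc s t, HasDerivAt v₂ (g₂ r) r)
    (hlip : ∀ r ∈ Set.Icc s t, ⟪v₁ r - v₂ r, g₁ r - g₂ r⟫_ℝ ≤ L * ‖v₁ r - v₂ r‖ ^ 2) :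
    ‖v₁ t - v₂ t‖ ≤ Real.exp (L * (t - s)) * ‖v₁ s - v₂ s‖ := by
  have hsq : ‖v₁ t - v₂ t‖ ^ 2 ≤ ‖v₁ s - v₂ s‖ ^ 2 * Real.exp (2 * L * (t - s)) :=
    le_mul_exp_of_deriv_le_mul hst (fun r hr => ((hv₁ r hr).sub (hv₂ r hr)).norm_sq) fun r hr => by
      simp only [Pi.sub_apply]
      linarith [hlip r hr]
  refine le_of_sq_le_sq (hsq.trans_eq ?_) (by positivity)
  rw [mul_pow, ← Real.exp_nat_mul, mul_comm]
  push_cast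
  ring_nf

theorem norm_deriv_le_exp_mul_norm_deriv (hv : ∀ t > 0, HasDerivAt v (g t) t)
    (hlip : ∀ s > 0, ∀ t > 0, ⟪v s - v t, g s - g t⟫_ℝ ≤ L * ‖v s - v t‖ ^ 2) {s t : ℝ}
    (hs : 0 < s) (hst : s ≤ t) : ‖g t‖ ≤ Real.exp (L * (t - s)) * ‖g s‖ := by
  refine le_of_tendsto_of_tendsto (hv t (hs.trans_le hst)).tendsto_slope_zero_right.norm
    ((hv s hs).tendsto_slope_zero_right.norm.const_mul (Real.exp (L * (t - s)))) ?_
  filter_upwards [self_mem_nhdsWithin] with h (hh : 0 < h)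
  have hcontr := norm_sub_le_exp_mul_norm_sub (v₁ := fun r => v (r + h)) hst
    (fun r hr => (hv (r + h) (add_pos (hs.trans_le hr.1) hh)).comp_add_const r h)
    (fun r hr => hv r (hs.trans_le hr.1))
    fun r hr => hlip _ (add_pos (hs.trans_le hr.1) hh) _ (hs.trans_le hr.1)
  rw [norm_smul, norm_smul, mul_left_comm]
  gcongr

namespace IsGradientCurve

variable {E : ℝ → ℝ} {c C : ℝ}

theorem exists_tendsto_energy (h : IsGradientCurve v g E) (hE : ∀ t > 0, E t ≤ C) :
    ∃ c, Tendsto E atTop (𝓝 c) := by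
  have hmem : ∀ᶠ t in atTop, E t ∈ Set.Icc (E 1) C := by
    filter_upwards [eventually_ge_atTop 1] with t ht
    have hpos : 0 < t := one_pos.trans_le ht
    exact ⟨h.monotoneOn (Set.mem_Ioi.2 one_pos) hpos ht, hE t hpos⟩
  obtain ⟨c, -, hc⟩ := isCompact_Icc.exists_mapClusterPt_of_frequently hmem.frequently
  exact ⟨c, tendsto_of_monotoneOn_of_mapClusterPt h.monotoneOn hc⟩

theorem tendsto_velocity_zero (h : IsGradientCurve v g E) (hc : Tendsto E atTop (𝓝 c))
    (hlip : ∀ s > 0, ∀ t > 0, ⟪v s - v t, g s - g t⟫_ℝ ≤ L * ‖v s - v t‖ ^ 2) :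
    Tendsto g atTop (𝓝 0) := by
  have hgap : Tendsto (fun t => E t - E (t - 1)) atTop (𝓝 0) := by
    have hshift : Tendsto (fun t : ℝ => t - 1) atTop atTop :=
      tendsto_atTop_add_const_right atTop (-1 : ℝ) tendsto_id
    simpa using hc.sub (hc.comp hshift)
  have hbound : Tendsto (fun t => Real.exp |L| * √(E t - E (t - 1))) atTop (𝓝 0) := by
    simpa using hgap.sqrt.const_mul (Real.exp |L|)
  refine squeeze_zero_norm' ?_ hbound
  filter_upwards [eventually_gt_atTop 1] with t ht
  obtain ⟨r, ⟨hr, hrt⟩, hslope⟩ := h.exists_norm_sq_eq_slope (sub_pos.2 ht) (sub_one_lt t)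
  rw [sub_sub_cancel, div_one] at hslope
  rw [← hslope, Real.sqrt_sq (norm_nonneg _)]
  refine (norm_deriv_le_exp_mul_norm_deriv h.hasDerivAt hlip (by linarith) hrt.le).trans ?_
  gcongr
  calc L * (t - r) ≤ |L| * (t - r) := by
        gcongr
        exact le_abs_self L
    _ ≤ |L| * 1 := by
        gcongr
        linarith
    _ = |L| := mul_one _

end IsGradientCurve

end OneSidedLipschitz

/-! ### Semilinear polyharmonic flows -/

section Semilinear

variable {N : ℕ} {Ω : Set (EuclideanSpace ℝ (Fin N))} [IsFiniteMeasure (volume.restrict Ω)]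
  {m : ℕ} {g : ℝ → ℝ} {L : NNReal}

/-- The right-hand side `(-1)^(m+1) Δ^m u + g(u)` of the parabolic equation. -/
noncomputable def vectorField (hg : LipschitzWith L g) (x : dirichletDomain Ω m) : L2 Ω :=
  polyLaplacianCLM Ω m x + superposition hg (toL2CLM Ω m x)

theorem continuous_vectorField (hg : LipschitzWith L g) :
    Continuous (vectorField hg : dirichletDomain Ω m → L2 Ω) :=
  (polyLaplacianCLM Ω m).continuous.add
    ((lipschitzWith_superposition hg).continuous.comp (toL2CLM Ω m).continuous)

/-- The energy `∫ (½ u (-1)^(m+1) Δ^m u + ∫₀ᵘ g)`, whose `L²` gradient is `vectorField`. -/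
noncomputable def energy (g : ℝ → ℝ) (x : dirichletDomain Ω m) : ℝ :=
  ⟪polyLaplacianCLM Ω m x, toL2CLM Ω m x⟫_ℝ / 2 + potential g (toL2CLM Ω m x)

theorem abs_energy_sub_sub_inner_le (hg : LipschitzWith L g) (x y : dirichletDomain Ω m) :
    |energy g x - energy g y - ⟪vectorField hg y, toL2CLM Ω m (x - y)⟫_ℝ| ≤
      (1 / 2 + L) * ‖x - y‖ * ‖toL2CLM Ω m (x - y)‖ := by
  have hexpand : energy g x - energy g y - ⟪vectorField hg y, toL2CLM Ω m (x - y)⟫_ℝ =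
      ⟪polyLaplacianCLM Ω m (x - y), toL2CLM Ω m (x - y)⟫_ℝ / 2 +
      (potential g (toL2CLM Ω m x) - potential g (toL2CLM Ω m y) -
        ⟪superposition hg (toL2CLM Ω m y), toL2CLM Ω m x - toL2CLM Ω m y⟫_ℝ) := by
    simp only [energy, vectorField, map_sub, inner_add_left, inner_sub_left, inner_sub_right]
    rw [inner_polyLaplacianCLM_symm x y]
    ring
  have hform : |⟪polyLaplacianCLM Ω m (x - y), toL2CLM Ω m (x - y)⟫_ℝ / 2| ≤
      ‖x - y‖ * ‖toL2CLM Ω m (x - y)‖ / 2 := by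
    rw [abs_div, abs_two]
    gcongr
    refine (abs_real_inner_le_norm _ _).trans ?_
    gcongr
    exact norm_polyLaplacianCLM_le _
  have hpot := abs_potential_sub_sub_inner_le hg (toL2CLM Ω m x) (toL2CLM Ω m y)
  calc _ ≤ ‖x - y‖ * ‖toL2CLM Ω m (x - y)‖ / 2 +
        L * ‖toL2CLM Ω m x - toL2CLM Ω m y‖ ^ 2 := by
        rw [hexpand]
        exact (abs_add_le _ _).trans (add_le_add hform hpot)
    _ ≤ ‖x - y‖ * ‖toL2CLM Ω m (x - y)‖ / 2 + L * (‖x - y‖ * ‖toL2CLM Ω m (x - y)‖) := by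
        rw [← map_sub, pow_two]
        gcongr
        exact norm_toL2CLM_le _
    _ = (1 / 2 + L) * ‖x - y‖ * ‖toL2CLM Ω m (x - y)‖ := by ring

theorem hasEmbeddedGradientAt_energy (hg : LipschitzWith L g) (y : dirichletDomain Ω m) :
    HasEmbeddedGradientAt (toL2CLM Ω m) (energy g) (vectorField hg y) y := by
  refine Asymptotics.isLittleO_iff.2 fun ε hε => ?_
  have hsmall : Tendsto (fun x => (1 / 2 + (L : ℝ)) * ‖x - y‖) (𝓝 y) (𝓝 0) := by
    have : ContinuousAt (fun x => (1 / 2 + (L : ℝ)) * ‖x - y‖) y := by fun_prop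
    simpa [ContinuousAt] using this
  filter_upwards [hsmall.eventually_lt_const hε] with x hx
  refine (abs_energy_sub_sub_inner_le hg x y).trans ?_
  gcongr

theorem energy_le (hg : LipschitzWith L g) {x : dirichletDomain Ω m} {R : ℝ}
    (hx : ‖toL2CLM Ω m x‖ ≤ R) :
    energy g x ≤ potential g (0 : L2 Ω) + ‖superposition hg (0 : L2 Ω)‖ * R + L * R ^ 2 := by
  have hpot := (abs_le.1 (abs_potential_sub_sub_inner_le hg (toL2CLM Ω m x) 0)).2
  rw [sub_zero] at hpot
  have hinner : ⟪superposition hg (0 : L2 Ω), toL2CLM Ω m x⟫_ℝ ≤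
      ‖superposition hg (0 : L2 Ω)‖ * R := (real_inner_le_norm _ _).trans (by gcongr)
  have hsq : (L : ℝ) * ‖toL2CLM Ω m x‖ ^ 2 ≤ L * R ^ 2 := by gcongr
  rw [energy]
  linarith [inner_polyLaplacianCLM_nonpos x]

theorem inner_vectorField_sub_le (hg : LipschitzWith L g) (x y : dirichletDomain Ω m) :
    ⟪toL2CLM Ω m x - toL2CLM Ω m y, vectorField hg x - vectorField hg y⟫_ℝ ≤
      L * ‖toL2CLM Ω m x - toL2CLM Ω m y‖ ^ 2 := by
  have hdiss : ⟪toL2CLM Ω m x - toL2CLM Ω m y, polyLaplacianCLM Ω m (x - y)⟫_ℝ ≤ 0 := by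
    rw [← map_sub, real_inner_comm]
    exact inner_polyLaplacianCLM_nonpos (x - y)
  have hlip : ⟪toL2CLM Ω m x - toL2CLM Ω m y,
      superposition hg (toL2CLM Ω m x) - superposition hg (toL2CLM Ω m y)⟫_ℝ ≤
      ‖toL2CLM Ω m x - toL2CLM Ω m y‖ * (L * ‖toL2CLM Ω m x - toL2CLM Ω m y‖) := by
    refine (real_inner_le_norm _ _).trans ?_
    gcongr
    exact (lipschitzWith_superposition hg).norm_sub_le _ _
  rw [vectorField, vectorField, add_sub_add_comm, ← map_sub (polyLaplacianCLM Ω m),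
    inner_add_right]
  linarith

theorem norm_polyLaplacianCLM_le_add (hg : LipschitzWith L g) (x : dirichletDomain Ω m) :
    ‖polyLaplacianCLM Ω m x‖ ≤
      ‖vectorField hg x‖ + (‖superposition hg (0 : L2 Ω)‖ + L * ‖toL2CLM Ω m x‖) := by
  have hlip := (lipschitzWith_superposition hg).norm_sub_le (toL2CLM Ω m x) 0
  rw [sub_zero] at hlip
  calc ‖polyLaplacianCLM Ω m x‖ = ‖vectorField hg x - superposition hg (toL2CLM Ω m x)‖ := by
        rw [vectorField, add_sub_cancel_right]
    _ ≤ ‖vectorField hg x‖ + ‖superposition hg (toL2CLM Ω m x)‖ := norm_sub_le _ _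
    _ ≤ _ := by
        gcongr
        linarith [norm_sub_norm_le (superposition hg (toL2CLM Ω m x)) (superposition hg 0)]

variable {u : ℝ → dirichletDomain Ω m} {R : ℝ}

theorem IsOrbit.tendsto_vectorField {hg : LipschitzWith L g}
    (hu : IsOrbit (toL2CLM Ω m) (vectorField hg) u) (hR : ∀ t > 0, ‖toL2CLM Ω m (u t)‖ ≤ R) :
    Tendsto (fun t => vectorField hg (u t)) atTop (𝓝 0) := by
  have hcurve := hu.isGradientCurve (hasEmbeddedGradientAt_energy hg)
  obtain ⟨c, hc⟩ := hcurve.exists_tendsto_energy fun t ht => energy_le hg (hR t ht)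
  exact hcurve.tendsto_velocity_zero hc fun s _ t _ => inner_vectorField_sub_le hg (u s) (u t)

theorem IsOrbit.precompactAtTop (hm : 0 < m) {hg : LipschitzWith L g}
    (hu : IsOrbit (toL2CLM Ω m) (vectorField hg) u) (hR : ∀ t > 0, ‖toL2CLM Ω m (u t)‖ ≤ R) :
    PrecompactAtTop u := by
  intro s hs
  have hvel := (hu.tendsto_vectorField hR).comp hs
  have hev : ∀ᶠ n in atTop, 0 < s n ∧ ‖vectorField hg (u (s n))‖ < 1 :=
    (hs.eventually_gt_atTop 0).and
      ((tendsto_zero_iff_norm_tendsto_zero.1 hvel).eventually_lt_const one_pos)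
  obtain ⟨n₀, hn₀⟩ := eventually_atTop.1 hev
  have hbound (n : ℕ) : ‖u (s (n + n₀))‖ ≤
      max R (1 + (‖superposition hg (0 : L2 Ω)‖ + L * R)) := by
    obtain ⟨hpos, hlt⟩ := hn₀ (n + n₀) (Nat.le_add_left _ _)
    rw [norm_eq_max]
    refine max_le_max (hR _ hpos) ((norm_polyLaplacianCLM_le_add hg _).trans ?_)
    gcongr
    exact hR _ hpos
  obtain ⟨a, φ, hφ, ha⟩ := exists_subseq_tendsto_toL2CLM hm hbound
  have hφ' : StrictMono fun n => φ n + n₀ := fun i j hij => Nat.add_lt_add_right (hφ hij) _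
  have hpoly : Tendsto (fun n => polyLaplacianCLM Ω m (u (s (φ n + n₀)))) atTop
      (𝓝 (0 - superposition hg a)) := by
    refine ((hvel.comp hφ'.tendsto_atTop).sub
      (((lipschitzWith_superposition hg).continuous.tendsto a).comp ha)).congr fun n => ?_
    simp [vectorField]
  obtain ⟨y, hy, -⟩ := exists_tendsto_of_tendsto ha hpoly
  exact ⟨y, _, hφ', hy⟩

end Semilinear

/-! ### Differentiability of superposition operators along compact embeddings -/

section SuperpositionDerivative

variable {α : Type*} [MeasurableSpace α] {μ : Measure α}

theorem tendsto_zero_of_ae_norm_le [IsFiniteMeasure μ] {r z : ℕ → Lp ℝ 2 μ} {l : Lp ℝ 2 μ}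
    (hz : Tendsto z atTop (𝓝 l)) (hle : ∀ n, ∀ᵐ p ∂μ, ‖r n p‖ ≤ ‖z n p‖)
    (hr : ∀ᵐ p ∂μ, Tendsto (fun n => r n p) atTop (𝓝 0)) : Tendsto r atTop (𝓝 0) := by
  have hz_unif : UnifIntegrable (fun n => ⇑(z n)) 2 μ :=
    unifIntegrable_of_tendsto_Lp one_le_two ENNReal.ofNat_ne_top (fun n => Lp.memLp _) (Lp.memLp l)
      (Lp.tendsto_Lp_iff_tendsto_eLpNorm' z l |>.1 hz)
  have hr_unif : UnifIntegrable (fun n => ⇑(r n)) 2 μ := fun ε hε => by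
    obtain ⟨δ, hδ, hsmall⟩ := hz_unif hε
    refine ⟨δ, hδ, fun n s hs hμs => (eLpNorm_mono_ae ?_).trans (hsmall n s hs hμs)⟩
    filter_upwards [hle n] with p hp
    rw [norm_indicator_eq_indicator_norm, norm_indicator_eq_indicator_norm]
    exact Set.indicator_le_indicator hp
  rw [Lp.tendsto_Lp_iff_tendsto_eLpNorm']
  refine (tendsto_Lp_finite_of_tendsto_ae one_le_two ENNReal.ofNat_ne_top
    (fun n => Lp.aestronglyMeasurable _) (Lp.memLp 0) hr_unif ?_)
  filter_upwards [hr, Lp.coeFn_zero ℝ 2 μ] with p hp hzero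
  rwa [hzero]

/-- Multiplication by a bounded function on `L²`. -/
noncomputable def mulCLM (b : Lp ℝ ⊤ μ) : Lp ℝ 2 μ →L[ℝ] Lp ℝ 2 μ :=
  (ContinuousLinearMap.mul ℝ ℝ).holderL μ ⊤ 2 2 b

theorem coeFn_mulCLM (b : Lp ℝ ⊤ μ) (u : Lp ℝ 2 μ) : mulCLM b u =ᵐ[μ] fun p => b p * u p :=
  (ContinuousLinearMap.mul ℝ ℝ).coeFn_holder b u

theorem exists_subseq_tendsto_ae {x : ℕ → Lp ℝ 2 μ} {l : Lp ℝ 2 μ} (hx : Tendsto x atTop (𝓝 l)) :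
    ∃ φ : ℕ → ℕ, StrictMono φ ∧ ∀ᵐ p ∂μ, Tendsto (fun n => x (φ n) p) atTop (𝓝 (l p)) :=
  (tendstoInMeasure_of_tendsto_Lp hx).exists_seq_tendsto_ae

variable [IsFiniteMeasure μ] {g : ℝ → ℝ} {L : NNReal} {b : Lp ℝ ⊤ μ} {ψ : Lp ℝ 2 μ}

theorem coeFn_smul_superposition_sub_sub_mulCLM (hg : LipschitzWith L g) (b : Lp ℝ ⊤ μ) (c : ℝ)
    (u v : Lp ℝ 2 μ) : c • (superposition hg u - superposition hg v - mulCLM b (u - v)) =ᵐ[μ]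
      fun p => c * (g (u p) - g (v p) - b p * (u p - v p)) := by
  filter_upwards [coeFn_superposition hg u, coeFn_superposition hg v, coeFn_mulCLM b (u - v),
    Lp.coeFn_sub u v, Lp.coeFn_sub (superposition hg u) (superposition hg v),
    Lp.coeFn_sub (superposition hg u - superposition hg v) (mulCLM b (u - v)),
    Lp.coeFn_smul c (superposition hg u - superposition hg v - mulCLM b (u - v))]
    with p hu hv hmul hsub hsup hrem hsmul
  simp only [hsmul, Pi.smul_apply, hrem, Pi.sub_apply, hsup, hu, hv, hmul, hsub, smul_eq_mul]

theorem tendsto_smul_superposition_sub_sub_mulCLM (hg : LipschitzWith L g)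
    (hb : ∀ᵐ p ∂μ, HasStrictDerivAt g (b p) (ψ p)) {x y : ℕ → Lp ℝ 2 μ} {c : ℕ → ℝ}
    {l : Lp ℝ 2 μ} (hx : ∀ᵐ p ∂μ, Tendsto (fun n => x n p) atTop (𝓝 (ψ p)))
    (hy : ∀ᵐ p ∂μ, Tendsto (fun n => y n p) atTop (𝓝 (ψ p)))
    (hl : Tendsto (fun n => c n • (x n - y n)) atTop (𝓝 l))
    (hl_ae : ∀ᵐ p ∂μ, Tendsto (fun n => (c n • (x n - y n)) p) atTop (𝓝 (l p))) :
    Tendsto (fun n => c n • (superposition hg (x n) - superposition hg (y n) -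
      mulCLM b (x n - y n))) atTop (𝓝 0) := by
  have hquot (n) : c n • (x n - y n) =ᵐ[μ] fun p => c n * (x n p - y n p) := by
    filter_upwards [Lp.coeFn_smul (c n) (x n - y n), Lp.coeFn_sub (x n) (y n)] with p hsmul hsub
    simp only [hsmul, Pi.smul_apply, hsub, Pi.sub_apply, smul_eq_mul]
  have hrem (n) := coeFn_smul_superposition_sub_sub_mulCLM hg b (c n) (x n) (y n)
  refine tendsto_zero_of_ae_norm_le (hl.const_smul (2 * L : ℝ)) (fun n => ?_) ?_
  · filter_upwards [hb, hrem n, hquot n, Lp.coeFn_smul (2 * L : ℝ) (c n • (x n - y n))]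
      with p hbp hrem hquot hsmul
    have hb_le : ‖b p‖ ≤ L := hbp.hasDerivAt.le_of_lipschitz hg
    rw [hrem, hsmul, Pi.smul_apply, hquot, smul_eq_mul, mul_left_comm, norm_mul, norm_mul (c n)]
    gcongr
    calc ‖g (x n p) - g (y n p) - b p * (x n p - y n p)‖
        ≤ ‖g (x n p) - g (y n p)‖ + ‖b p‖ * ‖x n p - y n p‖ := by
          rw [← norm_mul]
          exact norm_sub_le _ _
      _ ≤ L * ‖x n p - y n p‖ + L * ‖x n p - y n p‖ := by
          gcongr
          exact hg.norm_sub_le _ _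
      _ = ‖2 * (L : ℝ) * (x n p - y n p)‖ := by
          rw [norm_mul, Real.norm_of_nonneg (by positivity : (0 : ℝ) ≤ 2 * L)]
          ring
  · filter_upwards [hb, hx, hy, hl_ae, ae_all_iff.2 hrem, ae_all_iff.2 hquot]
      with p hbp hxp hyp hlp hrem hquot
    simp only [hrem]
    simp only [hquot] at hlp
    have hlittle : (fun n => c n * (g (x n p) - g (y n p) - b p * (x n p - y n p))) =o[atTop]
        fun n => c n * (x n p - y n p) := by
      refine (Asymptotics.isBigO_refl c atTop).mul_isLittleO ?_
      have := hbp.isLittleO.comp_tendsto (hxp.prodMk_nhds hyp)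
      simpa [Function.comp_def, mul_comm] using this
    exact (hlittle.trans_isBigO (hlp.isBigO_one ℝ)).tendsto_zero_of_tendsto tendsto_const_nhds

variable {X : Type*} [NormedAddCommGroup X] [NormedSpace ℝ X] {ι : X →L[ℝ] Lp ℝ 2 μ}

theorem hasStrictFDerivAt_superposition_comp
    (hι : ∀ (x : ℕ → X) (C : ℝ), (∀ n, ‖x n‖ ≤ C) →
      ∃ a, ∃ φ : ℕ → ℕ, StrictMono φ ∧ Tendsto (fun n => ι (x (φ n))) atTop (𝓝 a))
    (hg : LipschitzWith L g) {ψ : X} (hb : ∀ᵐ p ∂μ, HasStrictDerivAt g (b p) (ι ψ p)) :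
    HasStrictFDerivAt (fun x => superposition hg (ι x)) (mulCLM b ∘L ι) ψ := by
  refine HasStrictFDerivAt.of_isLittleO (Asymptotics.isLittleO_norm_norm.1 ?_)
  rw [Asymptotics.isLittleO_iff_tendsto fun q hq => by simp [sub_eq_zero.1 (norm_eq_zero.1 hq)]]
  refine tendsto_of_subseq_tendsto fun q hq => ?_
  have hfst : Tendsto (fun n => ι (q n).1) atTop (𝓝 (ι ψ)) :=
    ((ι.continuous.comp continuous_fst).tendsto (ψ, ψ)).comp hq
  have hsnd : Tendsto (fun n => ι (q n).2) atTop (𝓝 (ι ψ)) :=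
    ((ι.continuous.comp continuous_snd).tendsto (ψ, ψ)).comp hq
  set c : ℕ → ℝ := fun n => ‖(q n).1 - (q n).2‖⁻¹
  have hunit (n) : ‖c n • ((q n).1 - (q n).2)‖ ≤ 1 := by
    rw [norm_smul, norm_inv, norm_norm]
    exact inv_mul_le_one
  obtain ⟨l, φ, hφ, hl⟩ := hι _ 1 hunit
  simp only [map_smul, map_sub] at hl
  obtain ⟨φl, hφl, hl_ae⟩ := exists_subseq_tendsto_ae hl
  have hφ₁ := hφ.comp hφl
  obtain ⟨φx, hφx, hx_ae⟩ := exists_subseq_tendsto_ae (hfst.comp hφ₁.tendsto_atTop)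
  have hφ₂ := hφ₁.comp hφx
  obtain ⟨φy, hφy, hy_ae⟩ := exists_subseq_tendsto_ae (hsnd.comp hφ₂.tendsto_atTop)
  refine ⟨((φ ∘ φl) ∘ φx) ∘ φy, ?_⟩
  have hrem := (tendsto_smul_superposition_sub_sub_mulCLM hg hb
    (hx_ae.mono fun p hp => hp.comp hφy.tendsto_atTop) hy_ae
    (hl.comp (hφl.comp (hφx.comp hφy)).tendsto_atTop)
    (hl_ae.mono fun p hp => hp.comp (hφx.comp hφy).tendsto_atTop)).norm
  rw [norm_zero] at hrem
  refine hrem.congr fun n => ?_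
  rw [norm_smul, norm_inv, norm_norm, inv_mul_eq_div]
  simp only [Function.comp_apply, ContinuousLinearMap.comp_apply, map_sub]

end SuperpositionDerivative

/-! ### The linearization at an equilibrium -/

section SemiFredholm

variable {F X : Type*} [NormedAddCommGroup F] [NormedSpace ℝ F] [NormedAddCommGroup X]
  [NormedSpace ℝ X]

theorem finiteDimensional_ker_of_exists_subseq {L : X →L[ℝ] F}
    (hL : ∀ x : ℕ → X, (∀ n, ‖x n‖ ≤ 1) → Tendsto (fun n => L (x n)) atTop (𝓝 0) →
      ∃ y, ∃ φ : ℕ → ℕ, StrictMono φ ∧ Tendsto (fun n => x (φ n)) atTop (𝓝 y)) :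
    FiniteDimensional ℝ L.ker := by
  refine FiniteDimensional.of_isCompact_closedBall₀ ℝ one_pos ?_
  refine IsSeqCompact.isCompact fun x hx => ?_
  obtain ⟨y, φ, hφ, hy⟩ := hL (fun n => x n) (fun n => mem_closedBall_zero_iff.1 (hx n)) (by simp)
  have hker : y ∈ L.ker := L.isClosed_ker.mem_of_tendsto hy (.of_forall fun n => (x (φ n)).2)
  have hlim : Tendsto (x ∘ φ) atTop (𝓝 ⟨y, hker⟩) := tendsto_subtype_rng.2 hy
  exact ⟨⟨y, hker⟩, Metric.isClosed_closedBall.mem_of_tendsto hlim (.of_forall fun n => hx _),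
    φ, hφ, hlim⟩

theorem isSemiFredholm_of_exists_subseq {L : X →L[ℝ] F}
    (hL : ∀ x : ℕ → X, (∀ n, ‖x n‖ ≤ 1) → Tendsto (fun n => L (x n)) atTop (𝓝 0) →
      ∃ y, ∃ φ : ℕ → ℕ, StrictMono φ ∧ Tendsto (fun n => x (φ n)) atTop (𝓝 y)) :
    IsSemiFredholm L := by
  have := finiteDimensional_ker_of_exists_subseq hL
  obtain ⟨P, hP⟩ := Submodule.ClosedComplemented.of_finiteDimensional L.ker
  refine ⟨this, P, hP, ?_⟩
  by_contra! hunbounded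
  choose w hwP hw using fun n : ℕ => hunbounded (n + 1)
  have hpos (n) : 0 < ‖w n‖ := (by positivity : 0 ≤ ((n : ℝ) + 1) * ‖L (w n)‖).trans_lt (hw n)
  have hunit (n) : ‖‖w n‖⁻¹ • w n‖ = 1 := norm_smul_inv_norm (norm_pos_iff.1 (hpos n))
  have hsmall (n) : ‖L (‖w n‖⁻¹ • w n)‖ ≤ 1 / ((n : ℝ) + 1) := by
    rw [map_smul, norm_smul, norm_inv, norm_norm, inv_mul_le_iff₀ (hpos n), mul_one_div,
      le_div_iff₀' (by positivity)]
    exact (hw n).le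
  obtain ⟨y, φ, hφ, hy⟩ := hL _ (fun n => (hunit n).le)
    (squeeze_zero_norm hsmall tendsto_one_div_add_atTop_nhds_zero_nat)
  have hPy : P y = 0 := tendsto_nhds_unique ((P.continuous.tendsto y).comp hy) (by
    simp [Function.comp_def, hwP])
  have hLy : L y = 0 := tendsto_nhds_unique ((L.continuous.tendsto y).comp hy)
    ((squeeze_zero_norm hsmall tendsto_one_div_add_atTop_nhds_zero_nat).comp hφ.tendsto_atTop)
  have hy_unit : ‖y‖ = 1 := tendsto_nhds_unique hy.norm (by simp only [hunit, tendsto_const_nhds])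
  have hy_zero : y = 0 := congrArg Subtype.val ((hP ⟨y, hLy⟩).symm.trans hPy)
  simp [hy_zero] at hy_unit

end SemiFredholm

section Linearization

variable {N : ℕ} {Ω : Set (EuclideanSpace ℝ (Fin N))} {m : ℕ}

variable (m) in
/-- The operator `(-1)^(m+1) Δ^m + b` with a bounded potential `b`. -/
noncomputable def linearization (b : Lp ℝ ⊤ (volume.restrict Ω)) : dirichletDomain Ω m →L[ℝ] L2 Ω :=
  polyLaplacianCLM Ω m + mulCLM b ∘L toL2CLM Ω m

variable [IsFiniteMeasure (volume.restrict Ω)]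

theorem isSemiFredholm_linearization (hm : 0 < m) (b : Lp ℝ ⊤ (volume.restrict Ω)) :
    IsSemiFredholm (linearization m b) := by
  refine isSemiFredholm_of_exists_subseq fun x hx hLx => ?_
  obtain ⟨a, φ, hφ, ha⟩ := exists_subseq_tendsto_toL2CLM hm hx
  have hpoly : Tendsto (fun n => polyLaplacianCLM Ω m (x (φ n))) atTop (𝓝 (0 - mulCLM b a)) := by
    refine ((hLx.comp hφ.tendsto_atTop).sub
      (((mulCLM b).continuous.tendsto a).comp ha)).congr fun n => ?_
    simp [linearization]
  obtain ⟨y, hy, -⟩ := exists_tendsto_of_tendsto ha hpoly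
  exact ⟨y, φ, hφ, hy⟩

theorem hasStrictFDerivAt_vectorField (hm : 0 < m) {g : ℝ → ℝ} {L : NNReal}
    (hg : LipschitzWith L g) {ψ : dirichletDomain Ω m} {b : Lp ℝ ⊤ (volume.restrict Ω)}
    (hb : ∀ᵐ p ∂volume.restrict Ω, HasStrictDerivAt g (b p) (toL2CLM Ω m ψ p)) :
    HasStrictFDerivAt (vectorField hg) (linearization m b) ψ :=
  (polyLaplacianCLM Ω m).hasStrictFDerivAt.add
    (hasStrictFDerivAt_superposition_comp (fun _ _ => exists_subseq_tendsto_toL2CLM hm) hg hb)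

end Linearization

/-! ### Convergence of bounded solutions of the parabolic equation -/

section Parabolic

theorem exists_lipschitzWith_eventuallyEq {f : ℝ → ℝ} (hf : ContDiff ℝ 1 f) (M : ℝ) :
    ∃ (g : ℝ → ℝ) (L : NNReal), LipschitzWith L g ∧ ∀ s, |s| ≤ M → g =ᶠ[𝓝 s] f := by
  set K := |M| + 1
  obtain ⟨L, hL⟩ := hf.contDiffOn.exists_lipschitzOnWith one_ne_zero (convex_Icc (-K) K)
    isCompact_Icc
  have hle : -K ≤ K := neg_le_self (by positivity)
  refine ⟨Set.IccExtend hle ((Set.Icc (-K) K).domRestrict f), L * 1,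
    hL.to_restrict.comp (LipschitzWith.projIcc hle), fun s hs => ?_⟩
  have hsK : |s| < K := (hs.trans (le_abs_self M)).trans_lt (lt_add_one _)
  filter_upwards [continuous_abs.continuousAt.eventually_lt_const hsK] with r hr
  exact Set.IccExtend_of_mem hle _ (abs_le.1 hr.le)

variable {N : ℕ} {Ω : Set (EuclideanSpace ℝ (Fin N))} {m : ℕ} {f : ℝ → ℝ} {M : ℝ}

theorem isClosed_setOf_boundedBy : IsClosed {x : dirichletDomain Ω m | BoundedBy M x} := by
  refine isSeqClosed_iff_isClosed.1 fun x y hx hxy => ?_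
  obtain ⟨φ, -, hφ⟩ := exists_subseq_tendsto_ae (((toL2CLM Ω m).continuous.tendsto y).comp hxy)
  change ∀ᵐ p ∂(volume.restrict Ω), |toL2 y p| ≤ M
  filter_upwards [hφ, ae_all_iff.2 hx] with p hp hle
  exact le_of_tendsto hp.abs (.of_forall fun n => hle (φ n))

theorem exists_coeFn_eq_deriv_comp (hf : ContDiff ℝ 1 f) {ψ : dirichletDomain Ω m}
    (hψ : BoundedBy M ψ) : ∃ b : Lp ℝ ⊤ (volume.restrict Ω),
      b =ᵐ[volume.restrict Ω] fun p => deriv f (toL2 ψ p) := by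
  have hcont : Continuous (deriv f) := hf.continuous_deriv le_rfl
  obtain ⟨B, hB⟩ := (isCompact_Icc (a := -M) (b := M)).exists_bound_of_continuousOn
    hcont.continuousOn
  have hmem : MemLp (fun p => deriv f (toL2 ψ p)) ⊤ (volume.restrict Ω) :=
    memLp_top_of_bound (hcont.comp_aestronglyMeasurable (Lp.aestronglyMeasurable _)) B
      (Eventually.mono hψ fun p hp => hB _ (abs_le.1 hp))
  exact ⟨hmem.toLp _, hmem.coeFn_toLp⟩

theorem ker_linearization {ψ : dirichletDomain Ω m} {b : Lp ℝ ⊤ (volume.restrict Ω)}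
    (hb : b =ᵐ[volume.restrict Ω] fun p => deriv f (toL2 ψ p)) :
    (linearization m b).ker = pdeKernel f ψ := by
  ext v
  have hcoe : linearization m b v =ᵐ[volume.restrict Ω]
      fun p => polyLaplacian v p + deriv f (toL2 ψ p) * toL2 v p := by
    filter_upwards [hb, Lp.coeFn_add (polyLaplacianCLM Ω m v) (mulCLM b (toL2CLM Ω m v)),
      coeFn_mulCLM b (toL2CLM Ω m v)] with p hbp hadd hmul
    change (polyLaplacianCLM Ω m v + mulCLM b (toL2CLM Ω m v)) p = _
    rw [hadd, Pi.add_apply, hmul, hbp]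
    rfl
  rw [LinearMap.mem_ker, ContinuousLinearMap.coe_coe, Lp.eq_zero_iff_ae_eq_zero]
  exact ⟨hcoe.symm.trans, hcoe.trans⟩

variable {g : ℝ → ℝ}

theorem BoundedBy.energy_congr (hfg : ∀ s, |s| ≤ M → g s = f s) {x : dirichletDomain Ω m}
    (hx : BoundedBy M x) : energy g x = energy f x := by
  refine congrArg _ (integral_congr_ae (Eventually.mono hx fun p hp => ?_))
  refine intervalIntegral.integral_congr fun s hs => hfg s (le_trans ?_ hp)
  simpa [toL2CLM_apply] using Set.abs_sub_left_of_mem_uIcc hs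

variable [IsFiniteMeasure (volume.restrict Ω)] {L : NNReal}

theorem BoundedBy.norm_toL2CLM_le {x : dirichletDomain Ω m} (hx : BoundedBy M x) :
    ‖toL2CLM Ω m x‖ ≤ (volume.restrict Ω).real Set.univ ^ (2 : ENNReal).toReal⁻¹ * |M| :=
  Lp.norm_le_of_ae_bound (abs_nonneg M) (Eventually.mono hx fun _ hp => hp.trans (le_abs_self M))

theorem BoundedBy.coeFn_vectorField (hg : LipschitzWith L g) (hfg : ∀ s, |s| ≤ M → g s = f s)
    {x : dirichletDomain Ω m} (hx : BoundedBy M x) :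
    vectorField hg x =ᵐ[volume.restrict Ω] fun p => polyLaplacian x p + f (toL2 x p) := by
  filter_upwards [hx, Lp.coeFn_add (polyLaplacianCLM Ω m x) (superposition hg (toL2CLM Ω m x)),
    coeFn_superposition hg (toL2CLM Ω m x)] with p hp hadd hsup
  rw [vectorField, hadd, Pi.add_apply, hsup, polyLaplacianCLM_apply, toL2CLM_apply, hfg _ hp]

theorem mem_pdeEquilibria_iff (hg : LipschitzWith L g) (hfg : ∀ s, |s| ≤ M → g s = f s)
    {x : dirichletDomain Ω m} :
    x ∈ pdeEquilibria Ω m f M ↔ BoundedBy M x ∧ vectorField hg x = 0 := by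
  refine and_congr_right fun hx => ?_
  rw [Lp.eq_zero_iff_ae_eq_zero]
  have hcoe := hx.coeFn_vectorField hg hfg
  exact ⟨hcoe.trans, hcoe.symm.trans⟩

theorem isBigO_energy_sub_of_hasSurfaceThrough (hm : 0 < m) (hf : ContDiff ℝ 1 f)
    (hg : LipschitzWith L g) (hfg : ∀ s, |s| ≤ M → g =ᶠ[𝓝 s] f) {ψ : dirichletDomain Ω m}
    (hsurf : HasSurfaceThrough (pdeEquilibria Ω m f M) ψ (Module.finrank ℝ (pdeKernel f ψ))) :
    (fun x => energy g x - energy g ψ) =O[𝓝 ψ] fun x => ‖vectorField hg x‖ ^ 2 := by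
  have hψ : ψ ∈ pdeEquilibria Ω m f M := by
    obtain ⟨p, hp₀, -, -, hp⟩ := hsurf
    exact hp₀ ▸ hp.self_of_nhds
  obtain ⟨b, hb⟩ := exists_coeFn_eq_deriv_comp hf hψ.1
  have hderiv : ∀ᵐ p ∂volume.restrict Ω, HasStrictDerivAt g (b p) (toL2CLM Ω m ψ p) := by
    filter_upwards [hψ.1, hb] with p hp hbp
    rw [hbp]
    exact (hf.contDiffAt.hasStrictDerivAt one_ne_zero).congr_of_eventuallyEq (hfg _ hp).symm
  rw [← ker_linearization hb] at hsurf
  exact isBigO_norm_sq_of_hasSurfaceThrough (hasEmbeddedGradientAt_energy hg)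
    (hasStrictFDerivAt_vectorField hm hg hderiv) (isSemiFredholm_linearization hm b)
    (hasSurfaceThrough_mono
      (fun x hx => ((mem_pdeEquilibria_iff hg fun s hs => (hfg s hs).eq_of_nhds).1 hx).2) hsurf)

-- The surface may leave the set of functions bounded by `M`, on which `g` agrees with `f`, so the
-- inequality is first proved for a nonlinearity that agrees with `f` on a longer interval.
theorem isBigO_energy_sub_nhdsWithin_boundedBy (hm : 0 < m) (hf : ContDiff ℝ 1 f)
    (hg : LipschitzWith L g) (hfg : ∀ s, |s| ≤ M → g s = f s) {ψ : dirichletDomain Ω m}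
    (hψ : BoundedBy M ψ) {M' : ℝ}
    (hsurf : HasSurfaceThrough (pdeEquilibria Ω m f M') ψ (Module.finrank ℝ (pdeKernel f ψ))) :
    (fun x => energy g x - energy g ψ) =O[𝓝[{x | BoundedBy M x}] ψ]
      fun x => ‖vectorField hg x‖ ^ 2 := by
  obtain ⟨g', L', hg', hfg'⟩ := exists_lipschitzWith_eventuallyEq hf (max M M')
  have hloj := (isBigO_energy_sub_of_hasSurfaceThrough hm hf hg'
    (fun s hs => hfg' s (hs.trans (le_max_right M M'))) hsurf).mono
    (nhdsWithin_le_nhds (s := {x | BoundedBy M x}))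
  have hfg'M (s) (hs : |s| ≤ M) : g' s = f s := (hfg' s (hs.trans (le_max_left M M'))).eq_of_nhds
  refine hloj.congr' ?_ ?_ <;> filter_upwards [self_mem_nhdsWithin] with x (hx : BoundedBy M x)
  · rw [hx.energy_congr hfg, hψ.energy_congr hfg, hx.energy_congr hfg'M, hψ.energy_congr hfg'M]
  · rw [Lp.ext ((hx.coeFn_vectorField hg hfg).trans (hx.coeFn_vectorField hg' hfg'M).symm)]

theorem IsPdeOrbit.isOrbit (hg : LipschitzWith L g) (hfg : ∀ s, |s| ≤ M → g s = f s)
    {u : ℝ → dirichletDomain Ω m} (hu : IsPdeOrbit f u) (hM : ∀ t > 0, BoundedBy M (u t)) :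
    IsOrbit (toL2CLM Ω m) (vectorField hg) u where
  continuousOn := hu.continuousOn
  equation t ht := by
    obtain ⟨w, hw, hae⟩ := hu.equation t ht
    rwa [Lp.ext (((hM t ht).coeFn_vectorField hg hfg).trans (EventuallyEq.symm hae))]

theorem IsPdeOrbit.exists_tendsto (hΩ : IsOpen Ω) (hm : 0 < m) (hf : ContDiff ℝ 1 f)
    (hR : PdeResonanceBranching Ω m f) {u : ℝ → dirichletDomain Ω m}
    (hu : IsPdeOrbit f u) (hM : ∀ t > 0, BoundedBy M (u t)) :
    ∃ ψ ∈ pdeEquilibria Ω m f M, Tendsto u atTop (𝓝 ψ) ∧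
      (pdeKernel f ψ = ⊥ ∨ PdeBranchingAt f ψ →
        ConvergesExponentially (fun t => toL2 (u t)) (toL2 ψ)) := by
  obtain ⟨g, L, hg, hgf⟩ := exists_lipschitzWith_eventuallyEq hf M
  have hfg (s) (hs : |s| ≤ M) : g s = f s := (hgf s hs).eq_of_nhds
  have horbit := hu.isOrbit hg hfg hM
  have hnorm := fun t ht => (hM t ht).norm_toL2CLM_le
  refine horbit.exists_tendsto (hasEmbeddedGradientAt_energy hg) (injective_toL2CLM hΩ)
    (continuous_vectorField hg) (horbit.precompactAtTop hm hnorm)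
    (S := {x | BoundedBy M x}) hM hnorm
    (fun ψ hψ hzero => ?_) (fun ψ hψ hP => ?_) fun ψ _ hP hacc => hP (.inr ⟨M, hacc⟩)
  · exact (mem_pdeEquilibria_iff hg hfg).2 ⟨isClosed_setOf_boundedBy.mem_of_mapClusterPt hψ
      ((eventually_gt_atTop 0).mono hM), hzero⟩
  · obtain ⟨M', hsurf⟩ : ∃ M', HasSurfaceThrough (pdeEquilibria Ω m f M') ψ
        (Module.finrank ℝ (pdeKernel f ψ)) := by
      rcases hP with hbot | hbranch
      · exact ⟨M, hasSurfaceThrough_finrank hψ (.inl hbot)⟩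
      · by_cases hker : 1 ≤ Module.finrank ℝ (pdeKernel f ψ)
        · exact hR M ψ hψ hbranch hker
        · exact ⟨M, hasSurfaceThrough_finrank hψ (.inr fun h => absurd h hker)⟩
    exact isBigO_energy_sub_nhdsWithin_boundedBy hm hf hg hfg hψ.1 hsurf

end Parabolic

end GradientFlow

theorem mainTheorem2_general :
    (∀ (H : Type*) [NormedAddCommGroup H] [InnerProductSpace ℝ H]
        (X : Type*) [NormedAddCommGroup X] [NormedSpace ℝ X] [CompleteSpace X]
        (ι : X →L[ℝ] H) (V : X → ℝ) (V' : X → H),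
      GradientFlow.IsGradientSystem ι V V' →
      (∀ ψ ∈ GradientFlow.equilibria V', GradientFlow.IsSemiFredholm (fderiv ℝ V' ψ)) →
      GradientFlow.ResonanceBranching V' →
      ∀ u : ℝ → X, GradientFlow.IsSmoothOrbit ι V' u →
        Bornology.IsBounded (u '' Set.Ioi 0) →
        ∃ ψ ∈ GradientFlow.equilibria V',
          Tendsto u atTop (𝓝 ψ) ∧
          ((fderiv ℝ V' ψ).ker = ⊥ ∨ AccPt ψ (𝓟 (GradientFlow.equilibria V')) →
            GradientFlow.ConvergesExponentially (fun t => ι (u t)) (ι ψ))) ∧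
    (∀ (N m : ℕ) (Ω : Set (EuclideanSpace ℝ (Fin N))) (f : ℝ → ℝ),
      0 < m → IsOpen Ω → volume Ω ≠ ⊤ → ContDiff ℝ 1 f →
      GradientFlow.PdeResonanceBranching Ω m f →
      ∀ (u : ℝ → GradientFlow.dirichletDomain Ω m) (M : ℝ), GradientFlow.IsPdeOrbit f u →
        (∀ t > 0, GradientFlow.BoundedBy M (u t)) →
        ∃ ψ ∈ GradientFlow.pdeEquilibria Ω m f M,
          Tendsto u atTop (𝓝 ψ) ∧
          (GradientFlow.pdeKernel f ψ = ⊥ ∨ GradientFlow.PdeBranchingAt f ψ →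
            GradientFlow.ConvergesExponentially
              (fun t => GradientFlow.toL2 (u t)) (GradientFlow.toL2 ψ))) := by
  refine ⟨fun H _ _ X _ _ _ ι V V' hS hF hR u hu hb => hS.exists_tendsto hF hR hu hb,
    fun N m Ω f hm hΩ hvol hf hR u M hu hM => ?_⟩
  have := isFiniteMeasure_restrict.2 hvol
  exact hu.exists_tendsto hΩ hm hf hR hM

theorem mainTheorem2 :
    -- smooth gradient systems in a separable Hilbert space
    (∀ (H : Type*) [NormedAddCommGroup H] [InnerProductSpace ℝ H] [CompleteSpace H]
        [TopologicalSpace.SeparableSpace H]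
        (X : Type*) [NormedAddCommGroup X] [NormedSpace ℝ X] [CompleteSpace X]
        (ι : X →L[ℝ] H) (V : X → ℝ) (V' : X → H),
      GradientFlow.IsGradientSystem ι V V' →
      (∀ ψ ∈ GradientFlow.equilibria V',
        GradientFlow.IsFredholmIndexZero (fderiv ℝ V' ψ) ∧
        GradientFlow.HasDiscreteSelfAdjointExtension ι (fderiv ℝ V' ψ)) →
      GradientFlow.ResonanceBranching V' →
      ∀ u : ℝ → X, GradientFlow.IsSmoothOrbit ι V' u →
        Bornology.IsBounded (u '' Set.Ioi 0) →
        ∃ ψ ∈ GradientFlow.equilibria V',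
          Tendsto u atTop (𝓝 ψ) ∧
          ((fderiv ℝ V' ψ).ker = ⊥ ∨ AccPt ψ (𝓟 (GradientFlow.equilibria V')) →
            GradientFlow.ConvergesExponentially (fun t => ι (u t)) (ι ψ))) ∧
    -- parabolic equations of order `2m`
    (∀ (N m : ℕ) (Ω : Set (EuclideanSpace ℝ (Fin N))) (f : ℝ → ℝ),
      0 < N → 0 < m → IsOpen Ω → Bornology.IsBounded Ω → ContDiff ℝ 1 f →
      GradientFlow.PdeResonanceBranching Ω m f →
      ∀ (u : ℝ → GradientFlow.dirichletDomain Ω m) (M : ℝ), GradientFlow.IsPdeOrbit f u →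
        (∀ t > 0, GradientFlow.BoundedBy M (u t)) →
        ∃ ψ ∈ GradientFlow.pdeEquilibria Ω m f M,
          Tendsto u atTop (𝓝 ψ) ∧
          (GradientFlow.pdeKernel f ψ = ⊥ ∨ GradientFlow.PdeBranchingAt f ψ →
            GradientFlow.ConvergesExponentially
              (fun t => GradientFlow.toL2 (u t)) (GradientFlow.toL2 ψ))) := by
  obtain ⟨hgradient, hparabolic⟩ := mainTheorem2_general
  exact ⟨fun H _ _ _ _ X _ _ _ ι V V' hS hF => hgradient H X ι V V' hS fun ψ hψ =>
      GradientFlow.isSemiFredholm_of_isFredholm (hF ψ hψ).1.1,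
    fun N m Ω f _ hm hΩ hb => hparabolic N m Ω f hm hΩ hb.measure_lt_top.ne⟩
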